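/- **Setting.** For integers $A,B$ with $\Delta=B^2(A^2-4B)\neq0$ let $E:\ y^2=x^3+Ax^2+Bx$ and $E':\ y^2=x^3-2Ax^2+(A^2-4B)x$. Let $D\subseteq\mathbb{Q}^*/{\mathbb{Q}^*}^2$ be the subgroup generated by $-1$ and the primes dividing $\Delta$, and let $M$ consist of $\infty$ and the primes dividing $\Delta$ (with $\mathbb{Q}_\infty=\mathbb{R}$). For $p\in M$ define $\delta'_p:E(\mathbb{Q}_p)\to\mathbb{Q}_p^*/{\mathbb{Q}_p^*}^2$ by $O\mapsto1$, $(0,0)\mapsto B$, and $(x,y)\mapsto x$ for all other points; define $\delta_p:E'(\mathbb{Q}_p)\to\mathbb{Q}_p^*/{\mathbb{Q}_p^*}^2$ in the same way, with $A^2-4B$ in place of $B$. Put $$S'(E)=\{d\in D: d\in\mathrm{Im}(\delta'_p)\ \text{for all}\ p\in M\},\qquad S(E)=\{d\in D: d\in\mathrm{Im}(\delta_p)\ \text{for all}\ p\in M\}.$$ For a squarefree integer $m\neq 0,\pm1$, let $G(m)$ be the directed graph whose vertex set $V$ consists of the primes dividing $m$, together with $-1$ if $m<0$, with an arc $p\to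 v$ whenever $p\in V$ is a prime with $p\equiv1\pmod3$, $v\in V$ and $\left(\frac{v}{p}\right)=-1$. For $V_1\subseteq V$ write $\overline{V}_1=V\setminus V_1$ and $d(V_1)=\prod_{v\in V_1}v$. The partition $(V_1,\overline{V}_1)$ is nontrivial if $V_1$ and $\overline{V}_1$ are both nonempty. It is odd if some $v\in V_1$ has an odd number of arcs to $\overline{V}_1$, or some $v\in\overline{V}_1$ has an odd number of arcs to $V_1$. **Theorem 5.2.** Let $n=3p_1\cdots p_tq_1\cdots q_s\equiv3\pmod{24}$, where $p_i\equiv1\pmod3$ and $q_j\equiv2\pmod3$ are distinct primes $\geq5$ and $t+s\geq1$. Let $P=p_1\cdots p_t$, $Q=q_1\cdots q_s$ (empty products are $1$), and let $E=E_{n,2\pi/3}:\ y^2=x(x+n)(x-3n)$. (I.1) If $PQ\equiv1\pmod3$, then $S'(E)=\{1,-n,n/3,-3\}$ if and only if $s\in\{0,2\}$ and the following holds in $G(-n)$: - if $s=0$: every nontrivial partition $(V_1,\overline{V}_1)$ of $V=\{-1,3,p_1,\dots,p_t\}$ with $d(V_1)\neq-3,P$ and $d(V_1)\equiv1\pmod4$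 is odd; - if $s=2$: every nontrivial partition $(V_1,\overline{V}_1)$ of $V=\{-1,3,p_1,\dots,p_t,q_1,q_2\}$ with $d(V_1)\neq Pq_1q_2$ and $d(V_1)\equiv1\pmod{12}$ is odd. (I.2) If $PQ\equiv2\pmod3$, then $S'(E)=\{1,-n,n/3,-3\}$ if and only if $s=1$ and, in $G(-n)$, every nontrivial partition $(V_1,\overline{V}_1)$ of $V=\{-1,3,p_1,\dots,p_t,q_1\}$ with $d(V_1)\neq-3,Pq_1$ and $d(V_1)\equiv1\pmod4$ is odd. (II.1) If $PQ\equiv1\pmod3$ and $s\in\{0,2\}$, then $S(E)=\{1\}$ if and only if $s=2$ and, in $G(n)$, every nontrivial partition $(V_1,\overline{V}_1)$ of $V=\{3,p_1,\dots,p_t,q_1,q_2\}$ with $V_1\subseteq\{3,p_1,\dots,p_t\}$ and $\left(\frac{d(V_1)}{q_1}\right)=\left(\frac{d(V_1)}{q_2}\right)=1$ is odd. In particular $S(E)\neq\{1\}$ when $s=0$. (II.2) If $PQ\equiv2\pmod3$ and $s=1$, then $S(E)=\{1\}$ if and only if, in $G(n)$, every nontrivial partition $(V_1,\overline{V}_1)$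 of $V=\{3,p_1,\dots,p_t,q_1\}$ with $V_1\subseteq\{p_1,\dots,p_t\}$ and $\left(\frac{d(V_1)}{q_1}\right)=1$ is odd. -/

import Mathlib

noncomputable section

open scoped Classical in
/-- The class in `Kˣ ⧸ (Kˣ)²` of a nonzero element of a field; the value at `0` is never relevant. -/
def sqClass {K : Type*} [Field K] (x : K) : Kˣ ⧸ Subgroup.square Kˣ :=
  if hx : x ≠ 0 then QuotientGroup.mk (Units.mk0 x hx) else 1

/-- The natural map `ℚˣ ⧸ (ℚˣ)² → Kˣ ⧸ (Kˣ)²` for a field extension `K` of `ℚ`. -/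
def localMap (K : Type*) [Field K] [CharZero K] :
    (ℚˣ ⧸ Subgroup.square ℚˣ) →* (Kˣ ⧸ Subgroup.square Kˣ) :=
  QuotientGroup.map _ _ (Units.map (Rat.castHom K : ℚ →* K)) (by
    intro x hx
    simp only [Subgroup.mem_square, Subgroup.mem_comap] at hx ⊢
    exact hx.map _)

/-- The curve `y² = x³ + A x² + B x` over the field `K`. -/
def curve (A B : ℤ) (K : Type*) [Field K] : WeierstrassCurve.Affine K :=
  { a₁ := 0, a₂ := (A : K), a₃ := 0, a₄ := (B : K), a₆ := 0 }

open scoped Classical in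
/-- The descent map on the `K`-points of `y² = x³ + A x² + B x`:
`O ↦ 1`, `(0, 0) ↦ B`, and `(x, y) ↦ x` otherwise, modulo squares. -/
def descentMap (A B : ℤ) (K : Type*) [Field K] :
    (curve A B K).Point → Kˣ ⧸ Subgroup.square Kˣ
  | .zero => 1
  | .some x _ _ => if x = 0 then sqClass (B : K) else sqClass x

/-- `Δ = B² (A² - 4 B)`, the discriminant of the right-hand side of `y² = x³ + A x² + B x`. -/
def disc (A B : ℤ) : ℤ := B ^ 2 * (A ^ 2 - 4 * B)

/-- `D`: the subgroup of `ℚˣ ⧸ (ℚˣ)²` generated by `-1` and the primes dividing `Δ(A, B)`. -/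
def groupD (A B : ℤ) : Subgroup (ℚˣ ⧸ Subgroup.square ℚˣ) :=
  Subgroup.closure
    ({sqClass (-1 : ℚ)} ∪ {c | ∃ p : ℕ, p.Prime ∧ (p : ℤ) ∣ disc A B ∧ c = sqClass (p : ℚ)})

/-- `S'(E)` for `E : y² = x³ + A x² + B x`: the elements of `D` lying, at the real place and at
every prime dividing `Δ`, in the image of the descent map of `E` over the completion. -/
def selmerS' (A B : ℤ) : Set (ℚˣ ⧸ Subgroup.square ℚˣ) :=
  {d | d ∈ groupD A B ∧ localMap ℝ d ∈ Set.range (descentMap A B ℝ) ∧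
    ∀ (p : ℕ) [Fact p.Prime], (p : ℤ) ∣ disc A B →
      localMap ℚ_[p] d ∈ Set.range (descentMap A B ℚ_[p])}

/-- `S(E)` for `E : y² = x³ + A x² + B x`: the same with the descent map of the 2-isogenous curve
`E' : y² = x³ + A' x² + B' x`, `A' = -2 A`, `B' = A² - 4 B`, in place of that of `E`. -/
def selmerS (A B : ℤ) : Set (ℚˣ ⧸ Subgroup.square ℚˣ) :=
  {d | d ∈ groupD A B ∧
    localMap ℝ d ∈ Set.range (descentMap (-2 * A) (A ^ 2 - 4 * B) ℝ) ∧
    ∀ (p : ℕ) [Fact p.Prime], (p : ℤ) ∣ disc A B →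
      localMap ℚ_[p] d ∈ Set.range (descentMap (-2 * A) (A ^ 2 - 4 * B) ℚ_[p])}

/-- Coefficient of `x²` in `x (x + n) (x - 3 n) = x³ + A x² + B x`. -/
def coeffA (n : ℤ) : ℤ := -2 * n

/-- Coefficient of `x` in `x (x + n) (x - 3 n) = x³ + A x² + B x`. -/
def coeffB (n : ℤ) : ℤ := -3 * n ^ 2

/-- The two coefficients are those of `E_{n, 2π/3} : y² = x (x + n) (x - 3 n)`. -/
theorem coeff_spec (n : ℤ) (x : ℚ) :
    x * (x + n) * (x - 3 * n) = x ^ 3 + (coeffA n : ℚ) * x ^ 2 + (coeffB n : ℚ) * x := by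
  simp only [coeffA, coeffB]
  push_cast
  ring

/-- The vertex set of `G(m)`: the primes dividing `m`, together with `-1` if `m < 0`. -/
def vertices (m : ℤ) : Finset ℤ :=
  m.natAbs.primeFactors.image (fun p : ℕ => (p : ℤ)) ∪ (if m < 0 then {-1} else ∅)

/-- The directed graph `G(m)`: there is an arc `p → v` exactly when `p ≡ 1 (mod 3)` is a prime
vertex and the Legendre symbol `(v / p)` is `-1`. -/
def graphG (m : ℤ) : Digraph (vertices m) where
  Adj u v := ∃ (p : ℕ) (_ : Fact p.Prime),
    (u : ℤ) = (p : ℤ) ∧ p ≡ 1 [MOD 3] ∧ legendreSym p (v : ℤ) = -1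

open scoped Classical in
/-- The number of arcs from the vertex `v` to the vertex set `W`. -/
def arcsTo {V : Type*} (Γ : Digraph V) (v : V) (W : Finset V) : ℕ :=
  (W.filter (fun w => Γ.Adj v w)).card

open scoped Classical in
/-- The partition `{V₁, V₁ᶜ}` of the vertex set is odd: some vertex of one part has an odd number
of arcs to the other part. -/
def IsOddPartition {V : Type*} [Fintype V] (Γ : Digraph V) (V₁ : Finset V) : Prop :=
  (∃ v ∈ V₁, Odd (arcsTo Γ v V₁ᶜ)) ∨ (∃ v ∈ V₁ᶜ, Odd (arcsTo Γ v V₁))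

open scoped Classical in
/-- The partition `{V₁, V₁ᶜ}` is nontrivial: both parts are nonempty. -/
def IsNontrivialPartition {V : Type*} [Fintype V] (V₁ : Finset V) : Prop :=
  V₁.Nonempty ∧ V₁ᶜ.Nonempty

/-- `d(V₁)`, the product of the vertices in `V₁`. -/
def prodV {m : ℤ} (V₁ : Finset (vertices m)) : ℤ := ∏ v ∈ V₁, (v : ℤ)

end

/-! This is a complete 2-isogeny descent. Write `n = 3m`, with `s` the number of primes dividing `m`
that are 2 mod 3. The image of each local descent map is computed exactly, and the local conditions
are then read off as parities in the graph.

Local images for `E`. Over ℝ the map is onto. At 2 the image is `{1, -3}`, which for integers prime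
to 4 means `d ≡ 1 (mod 4)`. At a prime `p ≡ 1 (mod 3)` dividing `n` it is `{1, -n}`. At a prime `q ≡
2 (mod 3)` dividing `n` it is everything, since `-3` is a nonresidue and the 2-torsion alone
supplies all four classes. At 3 it is `{1, -n}` if `m ≡ 1 (mod 3)` and everything if `m ≡ 2 (mod
3)`. For `E'` the images are, in the same order: the positive reals, the units at 2, `{1, n}`, the
trivial group, and at 3 either `{1, n}` or the trivial group. The shape of a point follows from
comparing the valuations of `x` and `n`: either the cofactor of `x` is a known constant times a
1-unit, or the right-hand side has odd valuation unless `x/n` reduces to a root.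

Global translation. Selmer classes are represented by squarefree `d` dividing `n`, that is by `d =
d(V₁)` for a vertex set `V₁`, with cofactor `e`. For `p` dividing `de = ∓n`, the class of `d` lies
in `{1, de}` at `p` exactly when `(e/p) = 1` (if `p ∣ d`) or `(d/p) = 1` (if not): this is `EvenAt`.
Since `(d(W)/p)` is `-1` to the number of arcs from `p` to `W`, a partition fails to be odd exactly
when `EvenAt` holds at all the `p_i` (`not_isOddPartition_iff`).

What is left is the prime 3 and the size of `s`. The four classes `1, -n, n/3, -3` always lie in
`S'(E)`. If `s ≥ 3`, there are so few sign conditions on the vertices that at least eight classes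
survive (`selmerS'_ne_of_three_le_card`); the parity of `s` is fixed by `m` mod 3. For `s = 0` the
condition at 3 follows from quadratic reciprocity (`evenAt_three_of_reciprocity`). For `m ≡ 1 (mod
3)` in general, passing to the complement makes `d` prime to 3, and the conditions at 2 and 3 merge
into `d ≡ 1 (mod 12)`. For `S(E)` the conditions at the `q_j` force `V₁` to avoid them, which
settles the condition at 3 up to excluding the vertex 3 itself; for `s = 0` the class of `n` is a
nontrivial member. -/

/-! ### Square classes and the image of the descent map -/

theorem isSquare_mul_self_left_iff {K : Type*} [Field K] {c x : K} (hc : c ≠ 0) :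
    IsSquare (c ^ 2 * x) ↔ IsSquare x := by
  constructor
  · rintro ⟨r, hr⟩
    refine ⟨r / c, ?_⟩
    field_simp
    linear_combination hr
  · rintro ⟨r, rfl⟩
    exact ⟨c * r, by ring⟩

theorem isSquare_of_isSquare_mul {K : Type*} [Field K] {a b : K} (hb : b ≠ 0)
    (hab : IsSquare (a * b)) (hsb : IsSquare b) : IsSquare a := by
  obtain ⟨r, hr⟩ := hab
  obtain ⟨s, rfl⟩ := hsb
  have hs : s ≠ 0 := by rintro rfl; simp at hb
  refine ⟨r / s, ?_⟩
  field_simp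
  linear_combination hr

theorem sqClass_eq_iff {K : Type*} [Field K] {a b : K} (ha : a ≠ 0) (hb : b ≠ 0) :
    sqClass a = sqClass b ↔ IsSquare (a * b) := by
  rw [sqClass, sqClass, dif_pos ha, dif_pos hb, QuotientGroup.eq, Subgroup.mem_square]
  constructor
  · rintro ⟨r, hr⟩
    have h := congrArg (Units.val) hr
    simp only [Units.val_mul, Units.val_inv_eq_inv_val, Units.val_mk0] at h
    refine ⟨a * r, ?_⟩
    field_simp at h
    linear_combination a * h
  · rintro ⟨r, hr⟩
    have hr0 : r ≠ 0 := by rintro rfl; simp [ha, hb] at hr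
    refine ⟨(Units.mk0 a ha)⁻¹ * Units.mk0 r hr0, ?_⟩
    ext
    simp only [Units.val_mul, Units.val_inv_eq_inv_val, Units.val_mk0]
    field_simp
    linear_combination hr

theorem sqClass_mul {K : Type*} [Field K] {a b : K} (ha : a ≠ 0) (hb : b ≠ 0) :
    sqClass (a * b) = sqClass a * sqClass b := by
  rw [sqClass, sqClass, sqClass, dif_pos ha, dif_pos hb, dif_pos (mul_ne_zero ha hb),
    Units.mk0_mul, QuotientGroup.mk_mul]

theorem sqClass_one {K : Type*} [Field K] : sqClass (1 : K) = 1 := by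
  rw [sqClass, dif_pos one_ne_zero, Units.mk0_one, QuotientGroup.mk_one]

theorem sqClass_inv {K : Type*} [Field K] {a : K} (ha : a ≠ 0) : (sqClass a)⁻¹ = sqClass a := by
  rw [inv_eq_iff_mul_eq_one, ← sqClass_mul ha ha, ← sqClass_one,
    sqClass_eq_iff (mul_ne_zero ha ha) one_ne_zero]
  exact ⟨a, by ring⟩

theorem localMap_sqClass (K : Type*) [Field K] [CharZero K] {a : ℚ} (ha : a ≠ 0) :
    localMap K (sqClass a) = sqClass (a : K) := by
  have h : (a : K) ≠ 0 := by exact_mod_cast ha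
  rw [sqClass, sqClass, dif_pos ha, dif_pos h, localMap, QuotientGroup.map_mk]
  congr 1
  ext
  simp

theorem curve_equation_iff (A B : ℤ) (K : Type*) [Field K] (x y : K) :
    (curve A B K).Equation x y ↔ y ^ 2 = x ^ 3 + A * x ^ 2 + B * x := by
  rw [WeierstrassCurve.Affine.equation_iff]
  simp [curve]

theorem curve_nonsingular {A B : ℤ} {K : Type*} [Field K] [CharZero K] (hΔ : disc A B ≠ 0)
    {x y : K} (h : y ^ 2 = x ^ 3 + A * x ^ 2 + B * x) : (curve A B K).Nonsingular x y := by
  have hd : (curve A B K).Δ = 16 * ((disc A B : ℤ) : K) := by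
    simp [WeierstrassCurve.Δ, WeierstrassCurve.b₂, WeierstrassCurve.b₄, WeierstrassCurve.b₆,
      WeierstrassCurve.b₈, curve, disc]
    ring
  have h0 : (curve A B K).Δ ≠ 0 := by
    rw [hd]
    exact mul_ne_zero (by norm_num) (by exact_mod_cast hΔ)
  exact ((curve A B K).equation_iff_nonsingular_of_Δ_ne_zero h0).1
    ((curve_equation_iff A B K x y).2 h)

/-- Removes points and quotient groups from the problem: every later local computation is about
squares in `K`. Nonsingularity is automatic because the discriminant is nonzero. -/
theorem sqClass_mem_range_descentMap_iff {A B : ℤ} (hΔ : disc A B ≠ 0) {K : Type*} [Field K]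
    [CharZero K] {a : K} (ha : a ≠ 0) :
    sqClass a ∈ Set.range (descentMap A B K) ↔ IsSquare a ∨ IsSquare (a * B) ∨
      ∃ x y : K, x ≠ 0 ∧ y ^ 2 = x ^ 3 + A * x ^ 2 + B * x ∧ IsSquare (a * x) := by
  have hB : (B : K) ≠ 0 := by
    have : B ≠ 0 := by rintro rfl; simp [disc] at hΔ
    exact_mod_cast this
  constructor
  · rintro ⟨P, hP⟩
    cases P with
    | zero =>
      left
      rw [descentMap, ← sqClass_one, sqClass_eq_iff one_ne_zero ha, one_mul] at hP
      exact hP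
    | some x y h =>
      right
      rw [descentMap] at hP
      split_ifs at hP with hx
      · left
        rw [sqClass_eq_iff hB ha, mul_comm] at hP
        exact hP
      · right
        rw [sqClass_eq_iff hx ha, mul_comm] at hP
        exact ⟨x, y, hx, (curve_equation_iff A B K x y).1 h.1, hP⟩
  · rintro (h | h | ⟨x, y, hx, hxy, h⟩)
    · refine ⟨.zero, ?_⟩
      rw [descentMap, ← sqClass_one, sqClass_eq_iff one_ne_zero ha, one_mul]
      exact h
    · refine ⟨.some 0 0 (curve_nonsingular hΔ (by ring)), ?_⟩
      rw [descentMap, if_pos rfl, sqClass_eq_iff hB ha, mul_comm]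
      exact h
    · refine ⟨.some x y (curve_nonsingular hΔ hxy), ?_⟩
      rw [descentMap, if_neg hx, sqClass_eq_iff hx ha, mul_comm]
      exact h

/-! ### Squares in `ℚ_p` -/

section Padic
variable {p : ℕ} [Fact p.Prime]

/-- Hensel's lemma for `X² - z` at 1, where the derivative is 2. Keeping the factor `‖2‖²` makes it
serve `p = 2` as well, as the condition modulo 8. -/
theorem padicInt_isSquare_of_norm_sub_one_lt {z : ℤ_[p]} (h : ‖z - 1‖ < ‖(2 : ℤ_[p])‖ ^ 2) :
    IsSquare z := by
  obtain ⟨r, hr, -⟩ := hensels_lemma (p := p) (R := ℤ_[p]) (F := Polynomial.X ^ 2 - Polynomial.C z)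
    (a := 1) (by
      simpa [one_add_one_eq_two, ← norm_neg (z - 1)] using h)
  refine ⟨r, ?_⟩
  simp only [map_sub, map_pow, Polynomial.aeval_X, Polynomial.aeval_C, Algebra.algebraMap_self,
    RingHom.id_apply] at hr
  linear_combination -hr

theorem padic_norm_le_one_of_norm_sub_one_lt {z : ℚ_[p]} (h : ‖z - 1‖ < 1) : ‖z‖ ≤ 1 := by
  have := Padic.nonarchimedean (z - 1) 1
  simp only [sub_add_cancel, norm_one] at this
  exact this.trans (max_le h.le le_rfl)

theorem padic_norm_intCast_eq_one {k : ℤ} (h : ¬ (p : ℤ) ∣ k) : ‖(k : ℚ_[p])‖ = 1 :=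
  le_antisymm (Padic.norm_int_le_one k) (not_lt.1 fun h' => h (Padic.norm_intCast_lt_one_iff.1 h'))

theorem padic_norm_two (hp : p ≠ 2) : ‖(2 : ℚ_[p])‖ = 1 := by
  have h := padic_norm_intCast_eq_one (p := p) (k := 2) (by
    intro h
    have h' : p ∣ 2 := by exact_mod_cast h
    exact hp ((Nat.prime_dvd_prime_iff_eq Fact.out Nat.prime_two).1 h'))
  simpa using h

theorem padic_isSquare_of_norm_sub_one_lt (hp : p ≠ 2) {z : ℚ_[p]} (h : ‖z - 1‖ < 1) :
    IsSquare z := by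
  obtain ⟨r, hr⟩ := padicInt_isSquare_of_norm_sub_one_lt
    (z := ⟨z, padic_norm_le_one_of_norm_sub_one_lt h⟩) (by
      have h2 : ‖(2 : ℤ_[p])‖ = 1 := by
        rw [PadicInt.norm_def, show ((2 : ℤ_[p]) : ℚ_[p]) = 2 by norm_cast, padic_norm_two hp]
      rw [h2, one_pow]
      exact h)
  exact ⟨r, congrArg Subtype.val hr⟩

theorem padic_not_isSquare_of_norm {z : ℚ_[p]} {k : ℤ} (hz : ‖z‖ = (p : ℝ) ^ k) (hk : Odd k) :
    ¬ IsSquare z := by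
  rintro ⟨r, rfl⟩
  have hp1 : (1 : ℝ) < p := by exact_mod_cast (Fact.out : p.Prime).one_lt
  have hr : r ≠ 0 := by
    rintro rfl
    have : (0 : ℝ) < (p : ℝ) ^ k := by positivity
    simp at hz
    linarith
  rw [norm_mul, Padic.norm_eq_zpow_neg_valuation hr, ← zpow_add₀ (by positivity)] at hz
  have := zpow_right_injective₀ (by positivity) hp1.ne' hz
  rw [← this] at hk
  exact (Int.not_odd_iff_even.2 ⟨_, rfl⟩) hk

theorem padic_isSquare_intCast_iff (hp : p ≠ 2) {d : ℤ} (hd : ¬ (p : ℤ) ∣ d) :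
    IsSquare (d : ℚ_[p]) ↔ legendreSym p d = 1 := by
  have hd0 : (d : ZMod p) ≠ 0 := fun h => hd ((ZMod.intCast_zmod_eq_zero_iff_dvd d p).1 h)
  rw [legendreSym.eq_one_iff p hd0]
  constructor
  · rintro ⟨r, hr⟩
    have hr1 : ‖r‖ ≤ 1 := by
      have := congrArg norm hr
      rw [padic_norm_intCast_eq_one hd, norm_mul] at this
      nlinarith [norm_nonneg r]
    obtain ⟨s, rfl⟩ : ∃ s : ℤ_[p], (s : ℚ_[p]) = r := ⟨⟨r, hr1⟩, rfl⟩
    have : (d : ℤ_[p]) = s * s := PadicInt.ext (by push_cast; exact hr)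
    refine ⟨PadicInt.toZMod s, ?_⟩
    rw [← map_mul, ← this, map_intCast]
  · rintro ⟨c, hc⟩
    obtain ⟨k, rfl⟩ := ZMod.intCast_surjective c
    have hk : ¬ (p : ℤ) ∣ k := by
      intro h
      rw [(ZMod.intCast_zmod_eq_zero_iff_dvd k p).2 h] at hc
      exact hd0 (by simpa using hc)
    have hdvd : (p : ℤ) ∣ d - k * k := by
      rw [← ZMod.intCast_zmod_eq_zero_iff_dvd]
      push_cast
      rw [hc, sub_self]
    have hk1 := padic_norm_intCast_eq_one hk
    have hk0 : (k : ℚ_[p]) ≠ 0 := by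
      intro h
      simp [h] at hk1
    have := padic_isSquare_of_norm_sub_one_lt hp (z := (d : ℚ_[p]) / k ^ 2) (by
      have h := Padic.norm_intCast_lt_one_iff.2 hdvd
      have e : (d : ℚ_[p]) / k ^ 2 - 1 = ((d - k * k : ℤ) : ℚ_[p]) / k ^ 2 := by
        push_cast
        field_simp
      rw [e, norm_div, norm_pow, hk1]
      simpa using h)
    rw [← isSquare_mul_self_left_iff hk0] at this
    rwa [mul_div_cancel₀ _ (pow_ne_zero 2 hk0)] at this

theorem padic_norm_intCast_of_sq_not_dvd {d : ℤ} (h1 : (p : ℤ) ∣ d) (h2 : ¬ (p : ℤ) ^ 2 ∣ d) :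
    ‖(d : ℚ_[p])‖ = (p : ℝ) ^ (-1 : ℤ) := by
  obtain ⟨e, rfl⟩ := h1
  have : ¬ (p : ℤ) ∣ e := fun h => h2 (by rw [pow_two]; exact mul_dvd_mul_left _ h)
  push_cast
  rw [norm_mul, padic_norm_intCast_eq_one this, Padic.norm_p, mul_one, zpow_neg_one]

theorem padic_not_isSquare_intCast {d : ℤ} (h1 : (p : ℤ) ∣ d) (h2 : ¬ (p : ℤ) ^ 2 ∣ d) :
    ¬ IsSquare (d : ℚ_[p]) :=
  padic_not_isSquare_of_norm (padic_norm_intCast_of_sq_not_dvd h1 h2) (by decide)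

/-- For `m = d e` squarefree, the local condition `d ∈ {1, m}` modulo squares at `p ∣ m`. -/
theorem padic_isSquare_or_isSquare_mul_iff (hp : p ≠ 2) {d e : ℤ} (hsq : Squarefree (d * e))
    (hpde : (p : ℤ) ∣ d * e) :
    (IsSquare (d : ℚ_[p]) ∨ IsSquare (((d * e : ℤ) : ℚ_[p]) * d)) ↔
      (((p : ℤ) ∣ d → legendreSym p e = 1) ∧ (¬ (p : ℤ) ∣ d → legendreSym p d = 1)) := by
  have hpp : Prime (p : ℤ) := Nat.prime_iff_prime_int.1 Fact.out
  have hd0 : (d : ℚ_[p]) ≠ 0 := by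
    have : d ≠ 0 := by rintro rfl; simp at hsq
    exact_mod_cast this
  have hp2 : ¬ (p : ℤ) ^ 2 ∣ d * e := fun h =>
    hpp.not_isUnit (hsq _ (by rwa [← pow_two]))
  have key : ((d * e : ℤ) : ℚ_[p]) * d = (d : ℚ_[p]) ^ 2 * (e : ℤ) := by push_cast; ring
  rw [key, isSquare_mul_self_left_iff hd0]
  -- By squarefreeness `p` divides exactly one of `d`, `e`. That factor has valuation 1 and is not a
  -- square, so only the other alternative can hold.
  by_cases h : (p : ℤ) ∣ d
  · have he : ¬ (p : ℤ) ∣ e := fun he => hp2 (by rw [pow_two]; exact mul_dvd_mul h he)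
    have hnd : ¬ IsSquare (d : ℚ_[p]) :=
      padic_not_isSquare_intCast h fun h' => hp2 (h'.mul_right _)
    simp [h, hnd, padic_isSquare_intCast_iff hp he]
  · have he : (p : ℤ) ∣ e := (hpp.dvd_or_dvd hpde).resolve_left h
    have hne : ¬ IsSquare (e : ℚ_[p]) :=
      padic_not_isSquare_intCast he fun h' => hp2 (h'.mul_left _)
    simp [h, hne, padic_isSquare_intCast_iff hp h]

end Padic

/-- The form in which curve equations are used: once the cofactor of `x` is a square times a 1-unit
`z`, `x` itself is a square. -/
theorem isSquare_of_sq_eq {K : Type*} [Field K] {x y c z : K} (hc : c ≠ 0) (hz : IsSquare z)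
    (hz0 : z ≠ 0) (h : y ^ 2 = c ^ 2 * z * x) : IsSquare x := by
  obtain ⟨r, rfl⟩ := hz
  have hr : r ≠ 0 := by rintro rfl; simp at hz0
  refine ⟨y / (c * r), ?_⟩
  field_simp
  linear_combination -h

/-! ### Points over `ℚ_p` for odd `p` dividing `n` -/

section Odd
variable {p : ℕ} [Fact p.Prime]

@[norm_cast, simp]
theorem padicInt_coe_ofNat (k : ℕ) [k.AtLeastTwo] :
    ((ofNat(k) : ℤ_[p]) : ℚ_[p]) = ofNat(k) := rfl

theorem padic_exists_int {t : ℚ_[p]} (h : ‖t‖ ≤ 1) : ∃ s : ℤ_[p], (s : ℚ_[p]) = t := ⟨⟨t, h⟩, rfl⟩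

theorem padic_norm_mul_lt_one {t : ℚ_[p]} (ht : ‖t‖ < 1) (w : ℤ_[p]) : ‖t * w‖ < 1 := by
  rw [norm_mul]
  calc ‖t‖ * ‖(w : ℚ_[p])‖ ≤ ‖t‖ * 1 :=
        mul_le_mul_of_nonneg_left (PadicInt.norm_le_one w) (norm_nonneg _)
    _ < 1 := by linarith

theorem padic_isSquare_one_add (hp : p ≠ 2) {t : ℚ_[p]} (ht : ‖t‖ < 1) (w : ℤ_[p]) :
    IsSquare (1 + t * w) ∧ 1 + t * w ≠ 0 := by
  have h := padic_norm_mul_lt_one ht w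
  refine ⟨padic_isSquare_of_norm_sub_one_lt hp (by rwa [add_sub_cancel_left]), fun h0 => ?_⟩
  rw [show t * w = -1 by linear_combination h0] at h
  simp at h

theorem padic_isSquare_of_close (hp : p ≠ 2) {u v : ℚ_[p]} (hv : ‖v‖ = 1) (h : ‖u - v‖ < 1) :
    IsSquare (u * v) := by
  have hv0 : v ≠ 0 := by rintro rfl; simp at hv
  have := padic_isSquare_of_norm_sub_one_lt hp (z := u / v) (by
    rw [show u / v - 1 = (u - v) / v by field_simp, norm_div, hv]; simpa using h)
  rw [← isSquare_mul_self_left_iff hv0] at this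
  rwa [show v ^ 2 * (u / v) = u * v by field_simp] at this

theorem padic_trichotomy {n x : ℚ_[p]} (hn : n ≠ 0) (hx : x ≠ 0) :
    ‖n / x‖ < 1 ∨ ‖x / n‖ < 1 ∨ ‖x / n‖ = 1 := by
  rw [norm_div, norm_div]
  have h1 := norm_pos_iff.2 hn
  have h2 := norm_pos_iff.2 hx
  rcases lt_trichotomy ‖n‖ ‖x‖ with h | h | h
  · left; rwa [div_lt_one h2]
  · right; right; rw [h]; exact div_self h2.ne'
  · right; left; rwa [div_lt_one h1]

theorem padic_norm_three (hp : p ≠ 3) : ‖(3 : ℚ_[p])‖ = 1 := by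
  have h := padic_norm_intCast_eq_one (p := p) (k := 3) (by
    intro h
    have h' : p ∣ 3 := by exact_mod_cast h
    exact hp ((Nat.prime_dvd_prime_iff_eq Fact.out Nat.prime_three).1 h'))
  simpa using h

/-- The right-hand side has valuation 3, which is odd. This excludes `x = n u` whenever `u` does not
reduce to a root of the remaining quadratic factor. -/
theorem padic_sq_norm_ne {n y u v : ℚ_[p]} (hn : ‖n‖ = (p : ℝ) ^ (-1 : ℤ)) (hu : ‖u‖ = 1)
    (hv : ‖v‖ = 1) (h : y ^ 2 = n ^ 3 * u * v) : False := by
  have hp0 : (p : ℝ) ≠ 0 := by exact_mod_cast (Fact.out : p.Prime).ne_zero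
  refine padic_not_isSquare_of_norm (p := p) (z := n ^ 3 * u * v) (k := -3) ?_ (by decide)
    ⟨y, by rw [← h]; ring⟩
  rw [norm_mul, norm_mul, norm_pow, hn, hu, hv, mul_one, mul_one, ← zpow_natCast, ← zpow_mul]
  norm_num

theorem ne_zero_of_norm_eq_zpow {n : ℚ_[p]} {k : ℤ} (hn : ‖n‖ = (p : ℝ) ^ k) : n ≠ 0 := by
  rintro rfl
  have : (0 : ℝ) < (p : ℝ) ^ k := zpow_pos (by exact_mod_cast (Fact.out : p.Prime).pos) _
  rw [norm_zero] at hn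
  linarith

/-- With `t = n/x` the cofactor is `x² (1 - 2t - 3t²)`, a square times a 1-unit. -/
theorem twoTorsion_isSquare_of_large (hp : p ≠ 2) {n x y : ℚ_[p]} (hx : x ≠ 0)
    (h : y ^ 2 = x * (x + n) * (x - 3 * n)) (ht : ‖n / x‖ < 1) : IsSquare x := by
  obtain ⟨t, htn⟩ := padic_exists_int ht.le
  obtain ⟨h1, h2⟩ := padic_isSquare_one_add hp ht (-2 - 3 * t)
  refine isSquare_of_sq_eq (y := y) hx h1 h2 ?_
  rw [h]
  push_cast
  rw [htn]
  field_simp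
  ring

/-- Compare valuations. If `x` is smaller than `n`, the cofactor is `-3n²` times a 1-unit, and `-3`
is a square. If `x = n u` with `u` a unit, odd valuation forces `u ≡ -1` or `u ≡ 3`, so `-u` is in
the class of `1` or `-3`, both trivial. -/
theorem twoTorsion_image_of_one_mod_three (hp : p ≠ 2) (hp3 : p ≠ 3)
    (h3 : IsSquare (-3 : ℚ_[p])) {n x y : ℚ_[p]} (hn : ‖n‖ = (p : ℝ) ^ (-1 : ℤ)) (hx : x ≠ 0)
    (h : y ^ 2 = x * (x + n) * (x - 3 * n)) : IsSquare x ∨ IsSquare (-n * x) := by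
  have hn0 := ne_zero_of_norm_eq_zpow hn
  have h30 : (-3 : ℚ_[p]) ≠ 0 := by norm_num
  have hn3 := padic_norm_three (p := p) hp3
  rcases padic_trichotomy hn0 hx with ht | ht | ht
  · exact Or.inl (twoTorsion_isSquare_of_large hp hx h ht)
  · left
    have ht' : ‖x / n / 3‖ < 1 := by rw [norm_div, hn3, div_one]; exact ht
    obtain ⟨t, htn⟩ := padic_exists_int ht'.le
    obtain ⟨h1, h2⟩ := padic_isSquare_one_add hp ht' (2 - 3 * t)
    refine isSquare_of_isSquare_mul h30 (isSquare_of_sq_eq (y := y) hn0 h1 h2 ?_) h3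
    rw [h]
    push_cast
    rw [htn]
    field_simp
    ring
  · right
    obtain ⟨u, hu⟩ := padic_exists_int ht.le
    have hxu : x = n * u := by rw [hu]; field_simp
    rw [← hu] at ht
    have hy : y ^ 2 = n ^ 3 * u * ((u + 1) * (u - 3)) := by rw [h, hxu]; ring
    by_cases h1 : ‖(u : ℚ_[p]) + 1‖ < 1
    · have := padic_isSquare_of_close hp (u := u) (v := -1) (by simp) (by simpa using h1)
      rw [hxu, show -n * (n * u) = n ^ 2 * (u * -1) by ring, isSquare_mul_self_left_iff hn0]
      exact this
    by_cases h2 : ‖(u : ℚ_[p]) - 3‖ < 1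
    · have h4 := padic_isSquare_of_close hp (u := u) (v := 3) hn3 h2
      rw [hxu, show -n * (n * u) = n ^ 2 * (-u) by ring, isSquare_mul_self_left_iff hn0]
      refine isSquare_of_isSquare_mul h30 ?_ h3
      rwa [show -(u : ℚ_[p]) * -3 = u * 3 by ring]
    exfalso
    have h1' : ‖(u : ℚ_[p]) + 1‖ = 1 :=
      le_antisymm (by exact_mod_cast PadicInt.norm_le_one (u + 1)) (not_lt.1 h1)
    have h2' : ‖(u : ℚ_[p]) - 3‖ = 1 :=
      le_antisymm (by exact_mod_cast PadicInt.norm_le_one (u - 3)) (not_lt.1 h2)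
    exact padic_sq_norm_ne hn ht (by rw [norm_mul, h1', h2', mul_one]) hy

/-- When `x` and `n` differ in valuation, the quadratic factor is `x²` or `16n²` times a 1-unit.
Otherwise `x = n u` and parity of valuation forces `u` to be a root of the quadratic modulo `p`. -/
theorem isogenous_image (hp : p ≠ 2) {n x y : ℚ_[p]} (hn : ‖n‖ = (p : ℝ) ^ (-1 : ℤ)) (hx : x ≠ 0)
    (h : y ^ 2 = x * (x ^ 2 + 4 * n * x + 16 * n ^ 2)) :
    IsSquare x ∨ ∃ u : ℤ_[p], x = n * u ∧ ‖(u : ℚ_[p])‖ = 1 ∧ IsSquare (u : ℚ_[p]) ∧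
      ‖((u : ℚ_[p]) ^ 2 + 4 * u + 16)‖ < 1 := by
  have hn0 := ne_zero_of_norm_eq_zpow hn
  have h16 : ‖(16 : ℚ_[p])‖ = 1 := by
    rw [show (16 : ℚ_[p]) = 2 ^ 4 by norm_num, norm_pow, padic_norm_two hp, one_pow]
  rcases padic_trichotomy hn0 hx with ht | ht | ht
  · left
    obtain ⟨t, htn⟩ := padic_exists_int ht.le
    obtain ⟨h1, h2⟩ := padic_isSquare_one_add hp ht (4 + 16 * t)
    refine isSquare_of_sq_eq (y := y) hx h1 h2 ?_
    rw [h]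
    push_cast
    rw [htn]
    field_simp
    ring
  · left
    have ht' : ‖x / n / 16‖ < 1 := by rw [norm_div, h16, div_one]; exact ht
    obtain ⟨t, htn⟩ := padic_exists_int ht'.le
    obtain ⟨h1, h2⟩ := padic_isSquare_one_add hp ht' (4 + 16 * t)
    refine isSquare_of_sq_eq (y := y) (c := 4 * n) (mul_ne_zero (by norm_num) hn0) h1 h2 ?_
    rw [h]
    push_cast
    rw [htn]
    field_simp
    ring
  · right
    obtain ⟨u, hu⟩ := padic_exists_int ht.le
    have hxu : x = n * u := by rw [hu]; field_simp
    rw [← hu] at ht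
    have hy : y ^ 2 = n ^ 3 * u * (u ^ 2 + 4 * u + 16) := by rw [h, hxu]; ring
    have hlt : ‖((u : ℚ_[p]) ^ 2 + 4 * u + 16)‖ < 1 := by
      by_contra hge
      have hle := PadicInt.norm_le_one (u ^ (2 : ℕ) + 4 * u + 16)
      rw [PadicInt.norm_def] at hle
      push_cast at hle
      exact padic_sq_norm_ne hn ht (le_antisymm hle (not_lt.1 hge)) hy
    refine ⟨u, hxu, ht, ?_, hlt⟩
    have h64 : ‖(64 : ℚ_[p])‖ = 1 := by
      rw [show (64 : ℚ_[p]) = 2 ^ 6 by norm_num, norm_pow, padic_norm_two hp, one_pow]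
    -- Since `(u² + 4u + 16)(u - 4) = u³ - 64`, a root `u` has `u³` close to the square `64`; hence
    -- `u³`, and so `u`, is a square.
    have hsq := padic_isSquare_of_close hp (u := (u : ℚ_[p]) ^ 3) (v := 64) h64 (by
      have := padic_norm_mul_lt_one hlt (u - 4)
      push_cast at this
      rwa [show ((u : ℚ_[p]) ^ 2 + 4 * u + 16) * (u - 4) = u ^ 3 - 64 by ring] at this)
    have hu0 : (u : ℚ_[p]) ≠ 0 := by
      intro h0
      simp [h0] at ht
    rw [show (u : ℚ_[p]) ^ 3 * 64 = (8 * u) ^ 2 * u by ring,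
      isSquare_mul_self_left_iff (mul_ne_zero (by norm_num) hu0)] at hsq
    exact hsq

/-- The exceptional case cannot occur: `u² + 4u + 16 = (u + 2)² + 12` is divisible by `p` only if
`-12`, hence `-3`, is a square. -/
theorem isogenous_image_of_not_isSquare (hp : p ≠ 2) (hp3 : p ≠ 3)
    (h3 : ¬ IsSquare (-3 : ℚ_[p])) {n x y : ℚ_[p]} (hn : ‖n‖ = (p : ℝ) ^ (-1 : ℤ)) (hx : x ≠ 0)
    (h : y ^ 2 = x * (x ^ 2 + 4 * n * x + 16 * n ^ 2)) : IsSquare x := by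
  rcases isogenous_image hp hn hx h with h | ⟨u, -, -, -, hlt⟩
  · exact h
  · exfalso
    apply h3
    have h12 : ‖(-12 : ℚ_[p])‖ = 1 := by
      rw [show (-12 : ℚ_[p]) = -(2 ^ 2 * 3) by norm_num, norm_neg, norm_mul, norm_pow,
        padic_norm_two hp, padic_norm_three hp3]
      norm_num
    have := padic_isSquare_of_close hp (u := ((u : ℚ_[p]) + 2) ^ 2) (v := -12) h12 (by
      rwa [show ((u : ℚ_[p]) + 2) ^ 2 - -12 = u ^ 2 + 4 * u + 16 by ring])
    have hu2 : (u : ℚ_[p]) + 2 ≠ 0 := by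
      intro h0
      have e : ((u : ℚ_[p]) ^ 2 + 4 * u + 16) = -(-12) := by linear_combination (u + 2) * h0
      rw [e, norm_neg, h12] at hlt
      exact lt_irrefl _ hlt
    rw [show ((u : ℚ_[p]) + 2) ^ 2 * -12 = (2 * (u + 2)) ^ 2 * -3 by ring,
      isSquare_mul_self_left_iff (mul_ne_zero two_ne_zero hu2)] at this
    exact this

end Odd

/-! ### Points over `ℚ_3` -/

section Three

theorem isogenous_image_three {m x y : ℚ_[3]} (hm : ‖m‖ = 1) (hns : ¬ IsSquare m) (hx : x ≠ 0)
    (h : y ^ 2 = x * (x ^ 2 + 4 * (3 * m) * x + 16 * (3 * m) ^ 2)) : IsSquare x := by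
  have hn : ‖3 * m‖ = ((3 : ℕ) : ℝ) ^ (-1 : ℤ) := by
    have h3 : ‖(3 : ℚ_[3])‖ = ((3 : ℕ) : ℝ)⁻¹ := by exact_mod_cast Padic.norm_p (p := 3)
    rw [norm_mul, hm, mul_one, zpow_neg_one, h3]
  rcases isogenous_image (by decide) hn hx h with h' | ⟨u, rfl, hu, hsq, hlt⟩
  · exact h'
  · exfalso
    have hm0 : m ≠ 0 := by rintro rfl; simp at hm
    have hu0 : (u : ℚ_[3]) ≠ 0 := by
      intro h0
      simp [h0] at hu
    -- Modulo 3 the quadratic is the perfect square `(u - 4)²`, so it has a double root and one more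
    -- term is needed.
    have h4 : (3 : ℤ_[3]) ∣ u - 4 := by
      have h1 : ‖u ^ 2 + 4 * u + 16‖ < 1 := by
        rw [PadicInt.norm_def]; push_cast; exact hlt
      rw [PadicInt.norm_lt_one_iff_dvd] at h1
      have h2 : (3 : ℤ_[3]) ∣ (u - 4) ^ 2 := by
        have := dvd_sub (show (3 : ℤ_[3]) ∣ u ^ 2 + 4 * u + 16 from h1) (Dvd.intro (4 * u) rfl)
        rwa [show u ^ 2 + 4 * u + 16 - 3 * (4 * u) = (u - 4) ^ 2 by ring] at this
      exact (show Prime (3 : ℤ_[3]) from PadicInt.prime_p).dvd_of_dvd_pow h2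
    obtain ⟨k, hk⟩ := h4
    have hk' : (u : ℚ_[3]) = 4 + 3 * k := by
      have := congrArg (fun z : ℤ_[3] => (z : ℚ_[3])) hk
      push_cast at this
      linear_combination this
    have h3 : ‖(3 / 4 : ℚ_[3])‖ < 1 := by
      have h3 : ‖(3 : ℚ_[3])‖ = ((3 : ℕ) : ℝ)⁻¹ := by exact_mod_cast Padic.norm_p (p := 3)
      rw [norm_div, h3, show (4 : ℚ_[3]) = 2 ^ 2 by norm_num, norm_pow, padic_norm_two (by decide)]
      norm_num
    have h3' : ‖(3 / 16 : ℚ_[3])‖ < 1 := by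
      have h3 : ‖(3 : ℚ_[3])‖ = ((3 : ℕ) : ℝ)⁻¹ := by exact_mod_cast Padic.norm_p (p := 3)
      rw [norm_div, h3, show (16 : ℚ_[3]) = 2 ^ 4 by norm_num, norm_pow,
        padic_norm_two (by decide)]
      norm_num
    obtain ⟨h5, h6⟩ := padic_isSquare_one_add (by decide) h3' (4 * k + k ^ 2)
    apply hns
    have : IsSquare (m * u) := by
      -- With `u = 4 + 3k` the quadratic is `48 (1 + (3/16)(4k + k²))`, so the equation becomes `y²
      -- = (36m)² · (1-unit) · (m u)`. As `u` is a square, `m` would be one too.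
      refine isSquare_of_sq_eq (y := y) (c := 36 * m) (mul_ne_zero (by norm_num) hm0) h5 h6 ?_
      rw [h]
      push_cast
      rw [hk']
      ring
    exact isSquare_of_isSquare_mul hu0 this hsq

/-- At 3 the roots `-n` and `3n` have different valuations, so the case of small `x` needs a second
subdivision at the scale `3n = 9m`. -/
theorem twoTorsion_image_three {m x y : ℚ_[3]} (hm : ‖m‖ = 1) (hsq : IsSquare m) (hx : x ≠ 0)
    (h : y ^ 2 = x * (x + 3 * m) * (x - 3 * (3 * m))) : IsSquare x ∨ IsSquare (-3 * x) := by
  have h3 : ‖(3 : ℚ_[3])‖ = ((3 : ℕ) : ℝ)⁻¹ := by exact_mod_cast Padic.norm_p (p := 3)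
  have h3' : ‖(3 : ℚ_[3])‖ < 1 := by rw [h3]; norm_num
  have hn : ‖3 * m‖ = ((3 : ℕ) : ℝ) ^ (-1 : ℤ) := by
    rw [norm_mul, hm, mul_one, zpow_neg_one, h3]
  have hm0 : m ≠ 0 := by rintro rfl; simp at hm
  have hn0 : 3 * m ≠ 0 := mul_ne_zero (by norm_num) hm0
  rcases padic_trichotomy hn0 hx with ht | ht | ht
  · exact Or.inl (twoTorsion_isSquare_of_large (by decide) hx h ht)
  · -- `x = 9 m v` with `v` integral
    obtain ⟨u, hu⟩ := padic_exists_int ht.le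
    rw [← hu] at ht
    have hu3 : (3 : ℤ_[3]) ∣ u := by
      have : ‖u‖ < 1 := ht
      rwa [PadicInt.norm_lt_one_iff_dvd] at this
    obtain ⟨v, rfl⟩ := hu3
    have hxv : x = 9 * m * v := by
      push_cast at hu
      rw [eq_div_iff hn0] at hu
      rw [← hu]
      ring
    obtain ⟨h5, h6⟩ := padic_isSquare_one_add (by decide) h3' v
    have hv0 : (v : ℚ_[3]) ≠ 0 := by
      intro h0
      simp [hxv, h0] at hx
    have hy : y ^ 2 = (9 * m) ^ 2 * (1 + 3 * (v : ℚ_[3])) * (m * (3 * v * (v - 1))) := by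
      rw [h, hxv]; ring
    -- If `v` is a nonunit, `v - 1` is in the class of `-1`, giving `-3v`. If `v` is a unit, the
    -- valuation is odd unless `v ≡ 1`, and then `v` is a square.
    have key : IsSquare (3 * (v : ℚ_[3]) * (v - 1)) := by
      have := isSquare_of_sq_eq (mul_ne_zero (by norm_num) hm0) h5 h6 hy
      exact isSquare_of_isSquare_mul hm0 (by rwa [mul_comm]) hsq
    have hx9 : ∀ c : ℚ_[3], IsSquare (c * v) → IsSquare (c * x) := by
      intro c hc
      have := (hsq.mul hc).mul (⟨3, by norm_num⟩ : IsSquare (9 : ℚ_[3]))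
      rwa [show m * (c * v) * 9 = c * x by rw [hxv]; ring] at this
    by_cases hv : ‖(v : ℚ_[3])‖ < 1
    · right
      obtain ⟨h7, h8⟩ := padic_isSquare_one_add (p := 3) (by decide) hv (-1)
      apply hx9
      refine isSquare_of_isSquare_mul h8 ?_ h7
      rwa [show -3 * (v : ℚ_[3]) * (1 + v * ((-1 : ℤ_[3]) : ℚ_[3])) = 3 * v * (v - 1) by
        push_cast; ring]
    · have hv1 : ‖(v : ℚ_[3])‖ = 1 := le_antisymm (PadicInt.norm_le_one v) (not_lt.1 hv)
      by_cases hv2 : ‖(v : ℚ_[3]) - 1‖ < 1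
      · left
        have := padic_isSquare_of_close (p := 3) (by decide) (norm_one) hv2
        have := hx9 1 (by rwa [one_mul, ← mul_one (v : ℚ_[3])])
        rwa [one_mul] at this
      · exfalso
        have hv2' : ‖(v : ℚ_[3]) - 1‖ = 1 :=
          le_antisymm (by exact_mod_cast PadicInt.norm_le_one (v - 1)) (not_lt.1 hv2)
        refine padic_not_isSquare_of_norm (p := 3) (k := -1) ?_ (by decide) key
        rw [norm_mul, norm_mul, hv1, hv2', h3, zpow_neg_one, mul_one, mul_one]
  · right
    obtain ⟨u, hu⟩ := padic_exists_int ht.le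
    have hxu : x = 3 * m * u := by rw [hu]; field_simp
    rw [← hu] at ht
    have hy : y ^ 2 = (3 * m) ^ 3 * u * ((u + 1) * (u - 3)) := by rw [h, hxu]; ring
    by_cases h1 : ‖(u : ℚ_[3]) + 1‖ < 1
    · have h4 := padic_isSquare_of_close (p := 3) (by decide) (u := u) (v := -1) (by simp)
        (by simpa using h1)
      have := (hsq.mul h4).mul (⟨3, by norm_num⟩ : IsSquare (9 : ℚ_[3]))
      rwa [show m * (u * -1) * 9 = -3 * x by rw [hxu]; ring] at this
    · exfalso
      have h1' : ‖(u : ℚ_[3]) + 1‖ = 1 :=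
        le_antisymm (by exact_mod_cast PadicInt.norm_le_one (u + 1)) (not_lt.1 h1)
      have h2' : ‖(u : ℚ_[3]) - 3‖ = 1 := by
        rw [sub_eq_add_neg, Padic.add_eq_max_of_ne (by rw [ht, norm_neg]; exact h3'.ne'), ht,
          norm_neg, max_eq_left h3'.le]
      exact padic_sq_norm_ne hn ht (by rw [norm_mul, h1', h2', mul_one]) hy

end Three

/-! ### Points over `ℚ_2` -/

section TwoAdic

theorem padicInt_two_isSquare {z : ℤ_[2]} (h : PadicInt.toZModPow (p := 2) 3 z = 1) :
    IsSquare z := by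
  apply padicInt_isSquare_of_norm_sub_one_lt
  have h1 : z - 1 ∈ RingHom.ker (PadicInt.toZModPow (p := 2) 3) := by
    rw [RingHom.mem_ker, map_sub, h, map_one, sub_self]
  rw [PadicInt.ker_toZModPow, ← PadicInt.norm_le_pow_iff_mem_span_pow] at h1
  have h2 : ‖(2 : ℤ_[2])‖ = (2 : ℝ)⁻¹ := by exact_mod_cast PadicInt.norm_p (p := 2)
  rw [h2]
  refine h1.trans_lt ?_
  norm_num

theorem padic_two_isSquare {z : ℤ_[2]} (h : PadicInt.toZModPow (p := 2) 3 z = 1) :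
    IsSquare (z : ℚ_[2]) := by
  obtain ⟨r, hr⟩ := padicInt_two_isSquare h
  exact ⟨r, by rw [hr]; push_cast; ring⟩

theorem padic_two_isSquare_intCast {d : ℤ} (h : d ≡ 1 [ZMOD 8]) : IsSquare (d : ℚ_[2]) := by
  have := padic_two_isSquare (z := (d : ℤ_[2])) (by
    rw [map_intCast]
    exact_mod_cast (ZMod.intCast_eq_intCast_iff d 1 8).2 h)
  simpa using this

theorem padic_two_isSquare_intCast_iff {d : ℤ} (hd : Odd d) :
    IsSquare (d : ℚ_[2]) ↔ d ≡ 1 [ZMOD 8] := by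
  refine ⟨?_, padic_two_isSquare_intCast⟩
  rintro ⟨r, hr⟩
  have hr1 : ‖r‖ ≤ 1 := by
    have := congrArg norm hr
    have h1 := Padic.norm_int_le_one (p := 2) d
    rw [norm_mul] at this
    nlinarith [norm_nonneg r]
  obtain ⟨s, rfl⟩ := padic_exists_int hr1
  have h1 : (d : ℤ_[2]) = s * s := PadicInt.ext (by push_cast; exact hr)
  have h2 := congrArg (PadicInt.toZModPow (p := 2) 3) h1
  rw [map_intCast, map_mul] at h2
  have h3 : ((d % 8 : ℤ) : ZMod (2 ^ 3)) = (d : ZMod (2 ^ 3)) :=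
    (ZMod.intCast_eq_intCast_iff _ _ 8).2 (Int.mod_modEq d 8)
  rw [← h3] at h2
  have h4 : d % 8 = 1 ∨ d % 8 = 3 ∨ d % 8 = 5 ∨ d % 8 = 7 := by
    obtain ⟨k, rfl⟩ := hd
    omega
  generalize PadicInt.toZModPow (p := 2) 3 s = w at h2
  rcases h4 with h4 | h4 | h4 | h4
  · exact h4
  all_goals
    exfalso
    rw [h4] at h2
    revert h2
    revert w
    decide

/-- For odd `d` the two alternatives are `d ≡ 1` and `d ≡ 5` modulo 8. For `d ≡ 2 (mod 4)` the
valuation is odd and both sides fail. -/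
theorem padic_two_isSquare_or_iff {d : ℤ} (hd : ¬ (4 : ℤ) ∣ d) :
    (IsSquare (d : ℚ_[2]) ∨ IsSquare (-3 * d : ℚ_[2])) ↔ d ≡ 1 [ZMOD 4] := by
  have e : (-3 * d : ℚ_[2]) = ((-3 * d : ℤ) : ℚ_[2]) := by push_cast; ring
  rw [e]
  rcases Int.even_or_odd d with h | h
  · have h2 : ((2 : ℕ) : ℤ) ∣ d := by exact_mod_cast even_iff_two_dvd.1 h
    have h4 : ¬ ((2 : ℕ) : ℤ) ^ 2 ∣ d := by norm_num; exact hd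
    have h5 : ¬ ((2 : ℕ) : ℤ) ^ 2 ∣ -3 * d := by
      norm_num at h4 ⊢
      intro h6
      exact h4 (Int.dvd_of_dvd_mul_right_of_gcd_one (by simpa using h6) (by decide))
    have h6 : ¬ d ≡ 1 [ZMOD 4] := by
      intro h7
      have : d % 4 = 1 := h7
      obtain ⟨k, rfl⟩ := h
      omega
    simp only [padic_not_isSquare_intCast h2 h4,
      padic_not_isSquare_intCast (h2.mul_left (-3)) h5, h6, or_self]
  · rw [padic_two_isSquare_intCast_iff h,
      padic_two_isSquare_intCast_iff (Odd.mul (by decide) h)]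
    simp only [Int.ModEq]
    omega

theorem padic_two_norm_lt_one {z : ℤ_[2]} (h : ‖(z : ℚ_[2])‖ < 1) : ∃ w, z = 2 * w := by
  have h' : ‖z‖ < 1 := h
  rw [PadicInt.norm_lt_one_iff_dvd] at h'
  exact_mod_cast h'

/-- The polynomial `1 + t + t²` has no root in `𝔽₂`. -/
theorem padic_two_norm_one_add_add_sq (t : ℤ_[2]) : ‖(1 + t + t ^ 2 : ℚ_[2])‖ = 1 := by
  have hle := PadicInt.norm_le_one (1 + t + t ^ (2 : ℕ))
  rw [PadicInt.norm_def] at hle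
  push_cast at hle
  refine le_antisymm hle (not_lt.1 fun h => ?_)
  obtain ⟨w, hw⟩ := padic_two_norm_lt_one (z := 1 + t + t ^ (2 : ℕ)) (by push_cast; exact h)
  have h2 := congrArg (PadicInt.toZModPow (p := 2) 1) hw
  simp only [map_add, map_mul, map_pow, map_one, map_ofNat] at h2
  generalize PadicInt.toZModPow (p := 2) 1 w = a at h2
  generalize PadicInt.toZModPow (p := 2) 1 t = b at h2
  revert a b
  decide

theorem padic_two_isSquare_one_add (w : ℤ_[2]) :
    IsSquare (1 + 8 * w : ℚ_[2]) ∧ (1 + 8 * w : ℚ_[2]) ≠ 0 := by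
  have h1 : PadicInt.toZModPow (p := 2) 3 (1 + 8 * w) = 1 := by
    simp only [map_add, map_mul, map_one, map_ofNat]
    rw [show (8 : ZMod (2 ^ 3)) = 0 by decide]
    ring
  refine ⟨by simpa using padic_two_isSquare h1, fun h0 => ?_⟩
  have : (1 + 8 * w : ℤ_[2]) = 0 := PadicInt.ext (by push_cast; exact h0)
  rw [this, map_zero] at h1
  exact absurd h1 (by decide)

theorem padicInt_two_even_or_odd (t : ℤ_[2]) : (∃ w, t = 2 * w) ∨ ∃ w, t = 2 * w + 1 := by
  have key : ∀ t : ℤ_[2], PadicInt.toZModPow (p := 2) 1 t = 0 → ∃ w, t = 2 * w := by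
    intro t ht
    have h1 : t ∈ RingHom.ker (PadicInt.toZModPow (p := 2) 1) := ht
    rw [PadicInt.ker_toZModPow, Ideal.mem_span_singleton] at h1
    obtain ⟨w, hw⟩ := h1
    exact ⟨w, by rw [hw]; push_cast; ring⟩
  have h2 : PadicInt.toZModPow (p := 2) 1 t = 0 ∨ PadicInt.toZModPow (p := 2) 1 (t - 1) = 0 := by
    rw [map_sub, map_one]
    generalize PadicInt.toZModPow (p := 2) 1 t = a
    revert a
    decide
  rcases h2 with h2 | h2
  · exact Or.inl (key t h2)
  · obtain ⟨w, hw⟩ := key _ h2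
    exact Or.inr ⟨w, by rw [← hw]; ring⟩

theorem padic_two_unit_descent {w y : ZMod (2 ^ 3)}
    (h : y ^ 2 = (3 + 2 * w) * (w ^ 2 - 9)) : 3 + 2 * w = 1 ∨ -3 * (3 + 2 * w) = 1 := by
  revert w y
  decide

theorem padic_two_norm_two : ‖(2 : ℚ_[2])‖ = ((2 : ℕ) : ℝ) ^ (-1 : ℤ) := by
  have : ‖(2 : ℚ_[2])‖ = ((2 : ℕ) : ℝ)⁻¹ := by exact_mod_cast Padic.norm_p (p := 2)
  rw [this, zpow_neg_one]

theorem padic_two_norm_three : ‖(3 : ℚ_[2])‖ = 1 := padic_norm_three (by decide)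

/-- The curve with `n = 3`, to which all others reduce by scaling. Even integral `x` lands in the
class of `-3`, odd integral `x` is settled modulo 8, and nonintegral `x` is a square. -/
theorem twoTorsion_image_two_three {x y : ℚ_[2]} (hx : x ≠ 0)
    (h : y ^ 2 = x * (x + 3) * (x - 9)) : IsSquare x ∨ IsSquare (-3 * x) := by
  have h2 := padic_two_norm_two
  have h2' : ‖(2 : ℚ_[2])‖ < 1 := by rw [h2]; norm_num
  have h3 := padic_two_norm_three
  by_cases hx1 : ‖x‖ ≤ 1
  · obtain ⟨x, rfl⟩ := padic_exists_int hx1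
    have hy1 : ‖y‖ ≤ 1 := by
      have h4 := PadicInt.norm_le_one (x * (x + 3) * (x - 9))
      rw [PadicInt.norm_def] at h4
      push_cast at h4
      rw [← h, norm_pow] at h4
      nlinarith [norm_nonneg y]
    obtain ⟨y, rfl⟩ := padic_exists_int hy1
    have hZ : y ^ 2 = x * (x + 3) * (x - 9) := PadicInt.ext (by push_cast; exact h)
    by_cases hx2 : ‖(x : ℚ_[2])‖ < 1
    · right
      obtain ⟨v, rfl⟩ := padic_two_norm_lt_one hx2
      have hu1 : ‖(-27 + 2 * (-6 * v + 2 * v ^ 2) : ℚ_[2])‖ = 1 := by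
        have h27 : ‖(-27 : ℚ_[2])‖ = 1 := by
          rw [norm_neg, show (27 : ℚ_[2]) = 3 ^ 3 by norm_num, norm_pow, h3, one_pow]
        have hlt := padic_norm_mul_lt_one h2' (-6 * v + 2 * v ^ (2 : ℕ))
        push_cast at hlt
        rw [Padic.add_eq_max_of_ne (by rw [h27]; exact hlt.ne'), h27, max_eq_left hlt.le]
      have hv2 : ‖(v : ℚ_[2])‖ < 1 := by
        by_contra hv
        have hv1 : ‖(v : ℚ_[2])‖ = 1 := le_antisymm (PadicInt.norm_le_one v) (not_lt.1 hv)
        refine padic_not_isSquare_of_norm (p := 2) (k := -1) ?_ (by decide)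
          (⟨(y : ℚ_[2]), (pow_two _)⟩ : IsSquare ((y : ℚ_[2]) ^ 2))
        push_cast at h
        rw [h, show (2 * (v : ℚ_[2])) * (2 * v + 3) * (2 * v - 9)
          = 2 * v * (-27 + 2 * (-6 * v + 2 * v ^ 2)) by ring, norm_mul, norm_mul, h2, hv1, hu1]
        norm_num
      obtain ⟨w, rfl⟩ := padic_two_norm_lt_one hv2
      -- With `x = 4w`, `-3 (x + 3)(x - 9) = 81 + 72w - 48w² = 1 + 8 (10 + 9w - 6w²)`; multiplying
      -- the equation by 9 isolates `-3x`.
      have hsq := padic_two_isSquare_one_add (10 + 9 * w - 6 * w ^ (2 : ℕ))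
      refine isSquare_of_sq_eq (c := 1) (y := 3 * (y : ℚ_[2])) one_ne_zero hsq.1 hsq.2 ?_
      push_cast at h ⊢
      linear_combination 9 * h
    · have hx3 : ∃ w, x = 3 + 2 * w := by
        rcases padicInt_two_even_or_odd x with ⟨w, rfl⟩ | ⟨w, hw⟩
        · exfalso
          apply hx2
          push_cast
          exact padic_norm_mul_lt_one h2' w
        · exact ⟨w - 1, by linear_combination hw⟩
      obtain ⟨w, rfl⟩ := hx3
      have hy2 : ∃ z, y = 2 * z := by
        have h5 : (2 : ℤ_[2]) ∣ y ^ 2 := ⟨2 * ((3 + 2 * w) * (w ^ (2 : ℕ) - 9)), by rw [hZ]; ring⟩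
        exact (show Prime (2 : ℤ_[2]) from PadicInt.prime_p).dvd_of_dvd_pow h5
      obtain ⟨z, rfl⟩ := hy2
      have hZ' : z ^ 2 = (3 + 2 * w) * (w ^ 2 - 9) := by
        have h4 : (4 : ℤ_[2]) ≠ 0 := by norm_num
        apply mul_left_cancel₀ h4
        linear_combination hZ
      have hm := congrArg (PadicInt.toZModPow (p := 2) 3) hZ'
      simp only [map_add, map_mul, map_pow, map_sub, map_ofNat] at hm
      rcases padic_two_unit_descent hm with h5 | h5
      · left
        exact padic_two_isSquare (by simpa only [map_add, map_mul, map_ofNat] using h5)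
      · right
        have := padic_two_isSquare (z := -3 * (3 + 2 * w))
          (by simpa only [map_add, map_mul, map_neg, map_ofNat] using h5)
        push_cast at this ⊢
        exact this
  · left
    have ht : ‖x⁻¹‖ < 1 := by rw [norm_inv]; exact inv_lt_one_of_one_lt₀ (not_le.1 hx1)
    obtain ⟨t, ht'⟩ := padic_exists_int ht.le
    rw [← ht'] at ht
    obtain ⟨s, rfl⟩ := padic_two_norm_lt_one ht
    -- With `1/x = 2s` the cofactor is `x² (1 - 12 (s² + s) - 96 s²)`. The evenness of `s² + s`
    -- supplies the missing factor 2 for being 1 modulo 8.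
    obtain ⟨k, hk⟩ : ∃ k, s ^ 2 + s = 2 * k := by
      rcases padicInt_two_even_or_odd s with ⟨w, rfl⟩ | ⟨w, hw⟩
      · exact ⟨w * (2 * w + 1), by ring⟩
      · exact ⟨w * s + s, by rw [hw]; ring⟩
    have hsq := padic_two_isSquare_one_add (-3 * k - 12 * s ^ (2 : ℕ))
    refine isSquare_of_sq_eq (c := x) (y := y) hx hsq.1 hsq.2 ?_
    have hk' : (s : ℚ_[2]) ^ 2 + s = 2 * k := by exact_mod_cast congrArg (Subtype.val) hk
    push_cast at ht' ⊢
    have hxs : x * (2 * s) = 1 := by rw [ht']; exact mul_inv_cancel₀ hx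
    have e : y ^ 2 = x * (x + 3 * (x * (2 * s))) * (x - 9 * (x * (2 * s))) := by
      rw [hxs, mul_one, mul_one, h]
    linear_combination e - 12 * x ^ 3 * hk'

/-- Here `n = 3s²`, and `(x/s², y/s³)` is a point on the curve with `n = 3` and the same square
class. -/
theorem twoTorsion_image_two {n x y : ℚ_[2]} (hn : n ≠ 0) (hn3 : IsSquare (3 * n)) (hx : x ≠ 0)
    (h : y ^ 2 = x * (x + n) * (x - 3 * n)) : IsSquare x ∨ IsSquare (-3 * x) := by
  obtain ⟨r, hr⟩ := hn3
  have hr0 : r ≠ 0 := by rintro rfl; simp [hn] at hr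
  have hs0 : r / 3 ≠ 0 := div_ne_zero hr0 (by norm_num)
  have hns : n = 3 * (r / 3) ^ 2 := by linear_combination hr / 3
  generalize r / 3 = s at hs0 hns
  have := twoTorsion_image_two_three (x := x / s ^ 2) (y := y / s ^ 3)
    (div_ne_zero hx (pow_ne_zero 2 hs0)) (by
      rw [div_pow, h, hns]
      field_simp
      ring)
  rw [← isSquare_mul_self_left_iff hs0, ← isSquare_mul_self_left_iff (x := -3 * _) hs0,
    show s ^ 2 * (x / s ^ 2) = x by field_simp,
    show s ^ 2 * (-3 * (x / s ^ 2)) = -3 * x by field_simp] at this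
  exact this

/-- The quadratic factor is `X² + XY + Y²` at `X = x`, `Y = 4n`. Dividing by the larger variable
shows that its valuation is even, so `x` has even valuation too. -/
theorem isogenous_image_two {n x y d : ℚ_[2]} (hn : n ≠ 0) (hx : x ≠ 0)
    (h : y ^ 2 = x * (x ^ 2 + 4 * n * x + 16 * n ^ 2)) (hd : ‖d‖ = ((2 : ℕ) : ℝ) ^ (-1 : ℤ)) :
    ¬ IsSquare (d * x) := by
  intro hdx
  have hd0 := ne_zero_of_norm_eq_zpow hd
  have key : ∃ t : ℤ_[2], ∃ c : ℚ_[2], c ≠ 0 ∧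
      x ^ 2 + 4 * n * x + 16 * n ^ 2 = c ^ 2 * (1 + t + t ^ 2) := by
    by_cases ht : ‖4 * n / x‖ ≤ 1
    · obtain ⟨t, ht⟩ := padic_exists_int ht
      exact ⟨t, x, hx, by rw [ht]; field_simp; ring⟩
    · have h4n : 4 * n ≠ 0 := mul_ne_zero (by norm_num) hn
      have ht' : ‖x / (4 * n)‖ ≤ 1 := by
        rw [← inv_div, norm_inv]
        exact inv_le_one_of_one_le₀ (not_le.1 ht).le
      obtain ⟨t, ht'⟩ := padic_exists_int ht'
      exact ⟨t, 4 * n, h4n, by rw [ht']; field_simp; ring⟩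
  obtain ⟨t, c, hc, hq⟩ := key
  obtain ⟨r, hr⟩ := hdx
  have hr0 : r ≠ 0 := by rintro rfl; simp [hd0, hx] at hr
  have hnorm := padic_two_norm_one_add_add_sq t
  refine padic_not_isSquare_of_norm (p := 2) (z := d * (1 + t + t ^ 2 : ℚ_[2])) (k := -1)
    (by rw [norm_mul, hd, hnorm, mul_one]) (by decide) ?_
  have hyx : y ^ 2 = x * (c ^ 2 * (1 + t + t ^ 2)) := by rw [h, hq]
  refine ⟨d * y / (r * c), ?_⟩
  field_simp
  rw [hyx, pow_two r, ← hr]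
  ring

end TwoAdic

/-! ### Quadratic reciprocity with signs, and the symbols of `-3` and modulo 3 -/

-- When `a ≡ 1 (mod 4)` the reciprocity sign is trivial, provided the Hilbert symbol at infinity is
-- trivial too; that is the role of `hpos`. For `a < 0`, `|a| ≡ 3 (mod 4)` and the sign of `(-1/b)`
-- cancels the reciprocity sign.
open NumberTheorySymbols in
theorem jacobiSym_natAbs_reciprocity {a b : ℤ} (ha : a ≡ 1 [ZMOD 4]) (hb : Odd b)
    (hpos : 0 < a ∨ 0 < b) : J(a | b.natAbs) = J(b | a.natAbs) := by
  have ha4 : a % 4 = 1 := ha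
  have hbn : Odd b.natAbs := Int.natAbs_odd.2 hb
  have han : Odd a.natAbs := Int.natAbs_odd.2 (by rw [Int.odd_iff]; omega)
  rcases lt_or_ge 0 a with ha0 | ha0
  · have h1 : a.natAbs % 4 = 1 := by omega
    have h2 : J(a | b.natAbs) = J(b.natAbs | a.natAbs) := by
      rw [← jacobiSym.quadratic_reciprocity_one_mod_four h1 hbn]
      congr 1
      omega
    rw [h2]
    rcases Int.natAbs_eq b with h | h
    · rw [← h]
    · conv_rhs => rw [h]
      rw [jacobiSym.neg _ han, ZMod.χ₄_nat_one_mod_four h1, one_mul]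
  · have hb0 : 0 < b := hpos.resolve_left (not_lt.2 ha0)
    have h1 : a.natAbs % 4 = 3 := by omega
    have h2 : a = -(a.natAbs : ℤ) := by omega
    have h3 : b = (b.natAbs : ℤ) := by omega
    conv_lhs => rw [h2]
    conv_rhs => rw [h3]
    rw [jacobiSym.neg _ hbn]
    have h4 : b.natAbs % 4 = 1 ∨ b.natAbs % 4 = 3 := by
      have := Nat.odd_iff.1 hbn
      omega
    rcases h4 with h4 | h4
    · rw [ZMod.χ₄_nat_one_mod_four h4, one_mul,
        jacobiSym.quadratic_reciprocity_one_mod_four' han h4]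
    · rw [ZMod.χ₄_nat_three_mod_four h4, jacobiSym.quadratic_reciprocity_three_mod_four h1 h4]
      ring

theorem legendreSym_neg_three {p : ℕ} [Fact p.Prime] (hp2 : p ≠ 2) :
    legendreSym p (-3) = legendreSym 3 p := by
  have hodd : Odd (p : ℤ) := by
    exact_mod_cast (Fact.out : p.Prime).odd_of_ne_two hp2
  have := jacobiSym_natAbs_reciprocity (a := -3) (b := p) (by decide) hodd
    (Or.inr (by exact_mod_cast (Fact.out : p.Prime).pos))
  rw [jacobiSym.legendreSym.to_jacobiSym, jacobiSym.legendreSym.to_jacobiSym]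
  exact this

theorem legendreSym_three_of_one {d : ℤ} (h : d ≡ 1 [ZMOD 3]) : legendreSym 3 d = 1 := by
  rw [legendreSym.mod, show d % ((3 : ℕ) : ℤ) = 1 from h]
  decide

theorem legendreSym_three_of_two {d : ℤ} (h : d ≡ 2 [ZMOD 3]) : legendreSym 3 d = -1 := by
  rw [legendreSym.mod, show d % ((3 : ℕ) : ℤ) = 2 from h]
  decide

theorem legendreSym_three_eq_one_iff {d : ℤ} : legendreSym 3 d = 1 ↔ d ≡ 1 [ZMOD 3] := by
  refine ⟨fun h => ?_, legendreSym_three_of_one⟩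
  have h3 : d % 3 = 0 ∨ d % 3 = 1 ∨ d % 3 = 2 := by omega
  rcases h3 with h3 | h3 | h3
  · rw [legendreSym.mod, show d % ((3 : ℕ) : ℤ) = 0 from h3] at h
    exact absurd h (by decide)
  · exact h3
  · rw [legendreSym_three_of_two h3] at h
    exact absurd h (by decide)

/-- The unit square classes form a group of order 2, generated by any nonresidue. Used to show that
the 2-torsion fills the whole local group. -/
theorem padic_isSquare_or_nonresidue_mul {p : ℕ} [Fact p.Prime] (hp : p ≠ 2) {c d : ℤ}
    (hc : legendreSym p c = -1) (hd : ¬ (p : ℤ) ∣ d) :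
    IsSquare (d : ℚ_[p]) ∨ IsSquare ((c * d : ℤ) : ℚ_[p]) := by
  have hd0 : (d : ZMod p) ≠ 0 := fun h => hd ((ZMod.intCast_zmod_eq_zero_iff_dvd d p).1 h)
  have hcp : ¬ (p : ℤ) ∣ c := by
    intro h
    rw [(legendreSym.eq_zero_iff p c).2 ((ZMod.intCast_zmod_eq_zero_iff_dvd c p).2 h)] at hc
    exact absurd hc (by decide)
  have hcd : ¬ (p : ℤ) ∣ c * d := fun h =>
    ((Nat.prime_iff_prime_int.1 Fact.out : Prime (p : ℤ)).dvd_or_dvd h).elim hcp hd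
  rw [padic_isSquare_intCast_iff hp hd, padic_isSquare_intCast_iff hp hcd, legendreSym.mul, hc]
  rcases legendreSym.eq_one_or_neg_one p hd0 with h | h
  · exact Or.inl h
  · right; rw [h]; norm_num

/-! ### The local images as conditions on an integer `d` -/

theorem disc_coeff (n : ℤ) : disc (coeffA n) (coeffB n) = 144 * n ^ 6 := by
  simp only [disc, coeffA, coeffB]; ring

theorem mem_range_descentMap_iff {n : ℤ} (hn : n ≠ 0) {K : Type*} [Field K] [CharZero K] {a : K}
    (ha : a ≠ 0) :
    sqClass a ∈ Set.range (descentMap (coeffA n) (coeffB n) K) ↔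
      IsSquare a ∨ IsSquare (-3 * a) ∨
        ∃ x y : K, x ≠ 0 ∧ y ^ 2 = x * (x + n) * (x - 3 * n) ∧ IsSquare (a * x) := by
  have hn0 : (n : K) ≠ 0 := by exact_mod_cast hn
  rw [sqClass_mem_range_descentMap_iff (by rw [disc_coeff]; positivity) ha]
  have e : a * ((coeffB n : ℤ) : K) = (n : K) ^ 2 * (-3 * a) := by
    simp only [coeffB]; push_cast; ring
  rw [e, isSquare_mul_self_left_iff hn0]
  have e2 : ∀ x : K, x ^ 3 + ((coeffA n : ℤ) : K) * x ^ 2 + ((coeffB n : ℤ) : K) * x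
      = x * (x + n) * (x - 3 * n) := by
    intro x; simp only [coeffA, coeffB]; push_cast; ring
  simp only [e2]

/-- Here `B' = 16n²` is a square, so `(0, 0)` contributes only the trivial class. -/
theorem mem_range_descentMap_isogenous_iff {n : ℤ} (hn : n ≠ 0) {K : Type*} [Field K]
    [CharZero K] {a : K} (ha : a ≠ 0) :
    sqClass a ∈ Set.range
        (descentMap (-2 * coeffA n) (coeffA n ^ 2 - 4 * coeffB n) K) ↔
      IsSquare a ∨ ∃ x y : K, x ≠ 0 ∧ y ^ 2 = x * (x ^ 2 + 4 * n * x + 16 * n ^ 2) ∧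
        IsSquare (a * x) := by
  have hn0 : (n : K) ≠ 0 := by exact_mod_cast hn
  rw [sqClass_mem_range_descentMap_iff (by
    rw [show disc (-2 * coeffA n) (coeffA n ^ 2 - 4 * coeffB n) = -(12288 * n ^ 6) by
      simp only [disc, coeffA, coeffB]; ring, neg_ne_zero]
    positivity) ha]
  have e : a * ((coeffA n ^ 2 - 4 * coeffB n : ℤ) : K) = (4 * n : K) ^ 2 * a := by
    simp only [coeffA, coeffB]; push_cast; ring
  rw [e, isSquare_mul_self_left_iff (mul_ne_zero (by norm_num) hn0), ← or_assoc, or_self]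
  have e2 : ∀ x : K, x ^ 3 + ((-2 * coeffA n : ℤ) : K) * x ^ 2 +
      ((coeffA n ^ 2 - 4 * coeffB n : ℤ) : K) * x
      = x * (x ^ 2 + 4 * n * x + 16 * n ^ 2) := by
    intro x; simp only [coeffA, coeffB]; push_cast; ring
  simp only [e2]

theorem mem_range_of_isSquare_neg {n : ℤ} (hn : n ≠ 0) {K : Type*} [Field K] [CharZero K] {a : K}
    (ha : a ≠ 0) (h : IsSquare (-n * a)) :
    sqClass a ∈ Set.range (descentMap (coeffA n) (coeffB n) K) := by
  rw [mem_range_descentMap_iff hn ha]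
  refine Or.inr (Or.inr ⟨-n, 0, neg_ne_zero.2 (by exact_mod_cast hn), by ring, ?_⟩)
  rwa [mul_comm]

theorem mem_range_of_isSquare_three {n : ℤ} (hn : n ≠ 0) {K : Type*} [Field K] [CharZero K]
    {a : K} (ha : a ≠ 0) (h : IsSquare (3 * n * a)) :
    sqClass a ∈ Set.range (descentMap (coeffA n) (coeffB n) K) := by
  rw [mem_range_descentMap_iff hn ha]
  refine Or.inr (Or.inr ⟨3 * n, 0, mul_ne_zero (by norm_num) (by exact_mod_cast hn), by ring, ?_⟩)
  rwa [mul_comm]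

theorem mem_range_real {n : ℤ} (hn : 0 < n) {a : ℝ} (ha : a ≠ 0) :
    sqClass a ∈ Set.range (descentMap (coeffA n) (coeffB n) ℝ) := by
  have hn' : (0 : ℝ) < n := by exact_mod_cast hn
  rcases ha.lt_or_gt with h | h
  · exact mem_range_of_isSquare_neg hn.ne' ha (Real.isSquare_iff.2 (by nlinarith))
  · rw [mem_range_descentMap_iff hn.ne' ha]
    exact Or.inl (Real.isSquare_iff.2 h.le)

theorem mem_range_isogenous_real_iff {n : ℤ} (hn : 0 < n) {a : ℝ} (ha : a ≠ 0) :
    sqClass a ∈ Set.range (descentMap (-2 * coeffA n) (coeffA n ^ 2 - 4 * coeffB n) ℝ) ↔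
      0 < a := by
  have hn' : (0 : ℝ) < n := by exact_mod_cast hn
  rw [mem_range_descentMap_isogenous_iff hn.ne' ha]
  constructor
  · rintro (h | ⟨x, y, hx, hxy, h⟩)
    · exact lt_of_le_of_ne (Real.isSquare_iff.1 h) ha.symm
    · have h1 : 0 < x ^ 2 + 4 * n * x + 16 * n ^ 2 := by nlinarith [sq_nonneg (x + 2 * n)]
      have h2 : 0 ≤ x * (x ^ 2 + 4 * n * x + 16 * n ^ 2) := hxy ▸ sq_nonneg y
      have h3 : 0 < x := lt_of_le_of_ne (nonneg_of_mul_nonneg_left h2 h1) hx.symm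
      exact lt_of_le_of_ne (nonneg_of_mul_nonneg_left (Real.isSquare_iff.1 h) h3) ha.symm
  · exact fun h => Or.inl (Real.isSquare_iff.2 h.le)

theorem isSquare_two_three_mul {n : ℤ} (hn : n ≡ 3 [ZMOD 8]) : IsSquare (3 * n : ℚ_[2]) := by
  have := padic_two_isSquare_intCast (d := 3 * n) (by
    have : n % 8 = 3 := hn
    simp only [Int.ModEq]; omega)
  exact_mod_cast this

theorem mem_range_two_iff {n d : ℤ} (hn : n ≡ 3 [ZMOD 8]) (hd : ¬ (4 : ℤ) ∣ d) :
    sqClass (d : ℚ_[2]) ∈ Set.range (descentMap (coeffA n) (coeffB n) ℚ_[2]) ↔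
      d ≡ 1 [ZMOD 4] := by
  have hn0 : n ≠ 0 := by rintro rfl; exact absurd hn (by decide)
  have hd0 : (d : ℚ_[2]) ≠ 0 := by
    have : d ≠ 0 := by rintro rfl; simp at hd
    exact_mod_cast this
  rw [mem_range_descentMap_iff hn0 hd0, ← padic_two_isSquare_or_iff hd]
  constructor
  · rintro (h | h | ⟨x, y, hx, hxy, h⟩)
    · exact Or.inl h
    · exact Or.inr h
    · rcases twoTorsion_image_two (by exact_mod_cast hn0) (isSquare_two_three_mul hn) hx hxy
        with h1 | h1
      · exact Or.inl (isSquare_of_isSquare_mul hx h h1)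
      · right
        have h2 := h.mul h1
        rwa [show (d : ℚ_[2]) * x * (-3 * x) = x ^ 2 * (-3 * d) by ring,
          isSquare_mul_self_left_iff hx] at h2
  · rintro (h | h)
    · exact Or.inl h
    · exact Or.inr (Or.inl h)

theorem mem_range_isogenous_two_iff {n d : ℤ} (hn : n ≡ 3 [ZMOD 8]) (hd : ¬ (4 : ℤ) ∣ d) :
    sqClass (d : ℚ_[2]) ∈
        Set.range (descentMap (-2 * coeffA n) (coeffA n ^ 2 - 4 * coeffB n) ℚ_[2]) ↔ Odd d := by
  have hn0 : n ≠ 0 := by rintro rfl; exact absurd hn (by decide)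
  have hd0 : (d : ℚ_[2]) ≠ 0 := by
    have : d ≠ 0 := by rintro rfl; simp at hd
    exact_mod_cast this
  rw [mem_range_descentMap_isogenous_iff hn0 hd0]
  constructor
  · intro h
    by_contra hodd
    have h2 : ((2 : ℕ) : ℤ) ∣ d := by exact_mod_cast even_iff_two_dvd.1 (Int.not_odd_iff_even.1 hodd)
    have h4 : ¬ ((2 : ℕ) : ℤ) ^ 2 ∣ d := by norm_num; exact hd
    rcases h with h | ⟨x, y, hx, hxy, h⟩
    · exact padic_not_isSquare_intCast h2 h4 h
    · exact isogenous_image_two (by exact_mod_cast hn0) hx hxy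
        (padic_norm_intCast_of_sq_not_dvd h2 h4) h
  · intro hodd
    have hn8 : n % 8 = 3 := hn
    obtain ⟨k, hk⟩ : ∃ k, n = 8 * k + 3 := ⟨n / 8, by omega⟩
    -- The nontrivial unit classes 3, 5, 7 are realised by points with `x = 12, 5, 28`. For each,
    -- the right-hand side is a square times some `w ≡ 1 (mod 8)`, because `n ≡ 3 (mod 8)`.
    have key : ∀ x k w l u : ℤ, x ≠ 0 → x * (x ^ 2 + 4 * n * x + 16 * n ^ 2) = k ^ 2 * w →
        w ≡ 1 [ZMOD 8] → d * x = l ^ 2 * u → u ≡ 1 [ZMOD 8] → ∃ x y : ℚ_[2], x ≠ 0 ∧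
          y ^ 2 = x * (x ^ 2 + 4 * n * x + 16 * n ^ 2) ∧ IsSquare (d * x) := by
      intro x k w l u hx h1 hw h2 hu
      obtain ⟨r, hr⟩ := padic_two_isSquare_intCast hw
      obtain ⟨t, ht⟩ := padic_two_isSquare_intCast hu
      refine ⟨x, k * r, by exact_mod_cast hx, ?_, l * t, ?_⟩
      · rw [mul_pow, pow_two r, ← hr]
        exact_mod_cast h1.symm
      · rw [show (l * t) * (l * t) = (l : ℚ_[2]) ^ 2 * (t * t) by ring, ← ht]
        exact_mod_cast h2
    have hd8 : d % 8 = 1 ∨ d % 8 = 3 ∨ d % 8 = 5 ∨ d % 8 = 7 := by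
      obtain ⟨j, rfl⟩ := hodd
      omega
    rcases hd8 with h | h | h | h
    · exact Or.inl (padic_two_isSquare_intCast h)
    · refine Or.inr (key 12 8 (3 * (9 + 3 * n + n ^ 2)) 2 (3 * d) (by norm_num) (by ring) ?_
        (by ring) (by simp only [Int.ModEq]; omega))
      rw [hk]
      refine (Int.modEq_iff_dvd.2 ⟨-(10 + 27 * k + 24 * k ^ 2), by ring⟩)
    · refine Or.inr (key 5 1 (5 * (25 + 20 * n + 16 * n ^ 2)) 1 (5 * d) (by norm_num) (by ring) ?_
        (by ring) (by simp only [Int.ModEq]; omega))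
      rw [hk]
      refine (Int.modEq_iff_dvd.2 ⟨-(143 + 580 * k + 640 * k ^ 2), by ring⟩)
    · refine Or.inr (key 28 8 (7 * (49 + 7 * n + n ^ 2)) 2 (7 * d) (by norm_num) (by ring) ?_
        (by ring) (by simp only [Int.ModEq]; omega))
      rw [hk]
      refine (Int.modEq_iff_dvd.2 ⟨-(69 + 91 * k + 56 * k ^ 2), by ring⟩)

section OddPrime
variable {p : ℕ} [Fact p.Prime]

theorem isSquare_mul_of_mul_of_mul {K : Type*} [Field K] {a b x : K} (hx : x ≠ 0)
    (h : IsSquare (a * x)) (h1 : IsSquare (b * x)) : IsSquare (b * a) := by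
  have h2 := h.mul h1
  rwa [show a * x * (b * x) = x ^ 2 * (b * a) by ring, isSquare_mul_self_left_iff hx] at h2

theorem padic_isSquare_neg_three (hp2 : p ≠ 2) (hp : p ≡ 1 [MOD 3]) : IsSquare (-3 : ℚ_[p]) := by
  have hp3 : ¬ (p : ℤ) ∣ -3 := by
    rw [Int.dvd_neg]
    intro h
    have h' : p ∣ 3 := by exact_mod_cast h
    have := (Nat.prime_dvd_prime_iff_eq Fact.out Nat.prime_three).1 h'
    rw [this] at hp
    exact absurd hp (by decide)
  have := (padic_isSquare_intCast_iff hp2 hp3).2 (by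
    rw [legendreSym_neg_three hp2]
    exact legendreSym_three_of_one (by exact_mod_cast Int.natCast_modEq_iff.2 hp))
  exact_mod_cast this

theorem legendreSym_neg_three_of_two (hp2 : p ≠ 2) (hp : p ≡ 2 [MOD 3]) :
    legendreSym p (-3) = -1 := by
  rw [legendreSym_neg_three hp2]
  exact legendreSym_three_of_two (by exact_mod_cast Int.natCast_modEq_iff.2 hp)

theorem padic_not_isSquare_neg_three (hp2 : p ≠ 2) (hp : p ≡ 2 [MOD 3]) :
    ¬ IsSquare (-3 : ℚ_[p]) := by
  have hl := legendreSym_neg_three_of_two hp2 hp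
  have hp3 : ¬ (p : ℤ) ∣ -3 := by
    intro h
    rw [(legendreSym.eq_zero_iff p (-3)).2 ((ZMod.intCast_zmod_eq_zero_iff_dvd (-3) p).2 h)] at hl
    exact absurd hl (by decide)
  have := padic_isSquare_intCast_iff hp2 hp3
  push_cast at this
  rw [this, hl]
  decide

theorem mem_range_one_mod_three_iff (hp2 : p ≠ 2) (hp : p ≡ 1 [MOD 3]) {n d : ℤ} (hd : d ≠ 0)
    (h1 : (p : ℤ) ∣ n) (h2 : ¬ (p : ℤ) ^ 2 ∣ n) :
    sqClass (d : ℚ_[p]) ∈ Set.range (descentMap (coeffA n) (coeffB n) ℚ_[p]) ↔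
      IsSquare (d : ℚ_[p]) ∨ IsSquare (((-n : ℤ) : ℚ_[p]) * d) := by
  have hn0 : n ≠ 0 := by rintro rfl; simp at h2
  have hd0 : (d : ℚ_[p]) ≠ 0 := by exact_mod_cast hd
  have h3 := padic_isSquare_neg_three hp2 hp
  have hp3 : p ≠ 3 := by rintro rfl; exact absurd hp (by decide)
  push_cast
  constructor
  · rw [mem_range_descentMap_iff hn0 hd0]
    rintro (h | h | ⟨x, y, hx, hxy, h⟩)
    · exact Or.inl h
    · exact Or.inl (isSquare_of_isSquare_mul (by norm_num) (by rwa [mul_comm]) h3)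
    · rcases twoTorsion_image_of_one_mod_three hp2 hp3 h3
        (padic_norm_intCast_of_sq_not_dvd h1 h2) hx hxy with h4 | h4
      · exact Or.inl (isSquare_of_isSquare_mul hx h h4)
      · exact Or.inr (isSquare_mul_of_mul_of_mul hx h h4)
  · rintro (h | h)
    · rw [mem_range_descentMap_iff hn0 hd0]
      exact Or.inl h
    · exact mem_range_of_isSquare_neg hn0 hd0 h

/-- As `-3` is a square, `E'` has full 2-torsion over `ℚ_p`, and the nonzero roots of its cubic lie
in the class of `n`. -/
theorem mem_range_isogenous_one_mod_three_iff (hp2 : p ≠ 2) (hp : p ≡ 1 [MOD 3]) {n d : ℤ}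
    (hd : d ≠ 0) (h1 : (p : ℤ) ∣ n) (h2 : ¬ (p : ℤ) ^ 2 ∣ n) :
    sqClass (d : ℚ_[p]) ∈
        Set.range (descentMap (-2 * coeffA n) (coeffA n ^ 2 - 4 * coeffB n) ℚ_[p]) ↔
      IsSquare (d : ℚ_[p]) ∨ IsSquare ((n : ℚ_[p]) * d) := by
  have hn0 : n ≠ 0 := by rintro rfl; simp at h2
  have hn0' : (n : ℚ_[p]) ≠ 0 := by exact_mod_cast hn0
  have hd0 : (d : ℚ_[p]) ≠ 0 := by exact_mod_cast hd
  rw [mem_range_descentMap_isogenous_iff hn0 hd0]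
  constructor
  · rintro (h | ⟨x, y, hx, hxy, h⟩)
    · exact Or.inl h
    · rcases isogenous_image hp2 (padic_norm_intCast_of_sq_not_dvd h1 h2) hx hxy with
        h4 | ⟨u, hxu, -, h4, -⟩
      · exact Or.inl (isSquare_of_isSquare_mul hx h h4)
      · refine Or.inr (isSquare_mul_of_mul_of_mul hx h ?_)
        rw [hxu, ← mul_assoc, ← pow_two]
        rwa [isSquare_mul_self_left_iff hn0']
  · rintro (h | h)
    · exact Or.inl h
    · right
      obtain ⟨r, hr⟩ := padic_isSquare_neg_three hp2 hp
      have hr0 : -1 + r ≠ 0 := by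
        intro h0
        have : r = 1 := by linear_combination h0
        rw [this] at hr
        norm_num at hr
      -- `2 (r - 1)` is four times a primitive cube root of unity, hence a square
      refine ⟨n * (2 * (-1 + r)), 0, mul_ne_zero hn0' (mul_ne_zero two_ne_zero hr0), ?_, ?_⟩
      · linear_combination 8 * (n : ℚ_[p]) ^ 3 * (-1 + r) * hr
      · have e : (d : ℚ_[p]) * (n * (2 * (-1 + r))) = (-1 - r) ^ 2 * (n * d) := by
          linear_combination (d : ℚ_[p]) * n * hr
        rw [e, isSquare_mul_self_left_iff]
        · exact h
        · intro h0
          have : r = -1 := by linear_combination -h0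
          rw [this] at hr
          norm_num at hr

/-- The 2-torsion classes `1, -3, -n, 3n` are all of `ℚ_pˣ` modulo squares: `-3` is a nonresidue
unit and `n` is a uniformizer. -/
theorem mem_range_two_mod_three (hp2 : p ≠ 2) (hp : p ≡ 2 [MOD 3]) {n d : ℤ} (hd : d ≠ 0)
    (hd2 : ¬ (p : ℤ) ^ 2 ∣ d) (h1 : (p : ℤ) ∣ n) (h2 : ¬ (p : ℤ) ^ 2 ∣ n) :
    sqClass (d : ℚ_[p]) ∈ Set.range (descentMap (coeffA n) (coeffB n) ℚ_[p]) := by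
  have hn0 : n ≠ 0 := by rintro rfl; simp at h2
  have hd0 : (d : ℚ_[p]) ≠ 0 := by exact_mod_cast hd
  have hl := legendreSym_neg_three_of_two hp2 hp
  have hpp : Prime (p : ℤ) := Nat.prime_iff_prime_int.1 Fact.out
  have hp0 : (p : ℚ_[p]) ≠ 0 := by exact_mod_cast (Fact.out : p.Prime).ne_zero
  by_cases hpd : (p : ℤ) ∣ d
  · obtain ⟨e, rfl⟩ := hpd
    obtain ⟨k, rfl⟩ := h1
    have he : ¬ (p : ℤ) ∣ -(k * e) := by
      rw [Int.dvd_neg]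
      intro h
      rcases hpp.dvd_or_dvd h with h | h
      · exact h2 (by rw [pow_two]; exact mul_dvd_mul_left _ h)
      · exact hd2 (by rw [pow_two]; exact mul_dvd_mul_left _ h)
    rcases padic_isSquare_or_nonresidue_mul hp2 hl he with h | h
    · apply mem_range_of_isSquare_neg hn0 hd0
      rw [← isSquare_mul_self_left_iff hp0] at h
      convert h using 1
      push_cast
      ring
    · apply mem_range_of_isSquare_three hn0 hd0
      rw [← isSquare_mul_self_left_iff hp0] at h
      convert h using 1
      push_cast
      ring
  · rw [mem_range_descentMap_iff hn0 hd0]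
    rcases padic_isSquare_or_nonresidue_mul hp2 hl hpd with h | h
    · exact Or.inl h
    · exact Or.inr (Or.inl (by exact_mod_cast h))

theorem mem_range_isogenous_two_mod_three_iff (hp2 : p ≠ 2) (hp : p ≡ 2 [MOD 3]) (hp3 : p ≠ 3)
    {n d : ℤ} (hd : d ≠ 0) (h1 : (p : ℤ) ∣ n) (h2 : ¬ (p : ℤ) ^ 2 ∣ n) :
    sqClass (d : ℚ_[p]) ∈
        Set.range (descentMap (-2 * coeffA n) (coeffA n ^ 2 - 4 * coeffB n) ℚ_[p]) ↔
      IsSquare (d : ℚ_[p]) := by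
  have hn0 : n ≠ 0 := by rintro rfl; simp at h2
  have hd0 : (d : ℚ_[p]) ≠ 0 := by exact_mod_cast hd
  rw [mem_range_descentMap_isogenous_iff hn0 hd0]
  refine ⟨?_, Or.inl⟩
  rintro (h | ⟨x, y, hx, hxy, h⟩)
  · exact h
  · exact isSquare_of_isSquare_mul hx h (isogenous_image_of_not_isSquare hp2 hp3
      (padic_not_isSquare_neg_three hp2 hp) (padic_norm_intCast_of_sq_not_dvd h1 h2) hx hxy)

end OddPrime

section AtThree

theorem three_not_dvd_of_modEq {m : ℤ} (h : m ≡ 1 [ZMOD 3] ∨ m ≡ 2 [ZMOD 3]) :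
    ¬ ((3 : ℕ) : ℤ) ∣ m := by
  simp only [Int.ModEq] at h
  omega

theorem padic_three_isSquare_iff {m : ℤ} (h : m ≡ 1 [ZMOD 3] ∨ m ≡ 2 [ZMOD 3]) :
    IsSquare (m : ℚ_[3]) ↔ m ≡ 1 [ZMOD 3] := by
  rw [padic_isSquare_intCast_iff (by decide) (three_not_dvd_of_modEq h),
    legendreSym_three_eq_one_iff]

theorem mem_range_three_iff {m d : ℤ} (hm : m ≡ 1 [ZMOD 3]) (hd : d ≠ 0) :
    sqClass (d : ℚ_[3]) ∈ Set.range (descentMap (coeffA (3 * m)) (coeffB (3 * m)) ℚ_[3]) ↔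
      IsSquare (d : ℚ_[3]) ∨ IsSquare (((-(3 * m) : ℤ) : ℚ_[3]) * d) := by
  have hm0 : m ≠ 0 := by rintro rfl; exact absurd hm (by decide)
  have hm0' : (m : ℚ_[3]) ≠ 0 := by exact_mod_cast hm0
  have hn0 : 3 * m ≠ 0 := by omega
  have hd0 : (d : ℚ_[3]) ≠ 0 := by exact_mod_cast hd
  have hsq := (padic_three_isSquare_iff (Or.inl hm)).2 hm
  have key : IsSquare (((-(3 * m) : ℤ) : ℚ_[3]) * d) ↔ IsSquare (-3 * d : ℚ_[3]) := by
    have e : ((-(3 * m) : ℤ) : ℚ_[3]) * d = -3 * d * m := by push_cast; ring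
    rw [e]
    exact ⟨fun h => isSquare_of_isSquare_mul hm0' h hsq, fun h => h.mul hsq⟩
  rw [mem_range_descentMap_iff hn0 hd0, key]
  constructor
  · rintro (h | h | ⟨x, y, hx, hxy, h⟩)
    · exact Or.inl h
    · exact Or.inr h
    · rcases twoTorsion_image_three (padic_norm_intCast_eq_one
        (three_not_dvd_of_modEq (Or.inl hm))) hsq hx (by push_cast at hxy; exact hxy) with h1 | h1
      · exact Or.inl (isSquare_of_isSquare_mul hx h h1)
      · exact Or.inr (isSquare_mul_of_mul_of_mul hx h h1)
  · rintro (h | h)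
    · exact Or.inl h
    · exact Or.inr (Or.inl h)

/-- Again the 2-torsion gives all four classes: `3n = 9m` is in the class of the nonresidue `m`, and
`-3` is a uniformizer. -/
theorem mem_range_three_of_two {m d : ℤ} (hm : m ≡ 2 [ZMOD 3]) (hd : d ≠ 0) (hd2 : ¬ 9 ∣ d) :
    sqClass (d : ℚ_[3]) ∈ Set.range (descentMap (coeffA (3 * m)) (coeffB (3 * m)) ℚ_[3]) := by
  have hm0 : m ≠ 0 := by rintro rfl; exact absurd hm (by decide)
  have hn0 : 3 * m ≠ 0 := by omega
  have hd0 : (d : ℚ_[3]) ≠ 0 := by exact_mod_cast hd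
  have hl := legendreSym_three_of_two hm
  have h30 : (3 : ℚ_[3]) ≠ 0 := by norm_num
  by_cases hpd : (3 : ℤ) ∣ d
  · obtain ⟨e, rfl⟩ := hpd
    have he : ¬ ((3 : ℕ) : ℤ) ∣ -e := by
      push_cast
      omega
    rcases padic_isSquare_or_nonresidue_mul (by decide) hl he with h | h
    · rw [mem_range_descentMap_iff hn0 hd0]
      right; left
      rw [← isSquare_mul_self_left_iff h30] at h
      convert h using 1
      push_cast
      ring
    · apply mem_range_of_isSquare_neg hn0 hd0
      rw [← isSquare_mul_self_left_iff h30] at h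
      convert h using 1
      push_cast
      ring
  · rcases padic_isSquare_or_nonresidue_mul (p := 3) (by decide) hl hpd with h | h
    · rw [mem_range_descentMap_iff hn0 hd0]
      exact Or.inl h
    · apply mem_range_of_isSquare_three hn0 hd0
      rw [← isSquare_mul_self_left_iff h30] at h
      convert h using 1
      push_cast
      ring

theorem three_mul_sq_not_dvd {m : ℤ} (h : m ≡ 1 [ZMOD 3] ∨ m ≡ 2 [ZMOD 3]) :
    ¬ ((3 : ℕ) : ℤ) ^ 2 ∣ 3 * m := by
  simp only [Int.ModEq] at h
  push_cast
  omega

theorem mem_range_isogenous_three_iff {m d : ℤ} (hm : m ≡ 1 [ZMOD 3]) (hd : d ≠ 0) :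
    sqClass (d : ℚ_[3]) ∈ Set.range (descentMap (-2 * coeffA (3 * m))
        (coeffA (3 * m) ^ 2 - 4 * coeffB (3 * m)) ℚ_[3]) ↔
      IsSquare (d : ℚ_[3]) ∨ IsSquare (((3 * m : ℤ) : ℚ_[3]) * d) := by
  have hm0 : m ≠ 0 := by rintro rfl; exact absurd hm (by decide)
  have hn0 : 3 * m ≠ 0 := by omega
  have hn0' : ((3 * m : ℤ) : ℚ_[3]) ≠ 0 := by exact_mod_cast hn0
  have hd0 : (d : ℚ_[3]) ≠ 0 := by exact_mod_cast hd
  rw [mem_range_descentMap_isogenous_iff hn0 hd0]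
  constructor
  · rintro (h | ⟨x, y, hx, hxy, h⟩)
    · exact Or.inl h
    · rcases isogenous_image (by decide) (padic_norm_intCast_of_sq_not_dvd (p := 3) (d := 3 * m)
        (Dvd.intro _ rfl) (three_mul_sq_not_dvd (Or.inl hm))) hx hxy with
        h4 | ⟨u, hxu, -, h4, -⟩
      · exact Or.inl (isSquare_of_isSquare_mul hx h h4)
      · refine Or.inr (isSquare_mul_of_mul_of_mul hx h ?_)
        rw [hxu, ← mul_assoc, ← pow_two]
        rwa [isSquare_mul_self_left_iff hn0']
  · rintro (h | h)
    · exact Or.inl h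
    · right
      obtain ⟨r, hr⟩ := (padic_three_isSquare_iff (m := 7 * m) (Or.inl
        (by simp only [Int.ModEq] at hm ⊢; omega))).2 (by simp only [Int.ModEq] at hm ⊢; omega)
      -- At `x = n` the right-hand side is `21n³ = (3n)² · 7m`, and `7m ≡ 1 (mod 3)` is a square.
      refine ⟨((3 * m : ℤ) : ℚ_[3]), 3 * ((3 * m : ℤ) : ℚ_[3]) * r, hn0', ?_, by rwa [mul_comm]⟩
      push_cast at hr ⊢
      linear_combination -81 * (m : ℚ_[3]) ^ 2 * hr

theorem mem_range_isogenous_three_of_two_iff {m d : ℤ} (hm : m ≡ 2 [ZMOD 3]) (hd : d ≠ 0) :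
    sqClass (d : ℚ_[3]) ∈ Set.range (descentMap (-2 * coeffA (3 * m))
        (coeffA (3 * m) ^ 2 - 4 * coeffB (3 * m)) ℚ_[3]) ↔ IsSquare (d : ℚ_[3]) := by
  have hm0 : m ≠ 0 := by rintro rfl; exact absurd hm (by decide)
  have hn0 : 3 * m ≠ 0 := by omega
  have hd0 : (d : ℚ_[3]) ≠ 0 := by exact_mod_cast hd
  rw [mem_range_descentMap_isogenous_iff hn0 hd0]
  refine ⟨?_, Or.inl⟩
  rintro (h | ⟨x, y, hx, hxy, h⟩)
  · exact h
  · refine isSquare_of_isSquare_mul hx h (isogenous_image_three (padic_norm_intCast_eq_one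
      (three_not_dvd_of_modEq (Or.inr hm))) ?_ hx (by push_cast at hxy; exact hxy))
    rw [padic_three_isSquare_iff (Or.inr hm)]
    simp only [Int.ModEq] at hm ⊢
    omega

end AtThree

/-! ### Squarefree representatives and vertex sets -/

theorem Int.squarefree_eq_of_isSquare_mul {a b : ℤ} (ha : Squarefree a) (hb : Squarefree b)
    (h : IsSquare (a * b)) : a = b := by
  obtain ⟨c, hc⟩ := h
  have hdvd : a ∣ c := (ha.dvd_pow_iff_dvd two_ne_zero).1 ⟨b, by rw [pow_two, hc]⟩
  obtain ⟨k, rfl⟩ := hdvd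
  have hb' : b = k * k * a := by
    apply mul_left_cancel₀ ha.ne_zero
    linear_combination hc
  have hk : IsUnit k := hb k ⟨a, hb'⟩
  rcases Int.isUnit_iff.1 hk with rfl | rfl <;> simp [hb']

theorem sqClass_intCast_injective {a b : ℤ} (ha : Squarefree a) (hb : Squarefree b)
    (h : sqClass (a : ℚ) = sqClass (b : ℚ)) : a = b := by
  rw [sqClass_eq_iff (by exact_mod_cast ha.ne_zero) (by exact_mod_cast hb.ne_zero)] at h
  apply Int.squarefree_eq_of_isSquare_mul ha hb
  rw [← Rat.isSquare_intCast_iff]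
  exact_mod_cast h

theorem mem_vertices_iff {m v : ℤ} (hm : m ≠ 0) :
    v ∈ vertices m ↔ (∃ p : ℕ, p.Prime ∧ (p : ℤ) ∣ m ∧ v = p) ∨ (m < 0 ∧ v = -1) := by
  rw [vertices, Finset.mem_union, Finset.mem_image]
  refine or_congr ?_ ?_
  · constructor
    · rintro ⟨p, hp, rfl⟩
      exact ⟨p, Nat.prime_of_mem_primeFactors hp,
        Int.natCast_dvd.2 (Nat.dvd_of_mem_primeFactors hp), rfl⟩
    · rintro ⟨p, hp, hpm, rfl⟩
      exact ⟨p, Nat.mem_primeFactors.2 ⟨hp, Int.natCast_dvd.1 hpm, by simpa using hm⟩, rfl⟩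
  · split_ifs with h <;> simp [h]

theorem prod_vertices {z : ℤ} (hz : Squarefree z) : ∏ v ∈ vertices z, v = z := by
  have hdisj : Disjoint (z.natAbs.primeFactors.image (fun p : ℕ => (p : ℤ)))
      (if z < 0 then {-1} else ∅) := by
    split_ifs
    · rw [Finset.disjoint_singleton_right, Finset.mem_image]
      rintro ⟨p, -, hp⟩
      omega
    · exact Finset.disjoint_empty_right _
  rw [vertices, Finset.prod_union hdisj, Finset.prod_image (by intro a _ b _ h; exact Int.ofNat_injective h),
    ← Nat.cast_prod, Nat.prod_primeFactors_of_squarefree (Int.squarefree_natAbs.2 hz)]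
  split_ifs with h
  · rw [Finset.prod_singleton]; omega
  · rw [Finset.prod_empty]; omega

section Vertices
variable {m : ℤ}

theorem vertex_cases (hm : m ≠ 0) (v : vertices m) :
    (∃ p : ℕ, p.Prime ∧ (p : ℤ) ∣ m ∧ (v : ℤ) = p) ∨ (m < 0 ∧ (v : ℤ) = -1) :=
  (mem_vertices_iff hm).1 v.2

theorem prodV_mul_compl (hm : Squarefree m) (W : Finset (vertices m)) :
    prodV W * prodV Wᶜ = m := by
  rw [prodV, prodV, Finset.prod_mul_prod_compl]
  rw [Finset.prod_coe_sort (vertices m) (fun v => v)]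
  exact prod_vertices hm

theorem prodV_squarefree (hm : Squarefree m) (W : Finset (vertices m)) : Squarefree (prodV W) :=
  hm.squarefree_of_dvd ⟨_, (prodV_mul_compl hm W).symm⟩

theorem exists_prodV_eq (hm : Squarefree m) {z : ℤ} (hz : z ∣ m) (hpos : 0 < m → 0 < z) :
    ∃ W : Finset (vertices m), prodV W = z := by
  have hzs := hm.squarefree_of_dvd hz
  have hsub : ∀ v ∈ vertices z, v ∈ vertices m := by
    intro v hv
    rw [mem_vertices_iff hzs.ne_zero] at hv
    rw [mem_vertices_iff hm.ne_zero]
    rcases hv with ⟨p, hp, hpz, rfl⟩ | ⟨hz0, rfl⟩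
    · exact Or.inl ⟨p, hp, hpz.trans hz, rfl⟩
    · refine Or.inr ⟨?_, rfl⟩
      by_contra hm0
      have := hpos (lt_of_le_of_ne (not_lt.1 hm0) hm.ne_zero.symm)
      omega
  refine ⟨(vertices z).subtype (· ∈ vertices m), ?_⟩
  rw [prodV, Finset.prod_subtype_of_mem (fun v => v) hsub, prod_vertices hzs]

theorem prime_dvd_prodV_iff (hm : m ≠ 0) {p : ℕ} (hp : p.Prime) (W : Finset (vertices m)) :
    (p : ℤ) ∣ prodV W ↔ ∃ v ∈ W, (v : ℤ) = p := by
  have hpp : Prime (p : ℤ) := Nat.prime_iff_prime_int.1 hp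
  rw [prodV, hpp.dvd_finsetProd_iff]
  refine exists_congr fun v => and_congr_right fun _ => ⟨fun h => ?_, fun h => by rw [h]⟩
  rcases vertex_cases hm v with ⟨q, hq, -, hvq⟩ | ⟨-, hv⟩
  · rw [hvq] at h ⊢
    rw [(Nat.prime_dvd_prime_iff_eq hp hq).1 (by exact_mod_cast h)]
  · rw [hv, Int.dvd_neg] at h
    exact absurd (isUnit_of_dvd_one h) hpp.not_isUnit

theorem prodV_neg_iff (hm : m ≠ 0) (W : Finset (vertices m)) :
    prodV W < 0 ↔ ∃ v ∈ W, (v : ℤ) = -1 := by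
  have hpos : ∀ W : Finset (vertices m), (¬ ∃ v ∈ W, (v : ℤ) = -1) → 0 < prodV W := by
    intro W hW
    refine Finset.prod_pos fun v hv => ?_
    rcases vertex_cases hm v with ⟨q, hq, -, hvq⟩ | ⟨-, hv'⟩
    · rw [hvq]; exact_mod_cast hq.pos
    · exact absurd ⟨v, hv, hv'⟩ hW
  constructor
  · intro h
    by_contra hW
    exact absurd (hpos W hW) (not_lt.2 h.le)
  · rintro ⟨v, hv, hv1⟩
    have h1 := hpos (W.erase v) (by
      rintro ⟨w, hw, hw1⟩
      exact (Finset.mem_erase.1 hw).1 (Subtype.ext (hw1.trans hv1.symm)))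
    have h2 : (v : ℤ) * prodV (W.erase v) = prodV W := Finset.mul_prod_erase W _ hv
    rw [hv1] at h2
    omega

/-- The prime divisors and the sign of the product recover the set. -/
theorem prodV_injective (hm : m ≠ 0) : Function.Injective (prodV (m := m)) := by
  have key : ∀ U W : Finset (vertices m), prodV U = prodV W → U ⊆ W := by
    intro U W h v hv
    have : ∃ w ∈ W, (w : ℤ) = v := by
      rcases vertex_cases hm v with ⟨q, hq, -, hvq⟩ | ⟨-, hv1⟩
      · rw [hvq, ← prime_dvd_prodV_iff hm hq, ← h, prime_dvd_prodV_iff hm hq]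
        exact ⟨v, hv, hvq⟩
      · rw [hv1, ← prodV_neg_iff hm, ← h, prodV_neg_iff hm]
        exact ⟨v, hv, hv1⟩
    obtain ⟨w, hw, hwv⟩ := this
    rwa [← Subtype.ext hwv]
  exact fun U W h => Finset.Subset.antisymm (key U W h) (key W U h.symm)

theorem isNontrivialPartition_iff (hm : Squarefree m) (W : Finset (vertices m)) :
    IsNontrivialPartition W ↔ prodV W ≠ 1 ∧ prodV W ≠ m := by
  have h1 : prodV (∅ : Finset (vertices m)) = 1 := Finset.prod_empty
  have h2 : prodV (Finset.univ : Finset (vertices m)) = m := by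
    have := prodV_mul_compl hm (Finset.univ : Finset (vertices m))
    rwa [Finset.compl_univ, h1, mul_one] at this
  have inj := prodV_injective hm.ne_zero
  -- The definition forms the complement with classical decidable equality; `convert` reconciles it
  -- with the instance on integers.
  have h' : IsNontrivialPartition W ↔ W.Nonempty ∧ Wᶜ.Nonempty := by
    unfold IsNontrivialPartition
    convert Iff.rfl
  rw [h', Finset.nonempty_iff_ne_empty, Finset.nonempty_iff_ne_empty, ne_eq,
    ne_eq, Finset.compl_eq_empty_iff]
  refine and_congr (not_congr ?_) (not_congr ?_)
  · rw [← inj.eq_iff, h1]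
  · rw [← inj.eq_iff, h2]

theorem isOddPartition_compl (W : Finset (vertices m)) :
    IsOddPartition (graphG m) Wᶜ ↔ IsOddPartition (graphG m) W := by
  classical
  have h : IsOddPartition (graphG m) Wᶜ ↔ (∃ v ∈ Wᶜ, Odd (arcsTo (graphG m) v (Wᶜ)ᶜ)) ∨
      ∃ v ∈ (Wᶜ)ᶜ, Odd (arcsTo (graphG m) v Wᶜ) := by
    unfold IsOddPartition
    convert Iff.rfl
  have h' : IsOddPartition (graphG m) W ↔ (∃ v ∈ W, Odd (arcsTo (graphG m) v Wᶜ)) ∨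
      ∃ v ∈ Wᶜ, Odd (arcsTo (graphG m) v W) := by
    unfold IsOddPartition
    convert Iff.rfl
  rw [h, h', compl_compl, or_comm]

theorem legendreSym_prod (p : ℕ) [Fact p.Prime] {ι : Type*} (s : Finset ι) (f : ι → ℤ) :
    legendreSym p (∏ i ∈ s, f i) = ∏ i ∈ s, legendreSym p (f i) :=
  map_prod (legendreSym.hom p) f s

theorem legendreSym_vertex (hm : m ≠ 0) {p : ℕ} [hp : Fact p.Prime] {v : vertices m}
    (hv : (v : ℤ) ≠ p) : legendreSym p v = 1 ∨ legendreSym p v = -1 := by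
  have hpp : Prime (p : ℤ) := Nat.prime_iff_prime_int.1 Fact.out
  apply legendreSym.eq_one_or_neg_one
  rw [ne_eq, ZMod.intCast_zmod_eq_zero_iff_dvd]
  intro h
  rcases vertex_cases hm v with ⟨q, hq, -, hvq⟩ | ⟨-, hv1⟩
  · rw [hvq] at h hv
    have hpq : p = q := (Nat.prime_dvd_prime_iff_eq hp.out hq).1 (by exact_mod_cast h)
    exact hv (by rw [hpq])
  · rw [hv1, Int.dvd_neg] at h
    exact absurd (isUnit_of_dvd_one h) hpp.not_isUnit

/-- Multiplicativity: each arc from `p` to `W` contributes a factor `-1` to the Legendre symbol of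
the product, every other vertex a factor `1`. -/
theorem even_arcsTo_iff (hm : m ≠ 0) {p : ℕ} [Fact p.Prime] (hp : p ≡ 1 [MOD 3])
    {v : vertices m} (hv : (v : ℤ) = p) {W : Finset (vertices m)} (hvW : v ∉ W) :
    Even (arcsTo (graphG m) v W) ↔ legendreSym p (prodV W) = 1 := by
  classical
  have h1 : legendreSym p (prodV W) = (-1) ^ arcsTo (graphG m) v W := by
    rw [prodV, legendreSym_prod, arcsTo, ← Finset.prod_const, Finset.prod_filter]
    refine Finset.prod_congr rfl fun w hw => ?_
    have hwp : (w : ℤ) ≠ p := by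
      intro h
      exact hvW (by rwa [Subtype.ext (hv.trans h.symm)])
    have hadj : (graphG m).Adj v w ↔ legendreSym p w = -1 := by
      constructor
      · rintro ⟨q, hq, hvq, -, h⟩
        have : p = q := by
          rw [hv] at hvq
          exact_mod_cast hvq
        subst this
        exact h
      · intro h
        exact ⟨p, inferInstance, hv, hp, h⟩
    split_ifs with h
    · exact hadj.1 h
    · exact (legendreSym_vertex hm hwp).resolve_right (fun h' => h (hadj.2 h'))
  rw [h1, neg_one_pow_eq_one_iff_even (by decide)]

theorem arcsTo_eq_zero {v : vertices m} (hv : ¬ ∃ p : ℕ, p.Prime ∧ (v : ℤ) = p ∧ p ≡ 1 [MOD 3])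
    (W : Finset (vertices m)) : arcsTo (graphG m) v W = 0 := by
  classical
  rw [arcsTo, Finset.card_eq_zero, Finset.filter_eq_empty_iff]
  rintro w - ⟨p, hp, hvp, hp3, -⟩
  exact hv ⟨p, hp.out, hvp, hp3⟩

end Vertices

/-! ### Even partitions, counting, and the symbol at 3 -/

/-- For `m = d e` squarefree and `p ∣ m`: the square class of `d` at `p` is that of `1` or `m`. -/
def EvenAt (p : ℕ) [Fact p.Prime] (d e : ℤ) : Prop :=
  ((p : ℤ) ∣ d → legendreSym p e = 1) ∧ (¬ (p : ℤ) ∣ d → legendreSym p d = 1)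

/-- Only primes `≡ 1 (mod 3)` emit arcs. Such a `p` sees the opposite part, whose product is `e` or
`d` according to the side of `p`, exactly as in `EvenAt`. -/
theorem not_isOddPartition_iff {m : ℤ} (hm : Squarefree m) (W : Finset (vertices m)) :
    ¬ IsOddPartition (graphG m) W ↔ ∀ (p : ℕ) [Fact p.Prime], p ≡ 1 [MOD 3] → (p : ℤ) ∣ m →
      EvenAt p (prodV W) (prodV Wᶜ) := by
  classical
  have h0 := hm.ne_zero
  have h' : IsOddPartition (graphG m) W ↔ (∃ v ∈ W, Odd (arcsTo (graphG m) v Wᶜ)) ∨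
      ∃ v ∈ Wᶜ, Odd (arcsTo (graphG m) v W) := by
    unfold IsOddPartition
    convert Iff.rfl
  rw [h']
  push Not
  simp only [Nat.not_odd_iff_even]
  constructor
  · rintro ⟨h1, h2⟩ p _ hp hpm
    have hvm : (p : ℤ) ∈ vertices m := (mem_vertices_iff h0).2 (Or.inl ⟨p, Fact.out, hpm, rfl⟩)
    have hmem : (p : ℤ) ∣ prodV W ↔ (⟨p, hvm⟩ : vertices m) ∈ W := by
      rw [prime_dvd_prodV_iff h0 Fact.out]
      constructor
      · rintro ⟨v, hv, hvp⟩
        rwa [← show v = ⟨p, hvm⟩ from Subtype.ext hvp]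
      · exact fun h => ⟨_, h, rfl⟩
    rw [EvenAt, hmem]
    refine ⟨fun h => ?_, fun h => ?_⟩
    · exact (even_arcsTo_iff h0 hp (v := ⟨p, hvm⟩) rfl (by simpa using h)).1 (h1 _ h)
    · exact (even_arcsTo_iff h0 hp (v := ⟨p, hvm⟩) rfl h).1 (h2 _ (Finset.mem_compl.2 h))
  · intro h
    refine ⟨fun v hv => ?_, fun v hv => ?_⟩
    · by_cases hvp : ∃ p : ℕ, p.Prime ∧ (v : ℤ) = p ∧ p ≡ 1 [MOD 3]
      · obtain ⟨p, hp, hvp, hp3⟩ := hvp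
        have : Fact p.Prime := ⟨hp⟩
        have hd : (p : ℤ) ∣ prodV W := (prime_dvd_prodV_iff h0 hp W).2 ⟨v, hv, hvp⟩
        rw [even_arcsTo_iff h0 hp3 hvp (by simpa using hv)]
        exact (h p hp3 (hd.trans ⟨_, (prodV_mul_compl hm W).symm⟩)).1 hd
      · rw [arcsTo_eq_zero hvp]; exact Even.zero
    · by_cases hvp : ∃ p : ℕ, p.Prime ∧ (v : ℤ) = p ∧ p ≡ 1 [MOD 3]
      · obtain ⟨p, hp, hvp, hp3⟩ := hvp
        have : Fact p.Prime := ⟨hp⟩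
        have hd' : (p : ℤ) ∣ prodV Wᶜ := (prime_dvd_prodV_iff h0 hp Wᶜ).2 ⟨v, hv, hvp⟩
        have hd : ¬ (p : ℤ) ∣ prodV W := by
          rw [prime_dvd_prodV_iff h0 hp]
          rintro ⟨w, hw, hwp⟩
          rw [Subtype.ext (hwp.trans hvp.symm)] at hw
          exact Finset.mem_compl.1 hv hw
        rw [even_arcsTo_iff h0 hp3 hvp (Finset.mem_compl.1 hv)]
        exact (h p hp3 (hd'.trans ⟨prodV W, by rw [mul_comm, prodV_mul_compl hm W]⟩)).2 hd
      · rw [arcsTo_eq_zero hvp]; exact Even.zero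

theorem evenAt_iff_isSquare {p : ℕ} [Fact p.Prime] (hp : p ≠ 2) {m d e : ℤ} (hm : Squarefree m)
    (hde : d * e = m) (hpm : (p : ℤ) ∣ m) :
    (IsSquare (d : ℚ_[p]) ∨ IsSquare ((m : ℚ_[p]) * d)) ↔ EvenAt p d e := by
  subst hde
  exact padic_isSquare_or_isSquare_mul_iff hp hm hpm

/-- Characters with values `±1` on a set `V`, at least three fewer than the elements of `V`, have
at least eight common zeros among the subsets of `V`. -/
theorem eight_le_card_common_kernel {V J : Type*} [Fintype V] [DecidableEq V] [Fintype J]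
    [DecidableEq J] (g : J → V → ℤ) (hg : ∀ j v, g j v = 1 ∨ g j v = -1)
    (hcard : Fintype.card J + 3 ≤ Fintype.card V) :
    8 ≤ (Finset.univ.filter fun U : Finset V => ∀ j, ∏ v ∈ U, g j v = 1).card := by
  classical
  let F : Finset V → J → ℤ := fun U j => ∏ v ∈ U, g j v
  have hF : ∀ U j, F U j = 1 ∨ F U j = -1 := by
    intro U j
    have h1 : IsUnit (F U j) := by
      refine IsUnit.prod_iff.2 fun v _ => Int.isUnit_iff.2 (hg j v)
    exact Int.isUnit_iff.1 h1
  let T : Finset (J → ℤ) := Fintype.piFinset fun _ => {1, -1}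
  have hT : T.card = 2 ^ Fintype.card J := by
    rw [Fintype.card_piFinset]
    simp
  have hmaps : ∀ U ∈ (Finset.univ : Finset (Finset V)), F U ∈ T := by
    intro U _
    rw [Fintype.mem_piFinset]
    intro j
    simpa using hF U j
  -- Pigeonhole: `2^|V|` subsets map to at most `2^|J|` sign vectors, so some fibre has at least 8
  -- elements.
  obtain ⟨y, -, hy⟩ := Finset.exists_le_card_fiber_of_mul_le_card_of_maps_to hmaps
    ⟨_, hmaps ∅ (Finset.mem_univ _)⟩ (n := 8) (by
      rw [hT, Finset.card_univ, Fintype.card_finset]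
      calc 2 ^ Fintype.card J * 8 = 2 ^ (Fintype.card J + 3) := by rw [pow_add]; norm_num
        _ ≤ _ := Nat.pow_le_pow_right (by norm_num) hcard)
  obtain ⟨U₀, hU₀⟩ : ∃ U₀, F U₀ = y := by
    obtain ⟨U₀, h⟩ := Finset.card_pos.1 (lt_of_lt_of_le (by norm_num : 0 < 8) hy)
    exact ⟨U₀, (Finset.mem_filter.1 h).2⟩
  -- Symmetric difference is the group law on subsets; translating by a member of the fibre carries
  -- it injectively into the kernel.
  refine hy.trans (Finset.card_le_card_of_injOn (fun U => symmDiff U U₀) ?_ ?_)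
  · intro U hU
    have hUy := (Finset.mem_filter.1 (Finset.mem_coe.1 hU)).2
    simp only [Finset.coe_filter, Finset.mem_univ, true_and, Set.mem_ofPred_eq]
    intro j
    have h1 : F U j = F U₀ j := by rw [hU₀, hUy]
    have h2 : F U j = (∏ v ∈ U \ U₀, g j v) * ∏ v ∈ U ∩ U₀, g j v := by
      rw [mul_comm, Finset.prod_inter_mul_prod_sdiff]
    have h3 : F U₀ j = (∏ v ∈ U₀ \ U, g j v) * ∏ v ∈ U ∩ U₀, g j v := by
      rw [mul_comm, Finset.inter_comm, Finset.prod_inter_mul_prod_sdiff]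
    have h4 : ∏ v ∈ symmDiff U U₀, g j v = (∏ v ∈ U \ U₀, g j v) * ∏ v ∈ U₀ \ U, g j v := by
      rw [symmDiff_def, Finset.sup_eq_union, Finset.prod_union disjoint_sdiff_sdiff]
    have h5 : F (U ∩ U₀) j ≠ 0 := by
      rcases hF (U ∩ U₀) j with h | h <;> rw [h] <;> decide
    have h6 : ∏ v ∈ U \ U₀, g j v = ∏ v ∈ U₀ \ U, g j v := by
      apply mul_right_cancel₀ h5
      change _ * ∏ v ∈ U ∩ U₀, g j v = _ * ∏ v ∈ U ∩ U₀, g j v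
      rw [← h2, ← h3, h1]
    rw [h4, h6]
    rcases hF (U₀ \ U) j with h | h
    · change F _ j * F _ j = 1
      rw [h]; norm_num
    · change F _ j * F _ j = 1
      rw [h]; norm_num
  · intro U _ W _ h
    exact symmDiff_left_injective U₀ h
theorem padic_isSquare_squarefree_iff {p : ℕ} [Fact p.Prime] (hp : p ≠ 2) {d : ℤ}
    (hd : Squarefree d) : IsSquare (d : ℚ_[p]) ↔ legendreSym p d = 1 := by
  have hpp : Prime (p : ℤ) := Nat.prime_iff_prime_int.1 Fact.out
  by_cases h : (p : ℤ) ∣ d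
  · have h2 : ¬ (p : ℤ) ^ 2 ∣ d := fun h' => hpp.not_isUnit (hd _ (by rwa [← pow_two]))
    simp [padic_not_isSquare_intCast h h2, (legendreSym.eq_zero_iff p d).2
      ((ZMod.intCast_zmod_eq_zero_iff_dvd d p).2 h)]
  · exact padic_isSquare_intCast_iff hp h

theorem not_dvd_of_legendreSym_eq_one {p : ℕ} [Fact p.Prime] {d : ℤ} (h : legendreSym p d = 1) :
    ¬ (p : ℤ) ∣ d := by
  intro h'
  rw [(legendreSym.eq_zero_iff p d).2 ((ZMod.intCast_zmod_eq_zero_iff_dvd d p).2 h')] at h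
  exact absurd h (by decide)

/-- Expresses `EvenAt` through a character on vertex sets by giving the vertex `p` the value `(m/p
over p)`. If `p ∣ d`, then `m/p = (d/p) e`, so the product is the symbol of `(d/p)² e`, that is of
`e`. -/
theorem evenAt_of_prod_eq_one {m : ℤ} (hm : Squarefree m) {p : ℕ} [hp : Fact p.Prime]
    (W : Finset (vertices m))
    (h : ∏ v ∈ W, legendreSym p (if (v : ℤ) = p then m / p else v) = 1) :
    EvenAt p (prodV W) (prodV Wᶜ) := by
  classical
  have hpp : Prime (p : ℤ) := Nat.prime_iff_prime_int.1 hp.out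
  refine ⟨fun hd => ?_, fun hd => ?_⟩
  · obtain ⟨v, hv, hvp⟩ := (prime_dvd_prodV_iff hm.ne_zero hp.out W).1 hd
    have h1 : (p : ℤ) * prodV (W.erase v) = prodV W := by
      rw [← hvp]
      exact Finset.mul_prod_erase W _ hv
    have h2 : m / p = prodV (W.erase v) * prodV Wᶜ := by
      refine Int.ediv_eq_of_eq_mul_right hpp.ne_zero ?_
      rw [← mul_assoc, h1, prodV_mul_compl hm W]
    have h3 : ∏ v ∈ W.erase v, legendreSym p (if (v : ℤ) = p then m / p else v)
        = legendreSym p (prodV (W.erase v)) := by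
      rw [prodV, legendreSym_prod]
      refine Finset.prod_congr rfl fun w hw => ?_
      rw [if_neg fun hwp => (Finset.mem_erase.1 hw).1 (Subtype.ext (hwp.trans hvp.symm))]
    have h4 : ((prodV (W.erase v) : ℤ) : ZMod p) ≠ 0 := by
      rw [ne_eq, ZMod.intCast_zmod_eq_zero_iff_dvd]
      intro h5
      refine hpp.not_isUnit (prodV_squarefree hm W _ ?_)
      rw [← h1]
      exact mul_dvd_mul_left _ h5
    rw [← Finset.mul_prod_erase W _ hv, h3, if_pos hvp, h2, legendreSym.mul] at h
    have h5 := legendreSym.sq_one p h4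
    linear_combination h - legendreSym p (prodV Wᶜ) * h5
  · rw [prodV, legendreSym_prod, ← h]
    refine Finset.prod_congr rfl fun w hw => ?_
    rw [if_neg fun hwp => hd ((prime_dvd_prodV_iff hm.ne_zero hp.out W).2 ⟨w, hw, hwp⟩)]

open NumberTheorySymbols in
theorem jacobiSym_eq_one_of_forall {a : ℤ} {b : ℕ}
    (h : ∀ (p : ℕ) [Fact p.Prime], p ∣ b → legendreSym p a = 1) : J(a | b) = 1 := by
  unfold jacobiSym
  refine List.prod_eq_one fun x hx => ?_
  obtain ⟨p, hp, rfl⟩ := List.mem_pmap.1 hx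
  have : Fact p.Prime := ⟨Nat.prime_of_mem_primeFactorsList hp⟩
  exact h p (Nat.dvd_of_mem_primeFactorsList hp)

/-- Reciprocity equates the symbol of `d` over `e` with that of `e` over `d`, which is 1. Every
prime factor of `e` other than 3 contributes 1, so the factor at 3 is 1 as well. -/
theorem legendreSym_three_of_reciprocity {d e : ℤ} (hsq : Squarefree (d * e))
    (hd : d ≡ 1 [ZMOD 4]) (he : Odd e) (hpos : 0 < d ∨ 0 < e) (h3 : 3 ∣ e)
    (h1 : ∀ (p : ℕ) [Fact p.Prime], (p : ℤ) ∣ d → legendreSym p e = 1)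
    (h2 : ∀ (p : ℕ) [Fact p.Prime], p ≠ 3 → (p : ℤ) ∣ e → legendreSym p d = 1) :
    legendreSym 3 d = 1 := by
  have hrec := jacobiSym_natAbs_reciprocity hd he hpos
  rw [jacobiSym_eq_one_of_forall (a := e) (b := d.natAbs)
    fun p _ hp => h1 p (Int.natCast_dvd.2 hp)] at hrec
  obtain ⟨k, rfl⟩ := h3
  have hk0 : k.natAbs ≠ 0 := by
    rintro h
    rw [Int.natAbs_eq_zero.1 h] at hsq
    simp at hsq
  rw [Int.natAbs_mul, jacobiSym.mul_right' d (by decide) hk0,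
    jacobiSym_eq_one_of_forall (a := d) (b := k.natAbs) fun p _ hp => ?_, mul_one] at hrec
  · rw [jacobiSym.legendreSym.to_jacobiSym]
    exact hrec
  · have hpk : (p : ℤ) ∣ k := Int.natCast_dvd.2 hp
    refine h2 p ?_ (hpk.mul_left 3)
    rintro rfl
    have : (3 : ℤ) * 3 ∣ d * (3 * k) := (mul_dvd_mul_left 3 hpk).mul_left d
    exact absurd (Int.isUnit_iff.1 (hsq _ this)) (by decide)

/-! ### Arithmetic of `n` and integers representing `D` -/

/-- The hypotheses on `n = 3 m`, `m = p₁ ⋯ pₜ q₁ ⋯ qₛ`. -/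
structure IsAdmissible (Ps Qs : Finset ℕ) (n m : ℤ) : Prop where
  prime_P : ∀ p ∈ Ps, p.Prime ∧ 5 ≤ p ∧ p ≡ 1 [MOD 3]
  prime_Q : ∀ q ∈ Qs, q.Prime ∧ 5 ≤ q ∧ q ≡ 2 [MOD 3]
  m_eq : m = (∏ p ∈ Ps, (p : ℤ)) * ∏ q ∈ Qs, (q : ℤ)
  n_eq : n = 3 * m
  n_mod : n ≡ 3 [ZMOD 24]

namespace IsAdmissible
variable {Ps Qs : Finset ℕ} {n m : ℤ} (H : IsAdmissible Ps Qs n m)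
include H

theorem disjoint : Disjoint Ps Qs := by
  rw [Finset.disjoint_left]
  intro p hp hq
  have h1 := (H.prime_P p hp).2.2
  have h2 := (H.prime_Q p hq).2.2
  simp only [Nat.ModEq] at h1 h2
  omega

theorem three_notMem : 3 ∉ Ps ∪ Qs := by
  rw [Finset.mem_union]
  rintro (h | h)
  · have := (H.prime_P 3 h).2.1; omega
  · have := (H.prime_Q 3 h).2.1; omega

theorem n_eq_prod : n = ((∏ p ∈ insert 3 (Ps ∪ Qs), p : ℕ) : ℤ) := by
  rw [Finset.prod_insert H.three_notMem, Finset.prod_union H.disjoint, H.n_eq, H.m_eq]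
  push_cast
  rfl

theorem prime_of_mem {p : ℕ} (hp : p ∈ insert 3 (Ps ∪ Qs)) : p.Prime := by
  rw [Finset.mem_insert, Finset.mem_union] at hp
  rcases hp with rfl | hp | hp
  · exact Nat.prime_three
  · exact (H.prime_P p hp).1
  · exact (H.prime_Q p hp).1

theorem n_pos : 0 < n := by
  rw [H.n_eq_prod]
  exact_mod_cast Finset.prod_pos fun p hp => (H.prime_of_mem hp).pos

theorem prime_dvd_n_iff {p : ℕ} (hp : p.Prime) :
    (p : ℤ) ∣ n ↔ p = 3 ∨ p ∈ Ps ∨ p ∈ Qs := by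
  rw [H.n_eq_prod, Int.natCast_dvd_natCast, hp.prime.dvd_finsetProd_iff, ← Finset.mem_union,
    ← Finset.mem_insert]
  constructor
  · rintro ⟨q, hq, hpq⟩
    rwa [(Nat.prime_dvd_prime_iff_eq hp (H.prime_of_mem hq)).1 hpq]
  · exact fun h => ⟨p, h, dvd_rfl⟩

theorem squarefree : Squarefree n := by
  rw [H.n_eq_prod, Int.squarefree_natCast]
  refine Finset.squarefree_prod_of_pairwise_isCoprime ?_ fun p hp => (H.prime_of_mem hp).squarefree
  intro p hp q hq hpq
  exact Nat.coprime_iff_isRelPrime.1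
    ((Nat.coprime_primes (H.prime_of_mem hp) (H.prime_of_mem hq)).2 hpq)

theorem odd : Odd n := by
  have : n % 24 = 3 := H.n_mod
  rw [Int.odd_iff]
  omega

theorem sq_not_dvd {p : ℕ} (hp : p.Prime) : ¬ (p : ℤ) ^ 2 ∣ n := fun h =>
  (Nat.prime_iff_prime_int.1 hp).not_isUnit (H.squarefree _ (by rwa [← pow_two]))

theorem m_mod : m % 8 = 1 := by
  have h1 : n % 24 = 3 := H.n_mod
  have h2 := H.n_eq
  omega

theorem prod_P_mod (S : Finset ℕ) (hS : S ⊆ Ps) : (∏ p ∈ S, (p : ℤ)) ≡ 1 [ZMOD 3] := by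
  have : ∀ p ∈ S, ((p : ℤ) : ZMod 3) = 1 := fun p hp => by
    have := (ZMod.natCast_eq_natCast_iff p 1 3).2 (H.prime_P p (hS hp)).2.2
    exact_mod_cast this
  refine (ZMod.intCast_eq_intCast_iff _ 1 3).1 ?_
  rw [Int.cast_prod, Finset.prod_eq_one this, Int.cast_one]

theorem m_modEq : m ≡ (-1) ^ Qs.card [ZMOD 3] := by
  have h2 : (∏ q ∈ Qs, (q : ℤ)) ≡ (-1) ^ Qs.card [ZMOD 3] := by
    refine (ZMod.intCast_eq_intCast_iff _ _ 3).1 ?_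
    rw [Int.cast_prod, ← Finset.prod_const, Int.cast_prod]
    refine Finset.prod_congr rfl fun q hq => ?_
    have := (ZMod.natCast_eq_natCast_iff q 2 3).2 (H.prime_Q q hq).2.2
    push_cast at this ⊢
    rw [this]
    decide
  rw [H.m_eq]
  simpa using (H.prod_P_mod Ps subset_rfl).mul h2

theorem even_card (h : m ≡ 1 [ZMOD 3]) : Even Qs.card := by
  by_contra h'
  have h1 := H.m_modEq
  rw [(Nat.not_even_iff_odd.1 h').neg_one_pow] at h1
  exact absurd (h.symm.trans h1) (by decide)

theorem odd_card (h : m ≡ 2 [ZMOD 3]) : Odd Qs.card := by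
  by_contra h'
  have h1 := H.m_modEq
  rw [(Nat.not_odd_iff_even.1 h').neg_one_pow] at h1
  exact absurd (h.symm.trans h1) (by decide)

theorem m_mod_three : m ≡ 1 [ZMOD 3] ∨ m ≡ 2 [ZMOD 3] := by
  have h1 := H.m_modEq
  rcases neg_one_pow_eq_or ℤ Qs.card with h | h
  · rw [h] at h1; exact Or.inl h1
  · rw [h] at h1; exact Or.inr (h1.trans (by decide))

theorem prime_dvd_disc_iff {p : ℕ} (hp : p.Prime) :
    (p : ℤ) ∣ disc (coeffA n) (coeffB n) ↔ p = 2 ∨ (p : ℤ) ∣ n := by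
  have hpp : Prime (p : ℤ) := Nat.prime_iff_prime_int.1 hp
  rw [disc_coeff]
  constructor
  · intro h
    rw [show (144 : ℤ) * n ^ 6 = 2 ^ 4 * (3 ^ 2 * n ^ 6) by ring] at h
    rcases hpp.dvd_or_dvd h with h | h
    · left
      have := hpp.dvd_of_dvd_pow h
      exact (Nat.prime_dvd_prime_iff_eq hp Nat.prime_two).1 (by exact_mod_cast this)
    · right
      rcases hpp.dvd_or_dvd h with h | h
      · exact (hpp.dvd_of_dvd_pow h).trans ⟨m, H.n_eq⟩
      · exact hpp.dvd_of_dvd_pow h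
  · rintro (rfl | h)
    · exact ⟨72 * n ^ 6, by push_cast; ring⟩
    · exact (dvd_pow h (by decide)).mul_left _

theorem exists_of_mem_groupD {c : ℚˣ ⧸ Subgroup.square ℚˣ}
    (hc : c ∈ groupD (coeffA n) (coeffB n)) :
    ∃ z : ℤ, Squarefree z ∧ z ∣ 2 * n ∧ c = sqClass (z : ℚ) := by
  -- Squarefreeness is not preserved by products, so the induction carries only the prime support;
  -- the square part is removed afterwards.
  have key : ∃ z : ℤ, z ≠ 0 ∧ (∀ p : ℕ, p.Prime → (p : ℤ) ∣ z → (p : ℤ) ∣ 2 * n) ∧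
      c = sqClass (z : ℚ) := by
    induction hc using Subgroup.closure_induction with
    | mem x hx =>
      rcases hx with rfl | ⟨p, hp, hpd, rfl⟩
      · refine ⟨-1, by norm_num, fun p hp h => ?_, by norm_num⟩
        rw [Int.dvd_neg] at h
        exact absurd (isUnit_of_dvd_one h) (Nat.prime_iff_prime_int.1 hp).not_isUnit
      · refine ⟨p, by exact_mod_cast hp.ne_zero, fun q hq h => ?_, by norm_cast⟩
        rw [(Nat.prime_dvd_prime_iff_eq hq hp).1 (by exact_mod_cast h)]
        rcases (H.prime_dvd_disc_iff hp).1 hpd with rfl | h'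
        · exact ⟨n, by push_cast; ring⟩
        · exact h'.mul_left 2
    | one =>
      refine ⟨1, one_ne_zero, fun p hp h => ?_, by rw [Int.cast_one, sqClass_one]⟩
      exact absurd (isUnit_of_dvd_one h) (Nat.prime_iff_prime_int.1 hp).not_isUnit
    | mul x y _ _ hx hy =>
      obtain ⟨a, ha0, ha, rfl⟩ := hx
      obtain ⟨b, hb0, hb, rfl⟩ := hy
      refine ⟨a * b, mul_ne_zero ha0 hb0, fun p hp h => ?_, ?_⟩
      · exact ((Nat.prime_iff_prime_int.1 hp).dvd_or_dvd h).elim (ha p hp) (hb p hp)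
      · rw [Int.cast_mul, sqClass_mul (by exact_mod_cast ha0) (by exact_mod_cast hb0)]
    | inv x _ hx =>
      obtain ⟨a, ha0, ha, rfl⟩ := hx
      exact ⟨a, ha0, ha, sqClass_inv (by exact_mod_cast ha0)⟩
  obtain ⟨z, hz0, hz, rfl⟩ := key
  obtain ⟨a, b, hab, ha⟩ := Nat.sq_mul_squarefree z.natAbs
  have hb0 : (b : ℤ) ≠ 0 := by
    rintro h
    have : b = 0 := by exact_mod_cast h
    rw [this] at hab
    simp [eq_comm, hz0] at hab
  have hw : ∃ w : ℤ, w.natAbs = a ∧ z = b ^ 2 * w := by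
    have hab' : (b : ℤ) ^ 2 * a = z.natAbs := by exact_mod_cast hab
    rcases Int.natAbs_eq z with h | h
    · exact ⟨a, Int.natAbs_natCast a, by rw [hab', ← h]⟩
    · exact ⟨-a, by simp, by rw [mul_neg, hab', ← h]⟩
  obtain ⟨w, rfl, rfl⟩ := hw
  have hws := Int.squarefree_natAbs.1 ha
  refine ⟨w, hws, ?_, ?_⟩
  · rw [← Int.natAbs_dvd_natAbs, ← Nat.prod_primeFactors_of_squarefree ha]
    refine Finset.prod_primes_dvd _ (fun p hp => (Nat.prime_of_mem_primeFactors hp).prime)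
      fun p hp => ?_
    exact Int.natCast_dvd.1 (hz p (Nat.prime_of_mem_primeFactors hp)
      ((Int.natCast_dvd.2 (Nat.dvd_of_mem_primeFactors hp)).mul_left _))
  · have hw0 : (w : ℚ) ≠ 0 := by exact_mod_cast hws.ne_zero
    rw [sqClass_eq_iff (by exact_mod_cast hz0) hw0]
    exact ⟨b * w, by push_cast; ring⟩

theorem sqClass_mem_groupD {z : ℤ} (hz : z ∣ n) :
    sqClass (z : ℚ) ∈ groupD (coeffA n) (coeffB n) := by
  have hzs := H.squarefree.squarefree_of_dvd hz
  rw [← prod_vertices hzs]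
  have key : ∀ S ⊆ vertices z,
      sqClass ((∏ v ∈ S, v : ℤ) : ℚ) ∈ groupD (coeffA n) (coeffB n) ∧ ∏ v ∈ S, v ≠ 0 := by
    intro S
    induction S using Finset.induction_on with
    | empty =>
      intro _
      rw [Finset.prod_empty, Int.cast_one, sqClass_one]
      exact ⟨one_mem _, one_ne_zero⟩
    | insert v S hv ih =>
      intro hS
      obtain ⟨h1, h2⟩ := ih fun x hx => hS (Finset.mem_insert_of_mem hx)
      have hv' : sqClass (v : ℚ) ∈ groupD (coeffA n) (coeffB n) ∧ v ≠ 0 := by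
        rcases (mem_vertices_iff hzs.ne_zero).1 (hS (Finset.mem_insert_self v S)) with
          ⟨p, hp, hpz, rfl⟩ | ⟨-, rfl⟩
        · refine ⟨Subgroup.subset_closure (Or.inr ⟨p, hp, ?_, by norm_cast⟩),
            by exact_mod_cast hp.ne_zero⟩
          exact (H.prime_dvd_disc_iff hp).2 (Or.inr (hpz.trans hz))
        · exact ⟨Subgroup.subset_closure (Or.inl (by norm_num)), by norm_num⟩
      rw [Finset.prod_insert hv, Int.cast_mul,
        sqClass_mul (by exact_mod_cast hv'.2) (by exact_mod_cast h2)]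
      exact ⟨mul_mem hv'.1 h1, mul_ne_zero hv'.2 h2⟩
  exact (key _ subset_rfl).1

end IsAdmissible

theorem Int.dvd_of_dvd_two_mul_of_odd {n z : ℤ} (hz : z ∣ 2 * n) (hodd : Odd z) : z ∣ n := by
  obtain ⟨k, rfl⟩ := hodd
  exact IsCoprime.dvd_of_dvd_mul_left ⟨1, -k, by ring⟩ hz

/-! ### The Selmer groups in terms of vertex sets -/

namespace IsAdmissible
variable {Ps Qs : Finset ℕ} {n m : ℤ} (H : IsAdmissible Ps Qs n m)
include H

theorem n_modEq_eight : n ≡ 3 [ZMOD 8] := by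
  have : n % 24 = 3 := H.n_mod
  simp only [Int.ModEq]
  omega

/-- The real place, the primes `q_j`, and 3 when `m ≡ 2 (mod 3)` impose nothing, because the local
image is everything there. -/
theorem sqClass_mem_selmerS'_iff {z : ℤ} (hz : Squarefree z) :
    sqClass (z : ℚ) ∈ selmerS' (coeffA n) (coeffB n) ↔
      sqClass (z : ℚ) ∈ groupD (coeffA n) (coeffB n) ∧ z ≡ 1 [ZMOD 4] ∧
      (∀ (p : ℕ) [Fact p.Prime], p ∈ Ps →
        IsSquare (z : ℚ_[p]) ∨ IsSquare (((-n : ℤ) : ℚ_[p]) * z)) ∧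
      (m ≡ 1 [ZMOD 3] → IsSquare (z : ℚ_[3]) ∨ IsSquare (((-n : ℤ) : ℚ_[3]) * z)) := by
  have hz0 : (z : ℚ) ≠ 0 := by exact_mod_cast hz.ne_zero
  have hz4 : ¬ (4 : ℤ) ∣ z := fun h => by
    have := Int.isUnit_iff.1 (hz 2 (by norm_num; exact h))
    omega
  have hsq : ∀ p : ℕ, p.Prime → ¬ (p : ℤ) ^ 2 ∣ z := fun p hp h =>
    (Nat.prime_iff_prime_int.1 hp).not_isUnit (hz _ (by rwa [← pow_two]))
  rw [selmerS', Set.mem_ofPred_eq]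
  refine and_congr_right fun _ => ?_
  rw [localMap_sqClass ℝ hz0, Rat.cast_intCast]
  have hreal := mem_range_real H.n_pos (a := (z : ℝ)) (by exact_mod_cast hz.ne_zero)
  simp only [hreal, true_and, localMap_sqClass _ hz0, Rat.cast_intCast]
  constructor
  · intro h
    refine ⟨?_, fun p hp hpP => ?_, fun hm => ?_⟩
    · rw [← mem_range_two_iff H.n_modEq_eight hz4]
      exact h 2 ((H.prime_dvd_disc_iff Nat.prime_two).2 (Or.inl rfl))
    · obtain ⟨-, h5, h1⟩ := H.prime_P p hpP
      have hpn := (H.prime_dvd_n_iff hp.out).2 (Or.inr (Or.inl hpP))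
      rw [← mem_range_one_mod_three_iff (by omega) h1 hz.ne_zero hpn (H.sq_not_dvd hp.out)]
      exact h p ((H.prime_dvd_disc_iff hp.out).2 (Or.inr hpn))
    · have := h 3 ((H.prime_dvd_disc_iff Nat.prime_three).2 (Or.inr ⟨m, H.n_eq⟩))
      rw [H.n_eq] at this ⊢
      rwa [mem_range_three_iff hm hz.ne_zero] at this
  · rintro ⟨h2, hP, h3⟩ p hp hpd
    rcases (H.prime_dvd_disc_iff hp.out).1 hpd with rfl | hpn
    · exact (mem_range_two_iff H.n_modEq_eight hz4).2 h2
    rcases (H.prime_dvd_n_iff hp.out).1 hpn with rfl | hpP | hpQ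
    · rw [H.n_eq] at h3 ⊢
      rcases H.m_mod_three with hm | hm
      · exact (mem_range_three_iff hm hz.ne_zero).2 (h3 hm)
      · exact mem_range_three_of_two hm hz.ne_zero (by exact_mod_cast hsq 3 Nat.prime_three)
    · obtain ⟨-, h5, h1⟩ := H.prime_P p hpP
      exact (mem_range_one_mod_three_iff (by omega) h1 hz.ne_zero hpn (H.sq_not_dvd hp.out)).2
        (hP p hpP)
    · obtain ⟨-, h5, h1⟩ := H.prime_Q p hpQ
      exact mem_range_two_mod_three (by omega) h1 hz.ne_zero (hsq p hp.out) hpn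
        (H.sq_not_dvd hp.out)

theorem sqClass_mem_selmerS_iff {z : ℤ} (hz : Squarefree z) :
    sqClass (z : ℚ) ∈ selmerS (coeffA n) (coeffB n) ↔
      sqClass (z : ℚ) ∈ groupD (coeffA n) (coeffB n) ∧ 0 < z ∧ Odd z ∧
      (∀ (p : ℕ) [Fact p.Prime], p ∈ Ps →
        IsSquare (z : ℚ_[p]) ∨ IsSquare ((n : ℚ_[p]) * z)) ∧
      (∀ (q : ℕ) [Fact q.Prime], q ∈ Qs → legendreSym q z = 1) ∧
      (m ≡ 1 [ZMOD 3] → IsSquare (z : ℚ_[3]) ∨ IsSquare ((n : ℚ_[3]) * z)) ∧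
      (m ≡ 2 [ZMOD 3] → legendreSym 3 z = 1) := by
  have hz0 : (z : ℚ) ≠ 0 := by exact_mod_cast hz.ne_zero
  have hz4 : ¬ (4 : ℤ) ∣ z := fun h => by
    have := Int.isUnit_iff.1 (hz 2 (by norm_num; exact h))
    omega
  rw [selmerS, Set.mem_ofPred_eq]
  refine and_congr_right fun _ => ?_
  rw [localMap_sqClass ℝ hz0, Rat.cast_intCast]
  have hreal := mem_range_isogenous_real_iff H.n_pos (a := (z : ℝ)) (by exact_mod_cast hz.ne_zero)
  simp only [hreal, localMap_sqClass _ hz0, Rat.cast_intCast, Int.cast_pos]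
  refine and_congr_right fun _ => ?_
  constructor
  · intro h
    refine ⟨?_, fun p hp hpP => ?_, fun p hp hpQ => ?_, fun hm => ?_, fun hm => ?_⟩
    · rw [← mem_range_isogenous_two_iff H.n_modEq_eight hz4]
      exact h 2 ((H.prime_dvd_disc_iff Nat.prime_two).2 (Or.inl rfl))
    · obtain ⟨-, h5, h1⟩ := H.prime_P p hpP
      have hpn := (H.prime_dvd_n_iff hp.out).2 (Or.inr (Or.inl hpP))
      rw [← mem_range_isogenous_one_mod_three_iff (by omega) h1 hz.ne_zero hpn
        (H.sq_not_dvd hp.out)]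
      exact h p ((H.prime_dvd_disc_iff hp.out).2 (Or.inr hpn))
    · obtain ⟨-, h5, h1⟩ := H.prime_Q p hpQ
      have hpn := (H.prime_dvd_n_iff hp.out).2 (Or.inr (Or.inr hpQ))
      rw [← padic_isSquare_squarefree_iff (by omega) hz,
        ← mem_range_isogenous_two_mod_three_iff (by omega) h1 (by omega) hz.ne_zero hpn
        (H.sq_not_dvd hp.out)]
      exact h p ((H.prime_dvd_disc_iff hp.out).2 (Or.inr hpn))
    · have := h 3 ((H.prime_dvd_disc_iff Nat.prime_three).2 (Or.inr ⟨m, H.n_eq⟩))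
      rw [H.n_eq] at this ⊢
      rwa [mem_range_isogenous_three_iff hm hz.ne_zero] at this
    · have := h 3 ((H.prime_dvd_disc_iff Nat.prime_three).2 (Or.inr ⟨m, H.n_eq⟩))
      rw [H.n_eq, mem_range_isogenous_three_of_two_iff hm hz.ne_zero] at this
      exact (padic_isSquare_squarefree_iff (by decide) hz).1 this
  · rintro ⟨h2, hP, hQ, h3, h3'⟩ p hp hpd
    rcases (H.prime_dvd_disc_iff hp.out).1 hpd with rfl | hpn
    · exact (mem_range_isogenous_two_iff H.n_modEq_eight hz4).2 h2
    rcases (H.prime_dvd_n_iff hp.out).1 hpn with rfl | hpP | hpQ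
    · rcases H.m_mod_three with hm | hm
      · rw [H.n_eq] at h3 ⊢
        exact (mem_range_isogenous_three_iff hm hz.ne_zero).2 (h3 hm)
      · rw [H.n_eq]
        exact (mem_range_isogenous_three_of_two_iff hm hz.ne_zero).2
          ((padic_isSquare_squarefree_iff (by decide) hz).2 (h3' hm))
    · obtain ⟨-, h5, h1⟩ := H.prime_P p hpP
      exact (mem_range_isogenous_one_mod_three_iff (by omega) h1 hz.ne_zero hpn
        (H.sq_not_dvd hp.out)).2 (hP p hpP)
    · obtain ⟨-, h5, h1⟩ := H.prime_Q p hpQ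
      exact (mem_range_isogenous_two_mod_three_iff (by omega) h1 (by omega) hz.ne_zero hpn
        (H.sq_not_dvd hp.out)).2 ((padic_isSquare_squarefree_iff (by omega) hz).2 (hQ p hpQ))

theorem odd_of_dvd {z : ℤ} (hz : z ∣ n) : Odd z := by
  obtain ⟨k, hk⟩ := hz
  have h := H.odd
  rw [hk, Int.odd_mul] at h
  exact h.1

theorem squarefree_neg : Squarefree (-n) := 
  H.squarefree.squarefree_of_dvd (neg_dvd.2 dvd_rfl)

theorem prime_one_mod_three_dvd_iff {p : ℕ} (hp : p.Prime) :
    p ≡ 1 [MOD 3] ∧ (p : ℤ) ∣ n ↔ p ∈ Ps := by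
  rw [H.prime_dvd_n_iff hp]
  constructor
  · rintro ⟨h1, rfl | h | h⟩
    · exact absurd h1 (by decide)
    · exact h
    · have h2 := (H.prime_Q p h).2.2
      simp only [Nat.ModEq] at h1 h2
      omega
  · exact fun h => ⟨(H.prime_P p h).2.2, Or.inr (Or.inl h)⟩

theorem not_isOddPartition_neg_iff (W : Finset (vertices (-n))) :
    ¬ IsOddPartition (graphG (-n)) W ↔
      ∀ (p : ℕ) [Fact p.Prime], p ∈ Ps → EvenAt p (prodV W) (prodV Wᶜ) := by
  rw [not_isOddPartition_iff H.squarefree_neg]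
  constructor
  · intro h p hp hpP
    obtain ⟨h1, h2⟩ := (H.prime_one_mod_three_dvd_iff hp.out).2 hpP
    exact h p h1 (by rwa [Int.dvd_neg])
  · intro h p hp h1 h2
    rw [Int.dvd_neg] at h2
    exact h p ((H.prime_one_mod_three_dvd_iff hp.out).1 ⟨h1, h2⟩)

theorem not_isOddPartition_pos_iff (W : Finset (vertices n)) :
    ¬ IsOddPartition (graphG n) W ↔
      ∀ (p : ℕ) [Fact p.Prime], p ∈ Ps → EvenAt p (prodV W) (prodV Wᶜ) := by
  rw [not_isOddPartition_iff H.squarefree]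
  constructor
  · intro h p hp hpP
    obtain ⟨h1, h2⟩ := (H.prime_one_mod_three_dvd_iff hp.out).2 hpP
    exact h p h1 h2
  · intro h p hp h1 h2
    exact h p ((H.prime_one_mod_three_dvd_iff hp.out).1 ⟨h1, h2⟩)

theorem prodV_mem_selmerS'_iff (W : Finset (vertices (-n))) :
    sqClass (prodV W : ℚ) ∈ selmerS' (coeffA n) (coeffB n) ↔
      prodV W ≡ 1 [ZMOD 4] ∧ ¬ IsOddPartition (graphG (-n)) W ∧
      (m ≡ 1 [ZMOD 3] → EvenAt 3 (prodV W) (prodV Wᶜ)) := by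
  have hdvd : prodV W ∣ n := by
    rw [← Int.dvd_neg]
    exact ⟨_, (prodV_mul_compl H.squarefree_neg W).symm⟩
  rw [H.sqClass_mem_selmerS'_iff (prodV_squarefree H.squarefree_neg W),
    H.not_isOddPartition_neg_iff]
  simp only [H.sqClass_mem_groupD hdvd, true_and]
  refine and_congr_right fun _ => and_congr ?_ ?_
  · refine forall_congr' fun p => forall_congr' fun hp => forall_congr' fun hpP => ?_
    have h5 := (H.prime_P p hpP).2.1
    exact evenAt_iff_isSquare (by omega) H.squarefree_neg (prodV_mul_compl H.squarefree_neg W)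
      (by rw [Int.dvd_neg]; exact (H.prime_dvd_n_iff hp.out).2 (Or.inr (Or.inl hpP)))
  · refine imp_congr_right fun _ => ?_
    exact evenAt_iff_isSquare (by decide) H.squarefree_neg (prodV_mul_compl H.squarefree_neg W)
      (by rw [Int.dvd_neg]; exact ⟨m, H.n_eq⟩)

theorem prodV_mem_selmerS_iff (W : Finset (vertices n)) :
    sqClass (prodV W : ℚ) ∈ selmerS (coeffA n) (coeffB n) ↔
      ¬ IsOddPartition (graphG n) W ∧
      (∀ (q : ℕ) [Fact q.Prime], q ∈ Qs → legendreSym q (prodV W) = 1) ∧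
      (m ≡ 1 [ZMOD 3] → EvenAt 3 (prodV W) (prodV Wᶜ)) ∧
      (m ≡ 2 [ZMOD 3] → legendreSym 3 (prodV W) = 1) := by
  have hdvd : prodV W ∣ n := ⟨_, (prodV_mul_compl H.squarefree W).symm⟩
  have hpos : 0 < prodV W := by
    refine lt_of_le_of_ne (not_lt.1 ?_) (prodV_squarefree H.squarefree W).ne_zero.symm
    rw [prodV_neg_iff H.squarefree.ne_zero]
    rintro ⟨v, -, hv⟩
    rcases vertex_cases H.squarefree.ne_zero v with ⟨q, -, -, hq⟩ | ⟨h, -⟩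
    · omega
    · exact absurd h (not_lt.2 H.n_pos.le)
  have hodd : Odd (prodV W) := H.odd_of_dvd hdvd
  rw [H.sqClass_mem_selmerS_iff (prodV_squarefree H.squarefree W),
    H.not_isOddPartition_pos_iff]
  simp only [H.sqClass_mem_groupD hdvd, hpos, hodd, true_and]
  refine and_congr ?_ (and_congr_right fun _ => and_congr ?_ Iff.rfl)
  · refine forall_congr' fun p => forall_congr' fun hp => forall_congr' fun hpP => ?_
    have h5 := (H.prime_P p hpP).2.1
    exact evenAt_iff_isSquare (by omega) H.squarefree (prodV_mul_compl H.squarefree W)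
      ((H.prime_dvd_n_iff hp.out).2 (Or.inr (Or.inl hpP)))
  · refine imp_congr_right fun _ => ?_
    exact evenAt_iff_isSquare (by decide) H.squarefree (prodV_mul_compl H.squarefree W)
      ⟨m, H.n_eq⟩

theorem exists_of_mem_selmerS' {c : ℚˣ ⧸ Subgroup.square ℚˣ}
    (hc : c ∈ selmerS' (coeffA n) (coeffB n)) :
    ∃ W : Finset (vertices (-n)), c = sqClass (prodV W : ℚ) := by
  obtain ⟨z, hz, hzn, rfl⟩ := H.exists_of_mem_groupD hc.1
  have h4 : z % 4 = 1 := ((H.sqClass_mem_selmerS'_iff hz).1 hc).2.1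
  obtain ⟨W, rfl⟩ := exists_prodV_eq H.squarefree_neg (z := z)
    (by rw [Int.dvd_neg]; exact Int.dvd_of_dvd_two_mul_of_odd hzn (by rw [Int.odd_iff]; omega))
    (fun h => by have := H.n_pos; omega)
  exact ⟨W, rfl⟩

theorem exists_of_mem_selmerS {c : ℚˣ ⧸ Subgroup.square ℚˣ}
    (hc : c ∈ selmerS (coeffA n) (coeffB n)) :
    ∃ W : Finset (vertices n), c = sqClass (prodV W : ℚ) := by
  obtain ⟨z, hz, hzn, rfl⟩ := H.exists_of_mem_groupD hc.1
  obtain ⟨-, hpos, hodd, -⟩ := (H.sqClass_mem_selmerS_iff hz).1 hc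
  obtain ⟨W, rfl⟩ := exists_prodV_eq H.squarefree (z := z) (Int.dvd_of_dvd_two_mul_of_odd hzn hodd) fun _ => hpos
  exact ⟨W, rfl⟩

/-- The four listed classes come from 2-torsion and always lie in `S'(E)`, with `n/3 = m`; only the
absence of further classes is at stake. -/
theorem selmerS'_eq_iff :
    selmerS' (coeffA n) (coeffB n) =
        {1, sqClass (-(n : ℚ)), sqClass ((n : ℚ) / 3), sqClass (-3 : ℚ)} ↔
      ∀ W : Finset (vertices (-n)), prodV W ≡ 1 [ZMOD 4] → ¬ IsOddPartition (graphG (-n)) W →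
        (m ≡ 1 [ZMOD 3] → EvenAt 3 (prodV W) (prodV Wᶜ)) →
        prodV W = 1 ∨ prodV W = -n ∨ prodV W = m ∨ prodV W = -3 := by
  have hm : Squarefree m := H.squarefree.squarefree_of_dvd ⟨3, by rw [H.n_eq]; ring⟩
  have hm8 := H.m_mod
  have hn8 : n % 8 = 3 := H.n_modEq_eight
  have h3 : Squarefree (-3 : ℤ) :=
    Int.prime_three.squarefree.squarefree_of_dvd (neg_dvd.2 dvd_rfl)
  have e1 : (1 : ℚˣ ⧸ Subgroup.square ℚˣ) = sqClass ((1 : ℤ) : ℚ) := by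
    rw [Int.cast_one, sqClass_one]
  have e2 : sqClass (-(n : ℚ)) = sqClass ((-n : ℤ) : ℚ) := by push_cast; rfl
  have e3 : sqClass ((n : ℚ) / 3) = sqClass ((m : ℤ) : ℚ) := by
    rw [H.n_eq]; push_cast; congr 1; ring
  have e4 : sqClass (-3 : ℚ) = sqClass ((-3 : ℤ) : ℚ) := by push_cast; rfl
  rw [e1, e2, e3, e4]
  constructor
  · intro h W h1 h2 h3'
    have hW := (H.prodV_mem_selmerS'_iff W).2 ⟨h1, h2, h3'⟩
    have hs := prodV_squarefree H.squarefree_neg W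
    rw [h] at hW
    rcases hW with hW | hW | hW | hW
    · exact Or.inl (sqClass_intCast_injective hs squarefree_one hW)
    · exact Or.inr (Or.inl (sqClass_intCast_injective hs H.squarefree_neg hW))
    · exact Or.inr (Or.inr (Or.inl (sqClass_intCast_injective hs hm hW)))
    · exact Or.inr (Or.inr (Or.inr (sqClass_intCast_injective hs h3 hW)))
  · intro h
    apply Set.Subset.antisymm
    · intro c hc
      obtain ⟨W, rfl⟩ := H.exists_of_mem_selmerS' hc
      obtain ⟨h1, h2, h3'⟩ := (H.prodV_mem_selmerS'_iff W).1 hc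
      rcases h W h1 h2 h3' with h | h | h | h <;> rw [h] <;> simp
    · have hsqm : m ≡ 1 [ZMOD 3] → IsSquare (m : ℚ_[3]) := fun h =>
        (padic_three_isSquare_iff (Or.inl h)).2 h
      have hP3 : ∀ (p : ℕ) [Fact p.Prime], p ∈ Ps → IsSquare (-3 : ℚ_[p]) := fun p _ hp =>
        padic_isSquare_neg_three (by have := (H.prime_P p hp).2.1; omega) (H.prime_P p hp).2.2
      rintro c (rfl | rfl | rfl | rfl)
      · refine (H.sqClass_mem_selmerS'_iff squarefree_one).2
          ⟨H.sqClass_mem_groupD (one_dvd n), rfl, fun p _ _ => Or.inl ⟨1, by simp⟩,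
            fun _ => Or.inl ⟨1, by simp⟩⟩
      · refine (H.sqClass_mem_selmerS'_iff H.squarefree_neg).2
          ⟨H.sqClass_mem_groupD ⟨-1, by ring⟩, ?_, fun p _ _ => Or.inr ⟨_, rfl⟩,
            fun _ => Or.inr ⟨_, rfl⟩⟩
        simp only [Int.ModEq]
        omega
      · refine (H.sqClass_mem_selmerS'_iff hm).2
          ⟨H.sqClass_mem_groupD ⟨3, by rw [H.n_eq]; ring⟩, ?_, fun p _ hp => Or.inr ?_,
            fun h => Or.inl (hsqm h)⟩
        · simp only [Int.ModEq]
          omega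
        · obtain ⟨r, hr⟩ := hP3 p hp
          refine ⟨r * m, ?_⟩
          rw [H.n_eq]
          push_cast
          linear_combination (m : ℚ_[p]) ^ 2 * hr
      · refine (H.sqClass_mem_selmerS'_iff h3).2
          ⟨H.sqClass_mem_groupD ⟨-m, by rw [H.n_eq]; ring⟩, by decide, fun p _ hp => Or.inl ?_,
            fun h => Or.inr ?_⟩
        · simpa using hP3 p hp
        · obtain ⟨r, hr⟩ := hsqm h
          refine ⟨3 * r, ?_⟩
          rw [H.n_eq]
          push_cast
          linear_combination 9 * hr

theorem selmerS_eq_iff :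
    selmerS (coeffA n) (coeffB n) = {1} ↔
      ∀ W : Finset (vertices n), ¬ IsOddPartition (graphG n) W →
        (∀ (q : ℕ) [Fact q.Prime], q ∈ Qs → legendreSym q (prodV W) = 1) →
        (m ≡ 1 [ZMOD 3] → EvenAt 3 (prodV W) (prodV Wᶜ)) →
        (m ≡ 2 [ZMOD 3] → legendreSym 3 (prodV W) = 1) → prodV W = 1 := by
  have e1 : (1 : ℚˣ ⧸ Subgroup.square ℚˣ) = sqClass ((1 : ℤ) : ℚ) := by
    rw [Int.cast_one, sqClass_one]
  rw [e1]
  constructor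
  · intro h W h1 h2 h3 h4
    have hW := (H.prodV_mem_selmerS_iff W).2 ⟨h1, h2, h3, h4⟩
    rw [h] at hW
    exact sqClass_intCast_injective (prodV_squarefree H.squarefree W) squarefree_one hW
  · intro h
    apply Set.Subset.antisymm
    · intro c hc
      obtain ⟨W, rfl⟩ := H.exists_of_mem_selmerS hc
      obtain ⟨h1, h2, h3, h4⟩ := (H.prodV_mem_selmerS_iff W).1 hc
      rw [h W h1 h2 h3 h4]
      rfl
    · rintro c rfl
      refine (H.sqClass_mem_selmerS_iff squarefree_one).2
        ⟨H.sqClass_mem_groupD (one_dvd n), one_pos, odd_one, fun p _ _ => Or.inl ⟨1, by simp⟩,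
          fun q _ _ => legendreSym.at_one q, fun _ => Or.inl ⟨1, by simp⟩,
          fun _ => legendreSym.at_one 3⟩

theorem card_vertices_neg : Ps.card + Qs.card + 2 ≤ Fintype.card (vertices (-n)) := by
  classical
  have hsub : insert (-1) ((insert 3 (Ps ∪ Qs)).image fun p : ℕ => (p : ℤ)) ⊆ vertices (-n) := by
    intro v hv
    rw [mem_vertices_iff H.squarefree_neg.ne_zero]
    rw [Finset.mem_insert, Finset.mem_image] at hv
    rcases hv with rfl | ⟨p, hp, rfl⟩
    · exact Or.inr ⟨by have := H.n_pos; omega, rfl⟩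
    · refine Or.inl ⟨p, H.prime_of_mem hp, ?_, rfl⟩
      rw [Int.dvd_neg, H.prime_dvd_n_iff (H.prime_of_mem hp)]
      simpa using hp
  have h := Finset.card_le_card hsub
  rw [Finset.card_insert_of_notMem (by
      rw [Finset.mem_image]
      rintro ⟨p, -, hp⟩
      omega),
    Finset.card_image_of_injective _ (f := fun p : ℕ => (p : ℤ)) Int.ofNat_injective,
    Finset.card_insert_of_notMem H.three_notMem, Finset.card_union_of_disjoint H.disjoint] at h
  rw [Fintype.card_coe]
  omega

/-- There are `t + s + 2` vertices and only `t + 2` sign conditions: one modulo 4, one at 3, one at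
each `p_i`. For `s ≥ 3` at least 8 vertex sets satisfy them, against the 4 allowed products. -/
theorem selmerS'_ne_of_three_le_card (hs : 3 ≤ Qs.card) :
    selmerS' (coeffA n) (coeffB n) ≠
      {1, sqClass (-(n : ℚ)), sqClass ((n : ℚ) / 3), sqClass (-3 : ℚ)} := by
  classical
  rw [ne_eq, H.selmerS'_eq_iff]
  intro h
  have hn0 := H.squarefree_neg.ne_zero
  have hT : ∀ p : (insert 3 Ps : Finset ℕ), (p : ℕ).Prime ∧ (p : ℕ) ≠ 2 ∧ ((p : ℕ) : ℤ) ∣ n := by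
    rintro ⟨p, hp⟩
    have hp' : p ∈ insert 3 (Ps ∪ Qs) := by
      rw [Finset.mem_insert] at hp ⊢
      exact hp.imp_right (Finset.mem_union_left _)
    refine ⟨H.prime_of_mem hp', ?_, ?_⟩
    · change p ≠ 2
      rcases Finset.mem_insert.1 hp with h3 | hp
      · omega
      · have := (H.prime_P p hp).2.1
        omega
    · rw [H.prime_dvd_n_iff (H.prime_of_mem hp')]
      simpa using hp'
  -- `none` carries the condition modulo 4, `some p` the character of `evenAt_of_prod_eq_one`. The
  -- Jacobi symbol is used because it needs no primality instance for `p`.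
  let g : Option (insert 3 Ps : Finset ℕ) → vertices (-n) → ℤ := fun j v =>
    match j with
    | none => ZMod.χ₄ ((v : ℤ) : ZMod 4)
    | some p => jacobiSym (if (v : ℤ) = (p : ℕ) then -n / (p : ℕ) else v) p
  have hg : ∀ j v, g j v = 1 ∨ g j v = -1 := by
    rintro (_ | p) v
    · have hodd : Odd (v : ℤ) := by
        rcases vertex_cases hn0 v with ⟨q, -, hq, hv⟩ | ⟨-, hv⟩
        · rw [hv]
          rw [Int.dvd_neg] at hq
          exact H.odd_of_dvd hq
        · rw [hv]; decide
      have h4 : (v : ℤ) % 4 = 1 ∨ (v : ℤ) % 4 = 3 := by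
        have := Int.odd_iff.1 hodd
        omega
      exact h4.imp ZMod.χ₄_int_one_mod_four ZMod.χ₄_int_three_mod_four
    · obtain ⟨hp, -, hpn⟩ := hT p
      have : Fact (p : ℕ).Prime := ⟨hp⟩
      change jacobiSym _ _ = 1 ∨ jacobiSym _ _ = -1
      rw [← jacobiSym.legendreSym.to_jacobiSym]
      split_ifs with hv
      · apply legendreSym.eq_one_or_neg_one
        rw [ne_eq, ZMod.intCast_zmod_eq_zero_iff_dvd]
        intro h1
        apply H.sq_not_dvd hp
        rw [← Int.dvd_neg, ← Int.mul_ediv_cancel' (Int.dvd_neg.2 hpn), pow_two]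
        exact mul_dvd_mul_left _ h1
      · exact legendreSym_vertex hn0 hv
  have h8 := eight_le_card_common_kernel g hg (by
    rw [Fintype.card_option, Fintype.card_coe, Finset.card_insert_of_notMem
      (fun h3 => H.three_notMem (Finset.mem_union_left _ h3))]
    have := H.card_vertices_neg
    omega)
  have h4 : (Finset.univ.filter fun U : Finset (vertices (-n)) => ∀ j, ∏ v ∈ U, g j v = 1).card
      ≤ ({1, -n, m, -3} : Finset ℤ).card := by
    refine Finset.card_le_card_of_injOn prodV ?_ (prodV_injective hn0).injOn
    intro U hU
    have hU' := (Finset.mem_filter.1 (Finset.mem_coe.1 hU)).2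
    have heven : ∀ (p : ℕ) [Fact p.Prime], p ∈ insert 3 Ps → EvenAt p (prodV U) (prodV Uᶜ) := by
      intro p _ hp
      apply evenAt_of_prod_eq_one H.squarefree_neg
      rw [← hU' (some ⟨p, hp⟩)]
      exact Finset.prod_congr rfl fun v _ => jacobiSym.legendreSym.to_jacobiSym _ _
    have hmod : prodV U ≡ 1 [ZMOD 4] := by
      have h1 : ZMod.χ₄ ((prodV U : ℤ) : ZMod 4) = 1 := by
        rw [prodV, Int.cast_prod, map_prod]
        exact hU' none
      have h2 : Odd (prodV U) := H.odd_of_dvd (by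
        rw [← Int.dvd_neg]
        exact ⟨_, (prodV_mul_compl H.squarefree_neg U).symm⟩)
      have h4 : prodV U % 4 = 1 ∨ prodV U % 4 = 3 := by
        have := Int.odd_iff.1 h2
        omega
      rcases h4 with h4 | h4
      · exact h4
      · rw [ZMod.χ₄_int_three_mod_four h4] at h1
        exact absurd h1 (by decide)
    have := h U hmod ((H.not_isOddPartition_neg_iff U).2 fun p _ hp =>
      heven p (Finset.mem_insert_of_mem hp)) fun _ => heven 3 (Finset.mem_insert_self _ _)
    simpa using this
  have h5 : ({1, -n, m, -3} : Finset ℤ).card ≤ 4 := Finset.card_le_four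
  omega

end IsAdmissible

/-! ### The individual cases of the theorem -/

namespace IsAdmissible
variable {Ps Qs : Finset ℕ} {n m : ℤ} (H : IsAdmissible Ps Qs n m)
include H

theorem prodV_compl_modEq_four {W : Finset (vertices (-n))} (hW : prodV W ≡ 1 [ZMOD 4]) :
    prodV Wᶜ ≡ 1 [ZMOD 4] := by
  have h1 : prodV W * prodV Wᶜ ≡ 1 * prodV Wᶜ [ZMOD 4] := hW.mul_right _
  rw [prodV_mul_compl H.squarefree_neg, one_mul] at h1
  have h2 : n % 8 = 3 := H.n_modEq_eight
  refine h1.symm.trans ?_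
  simp only [Int.ModEq]
  omega

theorem three_dvd_prodV_or {W : Finset (vertices (-n))} :
    (3 : ℤ) ∣ prodV W ∨ (3 : ℤ) ∣ prodV Wᶜ := by
  apply Int.prime_three.dvd_or_dvd
  rw [prodV_mul_compl H.squarefree_neg, Int.dvd_neg]
  exact ⟨m, H.n_eq⟩

/-- If every prime factor of `n` other than `3` is `1` modulo `3`, then the condition at `3`
follows from the conditions at the other primes, by quadratic reciprocity. -/
theorem evenAt_three_of_reciprocity (hs : Qs.card = 0) {W : Finset (vertices (-n))}
    (h4 : prodV W ≡ 1 [ZMOD 4]) (hW : ¬ IsOddPartition (graphG (-n)) W) :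
    EvenAt 3 (prodV W) (prodV Wᶜ) := by
  have hde := prodV_mul_compl H.squarefree_neg W
  have hsq := H.squarefree_neg
  have he4 := H.prodV_compl_modEq_four h4
  have h3 := H.three_dvd_prodV_or (W := W)
  rw [H.not_isOddPartition_neg_iff] at hW
  have hn := H.n_pos
  generalize prodV W = d at *
  generalize prodV Wᶜ = e at *
  -- The product `de = -n` is negative, so reciprocity has no sign at infinity.
  have hpos : 0 < d ∨ 0 < e := by
    by_contra h
    push Not at h
    have := mul_nonneg_of_nonpos_of_nonpos h.1 h.2
    omega
  have hodd : ∀ x : ℤ, x ≡ 1 [ZMOD 4] → Odd x := fun x hx => by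
    have : x % 4 = 1 := hx
    rw [Int.odd_iff]
    omega
  have hP : ∀ p : ℕ, p.Prime → p ≠ 3 → (p : ℤ) ∣ d * e → p ∈ Ps := by
    intro p hp hp3 hpd
    rw [hde, Int.dvd_neg, H.prime_dvd_n_iff hp, Finset.card_eq_zero.1 hs] at hpd
    simpa [hp3] using hpd
  have hcop : ∀ p : ℕ, p.Prime → (p : ℤ) ∣ d → ¬ (p : ℤ) ∣ e := by
    intro p hp h1 h2
    apply H.sq_not_dvd hp
    rw [← Int.dvd_neg, ← hde, pow_two]
    exact mul_dvd_mul h1 h2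
  rw [← hde] at hsq
  constructor
  -- Both `d` and `e` are 1 modulo 4, so the same reciprocity lemma applies with the two exchanged
  -- when 3 divides `d`.
  · intro h3d
    refine legendreSym_three_of_reciprocity (by rwa [mul_comm]) he4 (hodd d h4) hpos.symm h3d
      (fun p hp hpe => ?_) fun p hp hp3 hpd => ?_
    · have hp3 : p ≠ 3 := by
        rintro rfl
        exact hcop 3 Nat.prime_three h3d hpe
      exact (hW p (hP p hp.out hp3 (hpe.mul_left _))).2 fun h => hcop p hp.out h hpe
    · exact (hW p (hP p hp.out hp3 (hpd.mul_right _))).1 hpd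
  · intro h3d
    refine legendreSym_three_of_reciprocity hsq h4 (hodd e he4) hpos (h3.resolve_left h3d)
      (fun p hp hpd => ?_) fun p hp hp3 hpe => ?_
    · have hp3 : p ≠ 3 := by
        rintro rfl
        exact h3d hpd
      exact (hW p (hP p hp.out hp3 (hpd.mul_right _))).1 hpd
    · exact (hW p (hP p hp.out hp3 (hpe.mul_left _))).2 fun h => hcop p hp.out h hpe

theorem selmerS'_eq_iff_of_two (hm : m ≡ 2 [ZMOD 3]) :
    selmerS' (coeffA n) (coeffB n) =
        {1, sqClass (-(n : ℚ)), sqClass ((n : ℚ) / 3), sqClass (-3 : ℚ)} ↔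
      Qs.card = 1 ∧ ∀ W : Finset (vertices (-n)), IsNontrivialPartition W →
        prodV W ≠ -3 → prodV W ≠ m → prodV W ≡ 1 [ZMOD 4] →
        IsOddPartition (graphG (-n)) W := by
  have hm1 : ¬ m ≡ 1 [ZMOD 3] := fun h => absurd (h.symm.trans hm) (by decide)
  constructor
  · intro h
    have hs : ¬ 3 ≤ Qs.card := fun hs => H.selmerS'_ne_of_three_le_card hs h
    refine ⟨?_, fun W hW h3 hWm h4 => ?_⟩
    · obtain ⟨k, hk⟩ := H.odd_card hm
      omega
    · by_contra hodd
      rw [isNontrivialPartition_iff H.squarefree_neg] at hW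
      rcases H.selmerS'_eq_iff.1 h W h4 hodd fun h => absurd h hm1 with h | h | h | h
      · exact hW.1 h
      · exact hW.2 h
      · exact hWm h
      · exact h3 h
  · rintro ⟨-, h⟩
    rw [H.selmerS'_eq_iff]
    intro W h4 hodd _
    by_contra hne
    push Not at hne
    exact hodd (h W ((isNontrivialPartition_iff H.squarefree_neg W).2 ⟨hne.1, hne.2.1⟩)
      hne.2.2.2 hne.2.2.1 h4)

theorem selmerS'_eq_iff_of_card_zero (hs : Qs.card = 0) :
    selmerS' (coeffA n) (coeffB n) =
        {1, sqClass (-(n : ℚ)), sqClass ((n : ℚ) / 3), sqClass (-3 : ℚ)} ↔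
      ∀ W : Finset (vertices (-n)), IsNontrivialPartition W →
        prodV W ≠ -3 → prodV W ≠ m → prodV W ≡ 1 [ZMOD 4] →
        IsOddPartition (graphG (-n)) W := by
  rw [H.selmerS'_eq_iff]
  constructor
  · intro h W hW h3 hWm h4
    by_contra hodd
    rw [isNontrivialPartition_iff H.squarefree_neg] at hW
    rcases h W h4 hodd fun _ => H.evenAt_three_of_reciprocity hs h4 hodd with h | h | h | h
    · exact hW.1 h
    · exact hW.2 h
    · exact hWm h
    · exact h3 h
  · intro h W h4 hodd _
    by_contra hne
    push Not at hne
    exact hodd (h W ((isNontrivialPartition_iff H.squarefree_neg W).2 ⟨hne.1, hne.2.1⟩)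
      hne.2.2.2 hne.2.2.1 h4)

/-- Complementation preserves both parity and the class 1 modulo 4, so one may assume that 3 does
not divide `d`. Then `EvenAt` at 3 says `d ≡ 1 (mod 3)`. The value `-3` needs no separate exclusion,
its complement being `m`. -/
theorem selmerS'_eq_iff_of_one (hm : m ≡ 1 [ZMOD 3]) :
    selmerS' (coeffA n) (coeffB n) =
        {1, sqClass (-(n : ℚ)), sqClass ((n : ℚ) / 3), sqClass (-3 : ℚ)} ↔
      ∀ W : Finset (vertices (-n)), IsNontrivialPartition W →
        prodV W ≠ m → prodV W ≡ 1 [ZMOD 12] → IsOddPartition (graphG (-n)) W := by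
  rw [H.selmerS'_eq_iff]
  have hn0 := H.squarefree.ne_zero
  have key : ∀ x : ℤ, ¬ (3 : ℤ) ∣ x → x ≡ 1 [ZMOD 4] → legendreSym 3 x = 1 →
      x ≡ 1 [ZMOD 12] := by
    intro x _ h4 h3
    rw [legendreSym_three_eq_one_iff] at h3
    simp only [Int.ModEq] at *
    omega
  constructor
  · intro h W hW hWm h12
    by_contra hodd
    rw [isNontrivialPartition_iff H.squarefree_neg] at hW
    have h4 : prodV W ≡ 1 [ZMOD 4] := h12.of_dvd (by decide)
    have h3 : prodV W ≡ 1 [ZMOD 3] := h12.of_dvd (by decide)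
    have hn3 : ¬ (3 : ℤ) ∣ prodV W := by
      simp only [Int.ModEq] at h3
      omega
    rcases h W h4 hodd fun _ => ⟨fun h => absurd h hn3, fun _ => legendreSym_three_of_one h3⟩
      with h | h | h | h
    · exact hW.1 h
    · exact hW.2 h
    · exact hWm h
    · rw [h] at hn3
      exact hn3 (by decide)
  · intro h W h4 hodd h3
    have hde := prodV_mul_compl H.squarefree_neg W
    obtain ⟨h31, h32⟩ := h3 hm
    by_contra hne
    push Not at hne
    by_cases h3d : (3 : ℤ) ∣ prodV W
    · have he := h31 h3d
      have hne3 : ¬ (3 : ℤ) ∣ prodV Wᶜ := fun h => not_dvd_of_legendreSym_eq_one he h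
      refine hodd ((isOddPartition_compl W).1 (h Wᶜ
        ((isNontrivialPartition_iff H.squarefree_neg _).2 ⟨fun h1 => ?_, fun h1 => ?_⟩)
        (fun h1 => ?_) (key _ hne3 (H.prodV_compl_modEq_four h4) he)))
      · rw [h1, mul_one] at hde
        exact hne.2.1 hde
      · rw [h1] at hde
        exact hne.1 ((mul_eq_right₀ (neg_ne_zero.2 hn0)).1 hde)
      · have hm0 : m ≠ 0 := by rintro rfl; exact absurd hm (by decide)
        rw [h1] at hde
        exact hne.2.2.2 (mul_right_cancel₀ hm0 (by linear_combination hde - H.n_eq))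
    · exact hodd (h W ((isNontrivialPartition_iff H.squarefree_neg W).2 ⟨hne.1, hne.2.1⟩)
        hne.2.2.1 (key _ h3d h4 (h32 h3d)))

/-- Without primes `q_j` the class of `n` satisfies every condition: its cofactor is 1. -/
theorem selmerS_ne_of_card_zero (hs : Qs.card = 0) (hm : m ≡ 1 [ZMOD 3]) :
    selmerS (coeffA n) (coeffB n) ≠ {1} := by
  rw [ne_eq, H.selmerS_eq_iff]
  intro h
  obtain ⟨W, hW⟩ := exists_prodV_eq H.squarefree dvd_rfl id
  have he : prodV Wᶜ = 1 := by
    have := prodV_mul_compl H.squarefree W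
    rw [hW] at this
    exact (mul_eq_left₀ H.squarefree.ne_zero).1 this
  have heven : ∀ (p : ℕ) [Fact p.Prime], (p : ℤ) ∣ n → EvenAt p (prodV W) (prodV Wᶜ) := by
    intro p _ hp
    rw [hW, he]
    exact ⟨fun _ => legendreSym.at_one p, fun h => absurd hp h⟩
  have h1 := h W ((H.not_isOddPartition_pos_iff W).2 fun p hp hpP =>
      heven p ((H.prime_dvd_n_iff hp.out).2 (Or.inr (Or.inl hpP))))
    (fun q _ hq => by rw [Finset.card_eq_zero.1 hs] at hq; exact absurd hq (Finset.notMem_empty q))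
    (fun _ => heven 3 ⟨m, H.n_eq⟩) (fun h => absurd (hm.symm.trans h) (by decide))
  have h2 : n % 8 = 3 := H.n_modEq_eight
  omega

theorem vertex_mem_of_legendreSym {W : Finset (vertices n)}
    (hq : ∀ (q : ℕ) [Fact q.Prime], q ∈ Qs → legendreSym q (prodV W) = 1) :
    ∀ v ∈ W, (v : ℤ) = 3 ∨ ∃ p ∈ Ps, (v : ℤ) = (p : ℤ) := by
  intro v hv
  rcases vertex_cases H.squarefree.ne_zero v with ⟨p, hp, hpn, hvp⟩ | ⟨h, -⟩
  · rcases (H.prime_dvd_n_iff hp).1 hpn with rfl | h | h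
    · exact Or.inl hvp
    · exact Or.inr ⟨p, h, hvp⟩
    · have : Fact p.Prime := ⟨hp⟩
      exact absurd ((prime_dvd_prodV_iff H.squarefree.ne_zero hp W).2 ⟨v, hv, hvp⟩)
        (not_dvd_of_legendreSym_eq_one (hq p h))
  · exact absurd h (not_lt.2 H.n_pos.le)

theorem prodV_ne_of_legendreSym (hs : Qs.card ≠ 0) {W : Finset (vertices n)}
    (hq : ∀ (q : ℕ) [Fact q.Prime], q ∈ Qs → legendreSym q (prodV W) = 1) : prodV W ≠ n := by
  obtain ⟨q, hqQ⟩ := Finset.card_ne_zero.1 hs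
  have : Fact q.Prime := ⟨(H.prime_Q q hqQ).1⟩
  intro h
  apply not_dvd_of_legendreSym_eq_one (hq q hqQ)
  rw [h, H.prime_dvd_n_iff (H.prime_Q q hqQ).1]
  exact Or.inr (Or.inr hqQ)

theorem prodV_modEq_one {W : Finset (vertices n)} (hW : ∀ v ∈ W, ∃ p ∈ Ps, (v : ℤ) = (p : ℤ)) :
    prodV W ≡ 1 [ZMOD 3] := by
  refine (ZMod.intCast_eq_intCast_iff _ 1 3).1 ?_
  rw [prodV, Int.cast_prod, Int.cast_one]
  refine Finset.prod_eq_one fun v hv => ?_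
  obtain ⟨p, hp, hvp⟩ := hW v hv
  rw [hvp]
  have := (ZMod.natCast_eq_natCast_iff p 1 3).2 (H.prime_P p hp).2.2
  exact_mod_cast this

/-- A product of primes `p_i` is 1 modulo 3. If `3 ∣ d`, then `(d/3) e = m ≡ 1` and `d/3 ≡ 1`, so `e
≡ 1` as well. -/
theorem evenAt_three {W : Finset (vertices n)} (hm : m ≡ 1 [ZMOD 3])
    (hW : ∀ v ∈ W, (v : ℤ) = 3 ∨ ∃ p ∈ Ps, (v : ℤ) = (p : ℤ)) :
    EvenAt 3 (prodV W) (prodV Wᶜ) := by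
  classical
  have hn0 := H.squarefree.ne_zero
  constructor
  · intro h3
    obtain ⟨v, hv, hv3⟩ := (prime_dvd_prodV_iff hn0 Nat.prime_three W).1 h3
    have h1 := H.prodV_modEq_one (W := W.erase v) fun w hw => by
      refine (hW w (Finset.mem_of_mem_erase hw)).resolve_left fun hw3 => ?_
      exact (Finset.mem_erase.1 hw).1 (Subtype.ext (hw3.trans hv3.symm))
    have h2 : (v : ℤ) * prodV (W.erase v) = prodV W := Finset.mul_prod_erase W _ hv
    have h3 := (prodV_mul_compl H.squarefree W).trans H.n_eq
    rw [← h2, hv3, mul_assoc] at h3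
    have h4 : prodV (W.erase v) * prodV Wᶜ = m :=
      mul_left_cancel₀ (by norm_num : ((3 : ℕ) : ℤ) ≠ 0) h3
    have h5 := h1.mul_right (prodV Wᶜ)
    rw [h4, one_mul] at h5
    exact legendreSym_three_of_one (h5.symm.trans hm)
  · intro h3
    refine legendreSym_three_of_one (H.prodV_modEq_one fun v hv => ?_)
    refine (hW v hv).resolve_left fun hv3 => h3 ?_
    exact (prime_dvd_prodV_iff hn0 Nat.prime_three W).2 ⟨v, hv, hv3⟩

theorem selmerS_eq_iff_of_one (hs : Qs.card ≠ 0) (hm : m ≡ 1 [ZMOD 3]) :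
    selmerS (coeffA n) (coeffB n) = {1} ↔
      ∀ W : Finset (vertices n), IsNontrivialPartition W →
        (∀ v ∈ W, (v : ℤ) = 3 ∨ ∃ p ∈ Ps, (v : ℤ) = (p : ℤ)) →
        (∀ (q : ℕ) [Fact q.Prime], q ∈ Qs → legendreSym q (prodV W) = 1) →
        IsOddPartition (graphG n) W := by
  rw [H.selmerS_eq_iff]
  constructor
  · intro h W hW hWP hq
    by_contra hodd
    rw [isNontrivialPartition_iff H.squarefree] at hW
    exact hW.1 (h W hodd hq (fun _ => H.evenAt_three hm hWP)
      fun h => absurd (hm.symm.trans h) (by decide))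
  · intro h W hodd hq _ _
    by_contra h1
    exact hodd (h W ((isNontrivialPartition_iff H.squarefree W).2
      ⟨h1, H.prodV_ne_of_legendreSym hs hq⟩) (H.vertex_mem_of_legendreSym hq) hq)

/-- The image at 3 is now trivial, so `(d/3) = 1` removes the vertex 3; conversely, a product of
primes `p_i` satisfies this automatically. -/
theorem selmerS_eq_iff_of_two (hs : Qs.card ≠ 0) (hm : m ≡ 2 [ZMOD 3]) :
    selmerS (coeffA n) (coeffB n) = {1} ↔
      ∀ W : Finset (vertices n), IsNontrivialPartition W →
        (∀ v ∈ W, ∃ p ∈ Ps, (v : ℤ) = (p : ℤ)) →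
        (∀ (q : ℕ) [Fact q.Prime], q ∈ Qs → legendreSym q (prodV W) = 1) →
        IsOddPartition (graphG n) W := by
  rw [H.selmerS_eq_iff]
  constructor
  · intro h W hW hWP hq
    by_contra hodd
    rw [isNontrivialPartition_iff H.squarefree] at hW
    exact hW.1 (h W hodd hq (fun h => absurd (h.symm.trans hm) (by decide))
      fun _ => legendreSym_three_of_one (H.prodV_modEq_one hWP))
  · intro h W hodd hq _ h3
    by_contra h1
    refine hodd (h W ((isNontrivialPartition_iff H.squarefree W).2
      ⟨h1, H.prodV_ne_of_legendreSym hs hq⟩) (fun v hv => ?_) hq)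
    refine (H.vertex_mem_of_legendreSym hq v hv).resolve_left fun hv3 => ?_
    exact not_dvd_of_legendreSym_eq_one (h3 hm)
      ((prime_dvd_prodV_iff H.squarefree.ne_zero Nat.prime_three W).2 ⟨v, hv, hv3⟩)

end IsAdmissible

/-! ### Assembly -/

theorem theorem5p2 (Ps Qs : Finset ℕ)
    (hP : ∀ p ∈ Ps, p.Prime ∧ 5 ≤ p ∧ p ≡ 1 [MOD 3])
    (hQ : ∀ q ∈ Qs, q.Prime ∧ 5 ≤ q ∧ q ≡ 2 [MOD 3])
    (hts : 1 ≤ Ps.card + Qs.card)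
    (P Q n : ℤ) (hPdef : P = ∏ p ∈ Ps, (p : ℤ)) (hQdef : Q = ∏ q ∈ Qs, (q : ℤ))
    (hn : n = 3 * P * Q) (hn24 : n ≡ 3 [ZMOD 24]) :
    -- the group S'(E)
    (P * Q ≡ 1 [ZMOD 3] →
      (selmerS' (coeffA n) (coeffB n) =
          {1, sqClass (-(n : ℚ)), sqClass ((n : ℚ) / 3), sqClass (-3 : ℚ)} ↔
        (Qs.card = 0 ∨ Qs.card = 2) ∧
        (Qs.card = 0 → ∀ V₁ : Finset (vertices (-n)), IsNontrivialPartition V₁ →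
          prodV V₁ ≠ -3 → prodV V₁ ≠ P → prodV V₁ ≡ 1 [ZMOD 4] →
          IsOddPartition (graphG (-n)) V₁) ∧
        (Qs.card = 2 → ∀ V₁ : Finset (vertices (-n)), IsNontrivialPartition V₁ →
          prodV V₁ ≠ P * Q → prodV V₁ ≡ 1 [ZMOD 12] →
          IsOddPartition (graphG (-n)) V₁))) ∧
    (P * Q ≡ 2 [ZMOD 3] →
      (selmerS' (coeffA n) (coeffB n) =
          {1, sqClass (-(n : ℚ)), sqClass ((n : ℚ) / 3), sqClass (-3 : ℚ)} ↔
        Qs.card = 1 ∧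
        ∀ V₁ : Finset (vertices (-n)), IsNontrivialPartition V₁ →
          prodV V₁ ≠ -3 → prodV V₁ ≠ P * Q → prodV V₁ ≡ 1 [ZMOD 4] →
          IsOddPartition (graphG (-n)) V₁)) ∧
    -- the group S(E)
    (P * Q ≡ 1 [ZMOD 3] → (Qs.card = 0 ∨ Qs.card = 2) →
      (selmerS (coeffA n) (coeffB n) = {1} ↔
        Qs.card = 2 ∧
        ∀ V₁ : Finset (vertices n), IsNontrivialPartition V₁ →
          (∀ v ∈ V₁, (v : ℤ) = 3 ∨ ∃ p ∈ Ps, (v : ℤ) = (p : ℤ)) →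
          (∀ (q : ℕ) [Fact q.Prime], q ∈ Qs → legendreSym q (prodV V₁) = 1) →
          IsOddPartition (graphG n) V₁)) ∧
    (P * Q ≡ 2 [ZMOD 3] → Qs.card = 1 →
      (selmerS (coeffA n) (coeffB n) = {1} ↔
        ∀ V₁ : Finset (vertices n), IsNontrivialPartition V₁ →
          (∀ v ∈ V₁, ∃ p ∈ Ps, (v : ℤ) = (p : ℤ)) →
          (∀ (q : ℕ) [Fact q.Prime], q ∈ Qs → legendreSym q (prodV V₁) = 1) →
          IsOddPartition (graphG n) V₁)) := by

  have H : IsAdmissible Ps Qs n (P * Q) :=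
    ⟨hP, hQ, by rw [hPdef, hQdef], by rw [hn, mul_assoc], hn24⟩
  refine ⟨fun hm => ?_, fun hm => H.selmerS'_eq_iff_of_two hm, fun hm hs => ?_, fun hm hs => ?_⟩
  · constructor
    · intro h
      have hs : ¬ 3 ≤ Qs.card := fun hs => H.selmerS'_ne_of_three_le_card hs h
      refine ⟨?_, fun h0 => ?_, fun _ => (H.selmerS'_eq_iff_of_one hm).1 h⟩
      · obtain ⟨k, hk⟩ := H.even_card hm
        omega
      -- For `s = 0` the product `Q` is empty, so the excluded value `m` is `P`.
      · have hPQ : P * Q = P := by rw [hQdef, Finset.card_eq_zero.1 h0]; simp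
        have := (H.selmerS'_eq_iff_of_card_zero h0).1 h
        rwa [hPQ] at this
    · rintro ⟨h0 | h2, h⟩
      · have hPQ : P * Q = P := by rw [hQdef, Finset.card_eq_zero.1 h0]; simp
        rw [H.selmerS'_eq_iff_of_card_zero h0, hPQ]
        exact h.1 h0
      · exact (H.selmerS'_eq_iff_of_one hm).2 (h.2 h2)
  · constructor
    · intro h
      rcases hs with h0 | h2
      · exact absurd h (H.selmerS_ne_of_card_zero h0 hm)
      · exact ⟨h2, (H.selmerS_eq_iff_of_one (by omega) hm).1 h⟩
    · rintro ⟨h2, h⟩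
      exact (H.selmerS_eq_iff_of_one (by omega) hm).2 h
  · exact H.selmerS_eq_iff_of_two (by omega) hm
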